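/- **Setting.** Let $X$ be a second countable locally compact (Hausdorff) abelian group with a Haar measure $dx$, $X^\sharp$ its dual group, $\Xi=X\times X^\sharp$, and $\theta$ the action of $X$ by translations, $(\theta_x a)(q)=a(q+x)$. Let $\omega$ be a normalized continuous $2$-cocycle on $X$ with values in $C(X;\mathbb T)$ (the unitary group of the multiplier algebra of $C_0(X)$, with the strict, i.e. compact-open, topology): $\omega(x+y,z)\,\omega(x,y)=\theta_x[\omega(y,z)]\,\omega(x,y+z)$ and $\omega(x,0)=\omega(0,x)=1$. Let $\tau$ be a continuous endomorphism of $X$. Then $L^1(X;C_0(X))$ is a Banach $*$-algebra with $$(\phi\diamond^\omega_\tau\psi)(x)=\int_X\theta_{\tau(y-x)}[\phi(y)]\;\theta_{(1-\tau)y}[\psi(x-y)]\;\theta_{-\tau x}[\omega(y,x-y)]\,dy,$$ $$\phi^{\diamond^\omega_\tau}(x)=\theta_{-\tau x}[\omega(x,-x)^{-1}]\;\theta_{(1-2\tau)x}[\overline{\phi(-x)}].$$ Transport this structure by the partial Fourier transformation $(\mathfrak F\phi)(q,\chi)=\big[\int_X\chi(x)\phi(x)\,dx\big](q)$ to the space $\mathfrak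 FL^1(X;C_0(X))$ of functions on $\Xi$. Let $\mathfrak C=\mathfrak C^\omega_{C_0(X),\tau}$ be the enveloping $C^*$-algebra of the Banach $*$-algebra so obtained, and let $\mathcal N$ be the multiplier algebra of $\mathfrak C$. A *pseudo-trivialization* of $\omega$ is a continuous map $\lambda:X\to C(X;\mathbb T)$ with $\lambda(x)\,\theta_x[\lambda(y)]\,\lambda(x+y)^{-1}=\omega(x,y)$ for all $x,y\in X$. For such $\lambda$ put, for $u\in L^2(X)$, $[T^\lambda(y)u](x)=\lambda(y)(x)\,u(x+y)$, let $r(a)$ be the multiplication by $a$ in $L^2(X)$, and put $[W^\lambda_\tau(y,\chi)u](x)=\chi(-x-\tau y)\,\lambda(y)(x)\,u(x+y)$ (the Weyl system). Let $\mathfrak{Op}^\lambda_\tau$ be given on $\mathfrak FL^1(X;C_0(X))$ by $$\mathfrak{Op}^\lambda_\tau(\mathfrak F\phi)u=\int_X r\big(\theta_{\tau y}[\phi(y)]\big)T^\lambda(y)u\,dy .$$ For a bounded complex Borel measure $\mu$ on $\Xi$ put $(\mathcal F_\Xi\mu)(x,\chi)=\int_\Xi\chi(y)\overline{\kappa(x)}\,\mu(dy,d\kappa)$;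 let $\mathcal F_\Xi\mathbb M(\Xi)$ be the space of all the functions $\mathcal F_\Xi\mu$. For $\xi_0=(x_0,\chi_0)\in\Xi$ let $F_{\xi_0}(x,\chi)=\chi(x_0)\overline{\chi_0(x)}$. **Proposition 3.4.** One has $F_{\xi_0}=\mathcal F_\Xi\delta_{\xi_0}$ for all $\xi_0\in\Xi$, and there is an injective linear map $J:\mathcal F_\Xi\mathbb M(\Xi)\to\mathcal N$ with $J(f)=f\in\mathfrak C\subset\mathcal N$ for every $f\in\mathcal F_\Xi\mathbb M(\Xi)\cap\mathfrak FL^1(X;C_0(X))$ (so $\mathcal F_\Xi\mathbb M(\Xi)\subset\mathcal N$) such that for every pseudo-trivialization $\lambda$ of $\omega$: 1. $\mathfrak{Op}^\lambda_\tau$ extends uniquely from $\mathfrak FL^1(X;C_0(X))$ to a unital $*$-homomorphism $\mathfrak{Op}^\lambda_\tau:\mathcal N\to B(L^2(X))$, and this extension is an isomorphism of $\mathcal N$ onto $B(L^2(X))$; 2. for every bounded complex measure $\mu$ on $\Xi$ and all $u,v\in L^2(X)$, $$\big\langle v,\mathfrak{Op}^\lambda_\tau(J(\mathcal F_\Xi\mu))u\big\rangle=\int_\Xi\big\langle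 v,W^\lambda_\tau(\xi)u\big\rangle\,\mu(d\xi);$$ 3. in particular $\mathfrak{Op}^\lambda_\tau(J(F_{\xi_0}))=W^\lambda_\tau(\xi_0)$ for all $\xi_0\in\Xi$. -/

import Mathlib

open MeasureTheory Filter Topology
open scoped ZeroAtInfty ENNReal

set_option linter.unusedSectionVars false

namespace TwistedWeyl
noncomputable section
universe u
section Basic
variable {X : Type u} [TopologicalSpace X]

lemma continuous_circle_coe : Continuous fun z : Circle => (z : ℂ) := continuous_subtype_val

lemma norm_circle_mul (v : C(X, Circle)) (a : C₀(X, ℂ)) (q : X) :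
    ‖(v q : ℂ) * a q‖ = ‖a q‖ := by
  rw [norm_mul, Circle.norm_coe, one_mul]

/-- The action of the multiplier `v ∈ C(X; 𝕋)` on `C₀(X)`: the pointwise product `v a`. -/
def phaseMul (v : C(X, Circle)) (a : C₀(X, ℂ)) : C₀(X, ℂ) where
  toFun q := (v q : ℂ) * a q
  continuous_toFun := (continuous_circle_coe.comp v.continuous).mul (map_continuous a)
  zero_at_infty' := by
    rw [tendsto_zero_iff_norm_tendsto_zero]
    have h := tendsto_zero_iff_norm_tendsto_zero.1 (zero_at_infty a)
    exact h.congr fun q => (norm_circle_mul v a q).symm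

lemma norm_le_iff' {a : C₀(X, ℂ)} {C : ℝ} (hC : 0 ≤ C) : ‖a‖ ≤ C ↔ ∀ q, ‖a q‖ ≤ C := by
  rw [← ZeroAtInftyContinuousMap.norm_toBCF_eq_norm, BoundedContinuousFunction.norm_le hC]; rfl

lemma norm_apply_le (a : C₀(X, ℂ)) (q : X) : ‖a q‖ ≤ ‖a‖ := (norm_le_iff' (norm_nonneg a)).1 le_rfl q

lemma norm_phaseMul_le (v : C(X, Circle)) (a : C₀(X, ℂ)) : ‖phaseMul v a‖ ≤ ‖a‖ :=
  (norm_le_iff' (norm_nonneg a)).2 fun q => (norm_circle_mul v a q).trans_le (norm_apply_le a q)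

lemma exists_compact (a : C₀(X, ℂ)) {ε : ℝ} (hε : 0 < ε) :
    ∃ K : Set X, IsCompact K ∧ ∀ q ∉ K, ‖a q‖ < ε := by
  have h := (tendsto_zero_iff_norm_tendsto_zero.1 (zero_at_infty a)).eventually (gt_mem_nhds hε)
  obtain ⟨K, hK, hs⟩ := mem_cocompact.1 h
  exact ⟨K, hK, fun q hq => hs hq⟩

lemma continuousAt_of_tight {T : Type*} [TopologicalSpace T] (f : T → C₀(X, ℂ)) (t₀ : T)
    (h1 : ContinuousAt (fun t => (f t : C(X, ℂ))) t₀)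
    (h2 : ∀ ε > 0, ∃ K : Set X, IsCompact K ∧ ∀ᶠ t in 𝓝 t₀, ∀ q ∉ K, ‖f t q‖ ≤ ε) :
    ContinuousAt f t₀ := by
  rw [ContinuousAt, Metric.tendsto_nhds]
  intro ε hε
  obtain ⟨K, hK, hev⟩ := h2 (ε / 4) (by positivity)
  have hu := (ContinuousMap.tendsto_iff_forall_isCompact_tendstoUniformlyOn.1 h1) K hK
  rw [Metric.tendstoUniformlyOn_iff] at hu
  filter_upwards [hev, hu (ε / 4) (by positivity)] with t ht hut
  have : dist (f t) (f t₀) ≤ ε / 2 := by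
    rw [dist_eq_norm, norm_le_iff' (by positivity)]
    intro q
    by_cases hq : q ∈ K
    · have := hut q hq
      rw [dist_comm, dist_eq_norm] at this
      exact (this.le.trans (by linarith))
    · have e1 := ht q hq
      have e2 := hev.self_of_nhds q hq
      calc ‖f t q - f t₀ q‖ ≤ ‖f t q‖ + ‖f t₀ q‖ := norm_sub_le _ _
        _ ≤ ε / 2 := by linarith
  linarith

lemma continuous_phaseMul [LocallyCompactSpace X] :
    Continuous fun p : C(X, Circle) × C₀(X, ℂ) => phaseMul p.1 p.2 := by
  rw [continuous_iff_continuousAt]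
  rintro ⟨v₀, a₀⟩
  have hl : Continuous fun v : C(X, Circle) => phaseMul v a₀ := by
    rw [continuous_iff_continuousAt]
    intro v₀
    apply continuousAt_of_tight
    · apply Continuous.continuousAt
      apply ContinuousMap.continuous_of_continuous_uncurry
      exact (continuous_circle_coe.comp continuous_eval).mul
        ((map_continuous a₀).comp continuous_snd)
    · intro ε hε
      obtain ⟨K, hK, hKa⟩ := exists_compact a₀ hε
      exact ⟨K, hK, Eventually.of_forall fun v q hq =>
        (norm_circle_mul v a₀ q).trans_le (hKa q hq).le⟩
  rw [ContinuousAt, tendsto_iff_dist_tendsto_zero]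
  have h1 : Tendsto (fun p : C(X, Circle) × C₀(X, ℂ) =>
      dist p.2 a₀ + dist (phaseMul p.1 a₀) (phaseMul v₀ a₀)) (𝓝 (v₀, a₀)) (𝓝 0) := by
    have : Continuous fun p : C(X, Circle) × C₀(X, ℂ) =>
        dist p.2 a₀ + dist (phaseMul p.1 a₀) (phaseMul v₀ a₀) :=
      (continuous_snd.dist continuous_const).add
        ((hl.comp continuous_fst).dist continuous_const)
    simpa using this.tendsto (v₀, a₀)
  refine squeeze_zero (fun _ => dist_nonneg) (fun p => ?_) h1
  refine (dist_triangle _ (phaseMul p.1 a₀) _).trans ?_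
  gcongr
  rw [dist_eq_norm, dist_eq_norm]
  have : phaseMul p.1 p.2 - phaseMul p.1 a₀ = phaseMul p.1 (p.2 - a₀) := by
    ext q
    exact (mul_sub _ _ _).symm
  rw [this]
  exact norm_phaseMul_le p.1 (p.2 - a₀)

end Basic

section Translations
variable {X : Type u} [AddCommGroup X] [TopologicalSpace X] [IsTopologicalAddGroup X]

/-- Translation `(θ_x a)(q) = a(q + x)` on `C₀(X)`. -/
def translate (x : X) (a : C₀(X, ℂ)) : C₀(X, ℂ) where
  toFun q := a (q + x)
  continuous_toFun := (map_continuous a).comp (continuous_id.add continuous_const)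
  zero_at_infty' :=
    (zero_at_infty a).comp (Homeomorph.addRight x).isClosedEmbedding.tendsto_cocompact

/-- Translation `(θ_x v)(q) = v(q + x)` on `C(X; 𝕋)`. -/
def translateU (x : X) (v : C(X, Circle)) : C(X, Circle) where
  toFun q := v (q + x)
  continuous_toFun := v.continuous.comp (continuous_id.add continuous_const)

lemma norm_translate_le (x : X) (a : C₀(X, ℂ)) : ‖translate x a‖ ≤ ‖a‖ :=
  (norm_le_iff' (norm_nonneg a)).2 fun q => norm_apply_le a (q + x)

lemma continuous_translate_left [LocallyCompactSpace X] (a : C₀(X, ℂ)) :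
    Continuous fun x : X => translate x a := by
  rw [continuous_iff_continuousAt]
  intro x₀
  apply continuousAt_of_tight
  · apply Continuous.continuousAt
    apply ContinuousMap.continuous_of_continuous_uncurry
    exact (map_continuous a).comp (continuous_snd.add continuous_fst)
  · intro ε hε
    obtain ⟨K, hK, hKa⟩ := exists_compact a hε
    obtain ⟨N, hN, hxN⟩ := exists_compact_mem_nhds x₀
    refine ⟨(fun p : X × X => p.1 - p.2) '' (K ×ˢ N), (hK.prod hN).image continuous_sub, ?_⟩
    filter_upwards [hxN] with x hx q hq
    refine (hKa (q + x) fun h => hq ⟨(q + x, x), ⟨h, hx⟩, by simp⟩).le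

lemma continuous_translate [LocallyCompactSpace X] :
    Continuous fun p : X × C₀(X, ℂ) => translate p.1 p.2 := by
  rw [continuous_iff_continuousAt]
  rintro ⟨x₀, a₀⟩
  rw [ContinuousAt, tendsto_iff_dist_tendsto_zero]
  have h1 : Tendsto (fun p : X × C₀(X, ℂ) => dist p.2 a₀ + dist (translate p.1 a₀) (translate x₀ a₀))
      (𝓝 (x₀, a₀)) (𝓝 0) := by
    have : Continuous fun p : X × C₀(X, ℂ) =>
        dist p.2 a₀ + dist (translate p.1 a₀) (translate x₀ a₀) :=
      (continuous_snd.dist continuous_const).add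
        (((continuous_translate_left a₀).comp continuous_fst).dist continuous_const)
    simpa using this.tendsto (x₀, a₀)
  refine squeeze_zero (fun _ => dist_nonneg) (fun p => ?_) h1
  refine (dist_triangle _ (translate p.1 a₀) _).trans ?_
  gcongr
  rw [dist_eq_norm, dist_eq_norm]
  exact norm_translate_le p.1 (p.2 - a₀)

lemma continuous_translateU [LocallyCompactSpace X] :
    Continuous fun p : X × C(X, Circle) => translateU p.1 p.2 := by
  apply ContinuousMap.continuous_of_continuous_uncurry
  have : Continuous fun p : (X × C(X, Circle)) × X => p.1.2 (p.2 + p.1.1) :=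
    continuous_eval.comp (f := fun p : (X × C(X, Circle)) × X => (p.1.2, p.2 + p.1.1)) (by fun_prop)
  exact this

end Translations
section TwistedAlgebra
variable {X : Type u} [AddCommGroup X] [TopologicalSpace X] [IsTopologicalAddGroup X]
  [LocallyCompactSpace X] [T2Space X] [SecondCountableTopology X]
  [MeasurableSpace X] [BorelSpace X]

/-- A normalized continuous `2`-cocycle on `X` with values in `C(X; 𝕋)`, the unitary group of
`C₀(X)`, with its strict (that is, compact-open) topology and the action of `X` by translations. -/
structure TwoCocycle (X : Type u) [AddCommGroup X] [TopologicalSpace X]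
    [IsTopologicalAddGroup X] where
  toMap : C(X × X, C(X, Circle))
  cocycle : ∀ x y z : X,
    toMap (x + y, z) * toMap (x, y) = translateU x (toMap (y, z)) * toMap (x, y + z)
  right_zero : ∀ x : X, toMap (x, 0) = 1
  left_zero : ∀ x : X, toMap (0, x) = 1

/-- The coboundary `δ¹(lam)(x, y) = lam(x) θ_x[lam(y)] / lam(x + y)` of a continuous `1`-cochain. -/
def coboundary (lam : C(X, C(X, Circle))) (x y : X) : C(X, Circle) :=
  lam x * translateU x (lam y) / lam (x + y)

/-- `lam` is a pseudo-trivialization of `ω`: a continuous `1`-cochain with values in `C(X; 𝕋)`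
whose coboundary is `ω`. -/
def IsPseudoTrivialization (ω : TwoCocycle X) (lam : C(X, C(X, Circle))) : Prop :=
  ∀ x y : X, coboundary lam x y = ω.toMap (x, y)

variable (ω : TwoCocycle X) (τ : X →ₜ+ X)

/-- The integrand of the `τ`-twisted product. -/
def twistedIntegrand (φ ψ : X → C₀(X, ℂ)) (x y : X) : C₀(X, ℂ) :=
  phaseMul (translateU (-τ x) (ω.toMap (y, x - y)))
    (translate (τ (y - x)) (φ y) * translate (y - τ y) (ψ (x - y)))

/-- The `τ`-twisted product
`(φ ⋄ ψ)(x) = ∫ θ_{τ(y-x)}[φ(y)] θ_{(1-τ)y}[ψ(x-y)] θ_{-τx}[ω(y,x-y)] dy`. -/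
def twistedProduct (m : Measure X) (φ ψ : X → C₀(X, ℂ)) (x : X) : C₀(X, ℂ) :=
  ∫ y, twistedIntegrand ω τ φ ψ x y ∂m

/-- The `τ`-twisted involution
`φ^⋄(x) = θ_{-τx}[ω(x,-x)⁻¹] θ_{(1-2τ)x}[φ(-x)^*]`. -/
def twistedStar (φ : X → C₀(X, ℂ)) (x : X) : C₀(X, ℂ) :=
  phaseMul (translateU (-τ x) (ω.toMap (x, -x))⁻¹) (translate (x - 2 • τ x) (star (φ (-x))))

lemma norm_twistedIntegrand_le (φ ψ : X → C₀(X, ℂ)) (x y : X) :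
    ‖twistedIntegrand ω τ φ ψ x y‖ ≤ ‖φ y‖ * ‖ψ (x - y)‖ := by
  refine (norm_phaseMul_le _ _).trans ((norm_mul_le _ _).trans ?_)
  gcongr <;> exact norm_translate_le _ _

lemma continuous_twistedIntegrand :
    Continuous fun t : (X × X) × C₀(X, ℂ) × C₀(X, ℂ) =>
      phaseMul (translateU (-τ t.1.1) (ω.toMap (t.1.2, t.1.1 - t.1.2)))
        (translate (τ (t.1.2 - t.1.1)) t.2.1 * translate (t.1.2 - τ t.1.2) t.2.2) := by
  have hτ : Continuous τ := map_continuous τ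
  have e1 : Continuous fun t : (X × X) × C₀(X, ℂ) × C₀(X, ℂ) =>
      (-τ t.1.1, ω.toMap (t.1.2, t.1.1 - t.1.2)) := by fun_prop
  have e2 : Continuous fun t : (X × X) × C₀(X, ℂ) × C₀(X, ℂ) =>
      (τ (t.1.2 - t.1.1), t.2.1) :=
    (hτ.comp (continuous_fst.snd.sub continuous_fst.fst)).prodMk continuous_snd.fst
  have e3 : Continuous fun t : (X × X) × C₀(X, ℂ) × C₀(X, ℂ) =>
      (t.1.2 - τ t.1.2, t.2.2) :=
    (continuous_fst.snd.sub (hτ.comp continuous_fst.snd)).prodMk continuous_snd.snd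
  have h1 := continuous_translateU.comp e1
  have h2 := continuous_translate.comp e2
  have h3 := continuous_translate.comp e3
  exact continuous_phaseMul.comp (h1.prodMk (h2.mul h3))

lemma aestronglyMeasurable_comp {α β γ : Type*} [MeasurableSpace α] [TopologicalSpace β]
    [TopologicalSpace γ] {μ : Measure α} (f : α → β) (G : β → γ) (hG : Continuous G)
    (hf : AEStronglyMeasurable f μ) : AEStronglyMeasurable (fun p => G (f p)) μ :=
  hG.comp_aestronglyMeasurable hf

lemma aestronglyMeasurable_twistedIntegrand (m : Measure X) [m.IsAddHaarMeasure]
    {φ ψ : X → C₀(X, ℂ)} (hφ : AEStronglyMeasurable φ m) (hψ : AEStronglyMeasurable ψ m) :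
    AEStronglyMeasurable (fun p : X × X => twistedIntegrand ω τ φ ψ p.1 p.2) (m.prod m) := by
  have hid : AEStronglyMeasurable (fun p : X × X => p) (m.prod m) :=
    continuous_id.aestronglyMeasurable
  have h1 : AEStronglyMeasurable (fun p : X × X => φ p.2) (m.prod m) := hφ.comp_snd
  have h2 : AEStronglyMeasurable (fun p : X × X => ψ (p.1 - p.2)) (m.prod m) :=
    hψ.comp_quasiMeasurePreserving (quasiMeasurePreserving_sub_of_right_invariant m m)
  have h3 : AEStronglyMeasurable (fun p : X × X => (p, φ p.2, ψ (p.1 - p.2))) (m.prod m) :=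
    hid.prodMk (h1.prodMk h2)
  exact aestronglyMeasurable_comp (fun p : X × X => (p, φ p.2, ψ (p.1 - p.2))) _
    (continuous_twistedIntegrand ω τ) h3

lemma integrable_twistedIntegrand (m : Measure X) [m.IsAddHaarMeasure] {φ ψ : X → C₀(X, ℂ)}
    (hφ : Integrable φ m) (hψ : Integrable ψ m) :
    Integrable (fun p : X × X => twistedIntegrand ω τ φ ψ p.1 p.2) (m.prod m) := by
  have hb : Integrable (fun p : X × X => ‖φ p.2‖ * ‖ψ (p.1 - p.2)‖) (m.prod m) :=
    hφ.norm.convolution_integrand (ContinuousLinearMap.mul ℝ ℝ) hψ.norm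
  exact hb.mono' (aestronglyMeasurable_twistedIntegrand ω τ m hφ.1 hψ.1)
    (Eventually.of_forall fun p => norm_twistedIntegrand_le ω τ φ ψ p.1 p.2)

lemma integrable_twistedProduct (m : Measure X) [m.IsAddHaarMeasure] {φ ψ : X → C₀(X, ℂ)}
    (hφ : Integrable φ m) (hψ : Integrable ψ m) :
    Integrable (twistedProduct ω τ m φ ψ) m :=
  (integrable_twistedIntegrand ω τ m hφ hψ).integral_prod_left

lemma continuous_twistedStar :
    Continuous fun t : X × C₀(X, ℂ) =>
      phaseMul (translateU (-τ t.1) (ω.toMap (t.1, -t.1))⁻¹)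
        (translate (t.1 - 2 • τ t.1) (star t.2)) := by
  have hτ : Continuous τ := map_continuous τ
  have e1 : Continuous fun t : X × C₀(X, ℂ) => (-τ t.1, (ω.toMap (t.1, -t.1))⁻¹) := by fun_prop
  have e2 : Continuous fun t : X × C₀(X, ℂ) => (t.1 - 2 • τ t.1, star t.2) :=
    (continuous_fst.sub ((hτ.comp continuous_fst).const_smul 2)).prodMk continuous_snd.star
  have h1 := continuous_translateU.comp e1
  have h2 := continuous_translate.comp e2
  exact continuous_phaseMul.comp (h1.prodMk h2)

lemma aestronglyMeasurable_twistedStar (m : Measure X) {φ : X → C₀(X, ℂ)}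
    (hφ : AEStronglyMeasurable (fun x => φ (-x)) m) :
    AEStronglyMeasurable (twistedStar ω τ φ) m := by
  have hid : AEStronglyMeasurable (fun x : X => x) m := continuous_id.aestronglyMeasurable
  have h3 : AEStronglyMeasurable (fun x : X => (x, φ (-x))) m := hid.prodMk hφ
  exact aestronglyMeasurable_comp (fun x : X => (x, φ (-x))) _ (continuous_twistedStar ω τ) h3

lemma norm_twistedStar_le (φ : X → C₀(X, ℂ)) (x : X) : ‖twistedStar ω τ φ x‖ ≤ ‖φ (-x)‖ := by
  refine (norm_phaseMul_le _ _).trans ((norm_translate_le _ _).trans ?_)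
  refine (norm_le_iff' (norm_nonneg _)).2 fun q => ?_
  rw [ZeroAtInftyContinuousMap.star_apply, norm_star]
  exact norm_apply_le _ _

lemma integrable_twistedStar (m : Measure X) [m.IsAddHaarMeasure] {φ : X → C₀(X, ℂ)}
    (hφ : Integrable φ m) : Integrable (twistedStar ω τ φ) m := by
  have hn : Integrable (fun x => φ (-x)) m := hφ.comp_neg
  exact hn.mono (aestronglyMeasurable_twistedStar ω τ m hn.1)
    (Eventually.of_forall fun x => norm_twistedStar_le ω τ φ x)

variable (m : Measure X) [m.IsAddHaarMeasure]

/-- The twisted product on `L¹(X; C₀(X))`. -/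
def mulL1 (φ ψ : X →₁[m] C₀(X, ℂ)) : X →₁[m] C₀(X, ℂ) :=
  (integrable_twistedProduct ω τ m (L1.integrable_coeFn φ) (L1.integrable_coeFn ψ)).toL1 _

/-- The twisted involution on `L¹(X; C₀(X))`. -/
def starL1 (φ : X →₁[m] C₀(X, ℂ)) : X →₁[m] C₀(X, ℂ) :=
  (integrable_twistedStar ω τ m (L1.integrable_coeFn φ)).toL1 _

end TwistedAlgebra

section PhaseSpace
variable (X : Type u) [AddCommGroup X] [TopologicalSpace X]

/-- The dual group `X^♯` of continuous characters of `X`. -/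
abbrev DualGroup := PontryaginDual (Multiplicative X)

instance : MeasurableSpace (DualGroup X) := borel _
instance : BorelSpace (DualGroup X) := ⟨rfl⟩

/-- The phase space `Ξ = X × X^♯`. -/
abbrev PhaseSpace := X × DualGroup X

variable {X}

/-- The value `χ(x)` of a character. -/
def character (χ : DualGroup X) (x : X) : Circle := χ (Multiplicative.ofAdd x)

lemma continuous_character (χ : DualGroup X) : Continuous (character χ) :=
  (map_continuous χ).comp continuous_ofAdd

lemma continuous_character_uncurry [LocallyCompactSpace X] :
    Continuous fun p : DualGroup X × X => character p.1 p.2 := by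
  have : LocallyCompactSpace (Multiplicative X) := inferInstanceAs (LocallyCompactSpace X)
  have h : Continuous fun p : C(Multiplicative X, Circle) × Multiplicative X => p.1 p.2 :=
    continuous_eval
  have h2 : Continuous fun χ : DualGroup X => (χ.toContinuousMap : C(Multiplicative X, Circle)) :=
    (ContinuousMonoidHom.isInducing_toContinuousMap (Multiplicative X) Circle).continuous
  exact h.comp ((h2.comp continuous_fst).prodMk (continuous_ofAdd.comp continuous_snd))
end PhaseSpace

section ComplexMeasures
variable {Y : Type*} [MeasurableSpace Y]

lemma isFiniteMeasure_variation (μ : ComplexMeasure Y) : IsFiniteMeasure μ.variation := by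
  have h : μ.variation ≤
      (ComplexMeasure.re μ).totalVariation + (ComplexMeasure.im μ).totalVariation := by
    apply VectorMeasure.variation_le_of_forall_enorm_le
    intro E _
    have h1 := SignedMeasure.enorm_le_totalVariation (ComplexMeasure.re μ) E
    have h2 := SignedMeasure.enorm_le_totalVariation (ComplexMeasure.im μ) E
    have h3 : ‖μ E‖ₑ ≤ ‖ComplexMeasure.re μ E‖ₑ + ‖ComplexMeasure.im μ E‖ₑ := by
      rw [← ofReal_norm, ← ofReal_norm, ← ofReal_norm,
        ← ENNReal.ofReal_add (norm_nonneg _) (norm_nonneg _)]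
      exact ENNReal.ofReal_le_ofReal (Complex.norm_le_abs_re_add_abs_im (μ E))
    exact h3.trans (add_le_add h1 h2)
  exact isFiniteMeasure_of_le _ h

/-- The integral `∫ f dμ` of a complex function against a complex measure. -/
def complexIntegral (μ : ComplexMeasure Y) (f : Y → ℂ) : ℂ :=
  μ.integral f (ContinuousLinearMap.mul ℝ ℂ)

lemma complexIntegral_add {μ ν : ComplexMeasure Y} {f : Y → ℂ} (hμ : μ.Integrable f)
    (hν : ν.Integrable f) :
    complexIntegral (μ + ν) f = complexIntegral μ f + complexIntegral ν f :=
  VectorMeasure.integral_add_vectorMeasure hμ hν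

lemma complexIntegral_smul {μ : ComplexMeasure Y} {f : Y → ℂ} (c : ℂ) (hμ : μ.Integrable f) :
    complexIntegral (c • μ) f = c * complexIntegral μ f := by
  have hfin := isFiniteMeasure_variation μ
  have hle : (c • μ).variation ≤ ‖c‖ₑ • μ.variation := by
    apply VectorMeasure.variation_le_of_forall_enorm_le
    intro E _
    rw [_root_.smul_apply, enorm_smul, Measure.smul_apply, smul_eq_mul]
    gcongr
    exact VectorMeasure.enorm_measure_le_variation μ E
  have hT' : DominatedFinMeasAdditive μ.variation
      ((c • μ).transpose (ContinuousLinearMap.mul ℝ ℂ)) ‖c‖ := by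
    refine ⟨fun s t hs ht _ _ hd => 
      cbmApplyMeasure_union (c • μ) (ContinuousLinearMap.mul ℝ ℂ) hs ht hd, fun s hs hsf => ?_⟩
    refine (norm_cbmApplyMeasure_le (c • μ) (ContinuousLinearMap.mul ℝ ℂ) s).trans ?_
    rw [_root_.smul_apply, norm_smul]
    have h1 : ‖ContinuousLinearMap.mul ℝ ℂ‖ ≤ 1 := ContinuousLinearMap.opNorm_mul_le ℝ ℂ
    have h2 : ‖μ s‖ ≤ μ.variation.real s := VectorMeasure.norm_measure_le_variation hsf.ne
    calc ‖ContinuousLinearMap.mul ℝ ℂ‖ * (‖c‖ * ‖μ s‖) ≤ 1 * (‖c‖ * μ.variation.real s) := by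
          gcongr
      _ = ‖c‖ * μ.variation.real s := one_mul _
  have key : complexIntegral (c • μ) f = setToFun μ.variation _ hT' f :=
    (setToFun_congr_measure_of_integrable _ enorm_ne_top hle hT' _ f hμ).symm
  rw [key]
  have hT := dominatedFinMeasAdditive_cbmApplyMeasure μ (ContinuousLinearMap.mul ℝ ℂ)
  change setToFun μ.variation _ hT' f = c * setToFun μ.variation _ hT f
  refine hμ.induction (P := fun f =>
    setToFun μ.variation _ hT' f = c * setToFun μ.variation _ hT f) ?_ ?_ ?_ ?_
  · intro a s hs hsf
    rw [setToFun_indicator_const hT' hs hsf.ne, setToFun_indicator_const hT hs hsf.ne]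
    change a * (c * μ s) = c * (a * μ s)
    ring
  · intro f g _ hf hg hPf hPg
    rw [setToFun_add hT' hf hg, setToFun_add hT hf hg, hPf, hPg, mul_add]
  · exact isClosed_eq (continuous_setToFun hT') (continuous_const.mul (continuous_setToFun hT))
  · intro f g hfg _ hPf
    rw [← setToFun_congr_ae hT' hfg, ← setToFun_congr_ae hT hfg, hPf]

end ComplexMeasures

section Fourier
variable {X : Type u} [AddCommGroup X] [TopologicalSpace X] [IsTopologicalAddGroup X]
  [LocallyCompactSpace X] [T2Space X] [SecondCountableTopology X]
  [MeasurableSpace X] [BorelSpace X]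

/-- The kernel `χ(y) conj(κ(x))`, for `ξ = (x, χ)` and `η = (y, κ)`, of the symplectic Fourier
transformation. -/
def symplecticKernel (ξ η : PhaseSpace X) : ℂ :=
  (character ξ.2 η.1 : ℂ) * starRingEnd ℂ (character η.2 ξ.1 : ℂ)

lemma integrable_symplecticKernel (μ : ComplexMeasure (PhaseSpace X)) (ξ : PhaseSpace X) :
    μ.Integrable (symplecticKernel ξ) := by
  have hfin := isFiniteMeasure_variation μ
  have hc : Continuous (symplecticKernel ξ) := by
    have h1 : Continuous fun η : PhaseSpace X => (character ξ.2 η.1 : ℂ) :=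
      continuous_circle_coe.comp ((continuous_character ξ.2).comp continuous_fst)
    have h2 : Continuous fun η : PhaseSpace X => (character η.2 ξ.1 : ℂ) :=
      continuous_circle_coe.comp
        (continuous_character_uncurry.comp (continuous_snd.prodMk continuous_const))
    exact h1.mul (Complex.continuous_conj.comp h2)
  refine Integrable.of_bound hc.aestronglyMeasurable 1 (Eventually.of_forall fun η => ?_)
  rw [symplecticKernel, norm_mul, RCLike.norm_conj, Circle.norm_coe, Circle.norm_coe, one_mul]

/-- The symplectic Fourier transformation of bounded complex measures on `Ξ`,
`(F_Ξ μ)(x, χ) = ∫ χ(y) conj(κ(x)) μ(dy, dκ)`. -/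
def symplecticFourier : ComplexMeasure (PhaseSpace X) →ₗ[ℂ] (PhaseSpace X → ℂ) where
  toFun μ ξ := complexIntegral μ (symplecticKernel ξ)
  map_add' μ ν := by
    ext ξ
    exact complexIntegral_add (integrable_symplecticKernel μ ξ) (integrable_symplecticKernel ν ξ)
  map_smul' c μ := by
    ext ξ
    exact complexIntegral_smul c (integrable_symplecticKernel μ ξ)

variable (X) in
/-- The space `F_Ξ 𝕄(Ξ)` of symplectic Fourier transforms of bounded complex measures. -/
def measureTransforms : Submodule ℂ (PhaseSpace X → ℂ) :=
  LinearMap.range (symplecticFourier (X := X))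

/-- The symplectic Fourier transform of a bounded complex measure, as an element of
`F_Ξ 𝕄(Ξ)`. -/
def measureTransform (μ : ComplexMeasure (PhaseSpace X)) : measureTransforms X :=
  ⟨symplecticFourier μ, μ, rfl⟩

/-- The exponential function `F_{ξ₀}(x, χ) = χ(x₀) conj(χ₀(x))`, where `ξ₀ = (x₀, χ₀)`. -/
def exponential (ξ₀ : PhaseSpace X) : PhaseSpace X → ℂ :=
  fun ξ => (character ξ.2 ξ₀.1 : ℂ) * starRingEnd ℂ (character ξ₀.2 ξ.1 : ℂ)

variable (m : Measure X) [m.IsAddHaarMeasure]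

lemma integrable_character_smul (χ : DualGroup X) {φ : X → C₀(X, ℂ)} (hφ : Integrable φ m) :
    Integrable (fun x => (character χ x : ℂ) • φ x) m := by
  have hc : Continuous fun x => (character χ x : ℂ) :=
    continuous_circle_coe.comp (continuous_character χ)
  refine hφ.mono (hc.aestronglyMeasurable.smul hφ.1) (Eventually.of_forall fun x => ?_)
  rw [norm_smul, Circle.norm_coe, one_mul]

/-- The partial Fourier transformation `𝔉 = 1 ⊗ F̄_X` on `L¹(X; C₀(X))`, with values in the
functions on `Ξ`: `(𝔉 φ)(q, χ) = [∫ χ(x) φ(x) dx](q)`. -/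
def partialFourier : (X →₁[m] C₀(X, ℂ)) →ₗ[ℂ] (PhaseSpace X → ℂ) where
  toFun φ ξ := (∫ x, (character ξ.2 x : ℂ) • φ x ∂m : C₀(X, ℂ)) ξ.1
  map_add' φ ψ := by
    ext ξ
    have h : (∫ x, (character ξ.2 x : ℂ) • (φ + ψ) x ∂m : C₀(X, ℂ)) =
        ∫ x, ((character ξ.2 x : ℂ) • φ x + (character ξ.2 x : ℂ) • ψ x) ∂m := by
      refine integral_congr_ae ?_
      filter_upwards [Lp.coeFn_add φ ψ] with x hx
      rw [hx]
      exact smul_add (character ξ.2 x : ℂ) (φ x) (ψ x)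
    rw [h, integral_add (integrable_character_smul m ξ.2 (L1.integrable_coeFn φ))
      (integrable_character_smul m ξ.2 (L1.integrable_coeFn ψ))]
    rfl
  map_smul' c φ := by
    ext ξ
    have h : (∫ x, (character ξ.2 x : ℂ) • (c • φ) x ∂m : C₀(X, ℂ)) =
        ∫ x, c • ((character ξ.2 x : ℂ) • φ x) ∂m := by
      refine integral_congr_ae ?_
      filter_upwards [Lp.coeFn_smul c φ] with x hx
      rw [hx]
      exact smul_comm (character ξ.2 x : ℂ) c (φ x)
    rw [h, integral_smul]
    rfl

/-- The space of symbols `𝔉 L¹(X; C₀(X))`. -/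
def symbolSpace : Submodule ℂ (PhaseSpace X → ℂ) := LinearMap.range (partialFourier m)

/-- The map `φ ↦ 𝔉 φ` onto the space of symbols. -/
def symbol : (X →₁[m] C₀(X, ℂ)) →ₗ[ℂ] symbolSpace m := (partialFourier m).rangeRestrict

lemma symbol_surjective : Function.Surjective (symbol m) :=
  (partialFourier m).surjective_rangeRestrict

end Fourier

section SymbolAlgebra
variable {X : Type u} [AddCommGroup X] [TopologicalSpace X] [IsTopologicalAddGroup X]
  [LocallyCompactSpace X] [T2Space X] [SecondCountableTopology X]
  [MeasurableSpace X] [BorelSpace X]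
  (ω : TwoCocycle X) (τ : X →ₜ+ X) (m : Measure X) [m.IsAddHaarMeasure]

/-- A Hilbert space representation of the Banach `*`-algebra `𝔉 L¹(X; C₀(X))`, whose product,
involution and norm are those of `L¹(X; C₀(X))` transported by `𝔉`. (A `*`-representation of a
Banach `*`-algebra is automatically contractive, so `norm_le` is no restriction; and every cyclic
representation lives, up to unitary equivalence, on a Hilbert space in the universe of `X`.) -/
structure SymbolRep where
  /-- the Hilbert space -/
  H : Type u
  [normedAddCommGroup : NormedAddCommGroup H]
  [innerProductSpace : InnerProductSpace ℂ H]
  [completeSpace : CompleteSpace H]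
  /-- the representation -/
  π : symbolSpace m →ₗ[ℂ] (H →L[ℂ] H)
  map_mul : ∀ φ ψ : X →₁[m] C₀(X, ℂ),
    π (symbol m (mulL1 ω τ m φ ψ)) = π (symbol m φ) * π (symbol m ψ)
  map_star : ∀ φ : X →₁[m] C₀(X, ℂ), π (symbol m (starL1 ω τ m φ)) = star (π (symbol m φ))
  norm_le : ∀ φ : X →₁[m] C₀(X, ℂ), ‖π (symbol m φ)‖ ≤ ‖φ‖

attribute [instance] SymbolRep.normedAddCommGroup SymbolRep.innerProductSpace
  SymbolRep.completeSpace

/-- The `C*`-algebra of bounded families of operators indexed by all the representations. -/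
def UniversalTarget : Type (u + 1) :=
  lp (fun π : SymbolRep ω τ m => (π.H →L[ℂ] π.H)) ∞

instance : NonUnitalCStarAlgebra (UniversalTarget ω τ m) :=
  inferInstanceAs (NonUnitalCStarAlgebra (lp (fun π : SymbolRep ω τ m => (π.H →L[ℂ] π.H)) ∞))

/-- The universal representation `f ↦ (π(f))_π` of the space of symbols. By construction
`‖universalRep f‖ = sup_π ‖π(f)‖`, the enveloping `C*`-norm. -/
def universalRep : symbolSpace m →ₗ[ℂ] UniversalTarget ω τ m where
  toFun f := ⟨fun π => π.π f, memℓp_infty (by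
    obtain ⟨φ, rfl⟩ := symbol_surjective m f
    refine ⟨‖φ‖, ?_⟩
    rintro _ ⟨π, rfl⟩
    exact π.norm_le φ)⟩
  map_add' f g := by
    refine lp.ext (funext fun π => ?_)
    exact map_add π.π f g
  map_smul' c f := by
    refine lp.ext (funext fun π => ?_)
    exact map_smul π.π c f

/-- The image of `𝔉 L¹(X; C₀(X))` under the universal representation, a `*`-algebra. -/
def symbolStarAlgebra : NonUnitalStarSubalgebra ℂ (UniversalTarget ω τ m) where
  carrier := Set.range (universalRep ω τ m)
  add_mem' := by
    rintro _ _ ⟨f, rfl⟩ ⟨g, rfl⟩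
    exact ⟨f + g, map_add _ f g⟩
  zero_mem' := ⟨0, map_zero _⟩
  smul_mem' := by
    rintro c _ ⟨f, rfl⟩
    exact ⟨c • f, map_smul _ c f⟩
  mul_mem' := by
    rintro _ _ ⟨f, rfl⟩ ⟨g, rfl⟩
    obtain ⟨φ, rfl⟩ := symbol_surjective m f
    obtain ⟨ψ, rfl⟩ := symbol_surjective m g
    refine ⟨symbol m (mulL1 ω τ m φ ψ), ?_⟩
    refine lp.ext (funext fun π => ?_)
    exact π.map_mul φ ψ
  star_mem' := by
    rintro _ ⟨f, rfl⟩
    obtain ⟨φ, rfl⟩ := symbol_surjective m f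
    refine ⟨symbol m (starL1 ω τ m φ), ?_⟩
    refine lp.ext (funext fun π => ?_)
    exact π.map_star φ

/-- The symbol `C*`-algebra `ℭ^ω_{C₀(X),τ}`: the enveloping `C*`-algebra of
`𝔉 L¹(X; C₀(X))`, that is, its completion in the norm `sup_π ‖π(f)‖`, realized as the closure of
its image under the universal representation. -/
def symbolAlgebra : NonUnitalStarSubalgebra ℂ (UniversalTarget ω τ m) :=
  (symbolStarAlgebra ω τ m).topologicalClosure

instance : NonUnitalCStarAlgebra (symbolAlgebra ω τ m) :=
  NonUnitalStarSubalgebra.nonUnitalCStarAlgebra _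
    (h_closed := (symbolStarAlgebra ω τ m).isClosed_topologicalClosure)

/-- The canonical map from `𝔉 L¹(X; C₀(X))` to its enveloping `C*`-algebra. -/
def toSymbolAlgebra : symbolSpace m →ₗ[ℂ] symbolAlgebra ω τ m where
  toFun f := ⟨universalRep ω τ m f,
    (symbolStarAlgebra ω τ m).le_topologicalClosure ⟨f, rfl⟩⟩
  map_add' f g := Subtype.ext (map_add _ f g)
  map_smul' c f := Subtype.ext (map_smul _ c f)

/-- The multiplier algebra `𝒩` of the symbol `C*`-algebra. -/
abbrev symbolMultipliers : Type (u + 1) := DoubleCentralizer ℂ (symbolAlgebra ω τ m)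

/-- The canonical map from `𝔉 L¹(X; C₀(X))` to the multiplier algebra `𝒩`. -/
def toMultipliers (f : symbolSpace m) : symbolMultipliers ω τ m :=
  DoubleCentralizer.coe ℂ (toSymbolAlgebra ω τ m f)

end SymbolAlgebra

section Operators
variable {X : Type u} [AddCommGroup X] [TopologicalSpace X] [IsTopologicalAddGroup X]
  [LocallyCompactSpace X] [T2Space X] [SecondCountableTopology X]
  [MeasurableSpace X] [BorelSpace X]
  (m : Measure X) [m.IsAddHaarMeasure]

lemma norm_mul_memLp {g : X → ℂ} (hg : Continuous g) {C : ℝ} (hC : ∀ x, ‖g x‖ ≤ C)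
    (u : Lp ℂ 2 m) : MemLp (fun x => g x * u x) 2 m :=
  (Lp.memLp u).of_le_mul (c := C) (hg.aestronglyMeasurable.mul (Lp.aestronglyMeasurable u))
    (Eventually.of_forall fun x => by
      rw [norm_mul]
      exact mul_le_mul_of_nonneg_right (hC x) (norm_nonneg _))

/-- The operator `r(g)` of multiplication by the bounded continuous function `g` in `L²(X)`. -/
def multiplication (g : BoundedContinuousFunction X ℂ) : Lp ℂ 2 m →L[ℂ] Lp ℂ 2 m :=
  LinearMap.mkContinuous
    { toFun := fun u => (norm_mul_memLp m g.continuous g.norm_coe_le_norm u).toLp _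
      map_add' := fun u v => by
        rw [← MemLp.toLp_add]
        apply MemLp.toLp_congr
        filter_upwards [Lp.coeFn_add u v] with x hx
        rw [hx, Pi.add_apply, Pi.add_apply, mul_add]
      map_smul' := fun c u => by
        rw [RingHom.id_apply, ← MemLp.toLp_const_smul]
        apply MemLp.toLp_congr
        filter_upwards [Lp.coeFn_smul c u] with x hx
        rw [hx, Pi.smul_apply, Pi.smul_apply, smul_eq_mul, smul_eq_mul, mul_left_comm] }
    ‖g‖ (fun u => by
      refine Lp.norm_le_mul_norm_of_ae_le_mul ?_
      filter_upwards [(norm_mul_memLp m g.continuous g.norm_coe_le_norm u).coeFn_toLp] with x hx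
      change ‖(norm_mul_memLp m g.continuous g.norm_coe_le_norm u).toLp _ x‖ ≤ _
      rw [hx, norm_mul]
      exact mul_le_mul_of_nonneg_right (g.norm_coe_le_norm x) (norm_nonneg _))

/-- The bounded continuous function underlying an element of `C(X; 𝕋)`. -/
def phaseFunction (v : C(X, Circle)) : BoundedContinuousFunction X ℂ :=
  BoundedContinuousFunction.ofNormedAddCommGroup (fun x => (v x : ℂ))
    (continuous_circle_coe.comp v.continuous) 1 (fun x => (Circle.norm_coe (v x)).le)

/-- The translation operator `[T(y)u](x) = u(x + y)` in `L²(X)`. -/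
def shift (y : X) : Lp ℂ 2 m →L[ℂ] Lp ℂ 2 m :=
  (Lp.compMeasurePreservingₗᵢ ℂ (fun x : X => x + y)
    (measurePreserving_add_right m y)).toContinuousLinearMap

/-- `T^lam(y) = r(lam(y)) T(y)`, that is, `[T^lam(y)u](x) = lam(y)(x) u(x + y)`. -/
def twistedShift (lam : C(X, C(X, Circle))) (y : X) : Lp ℂ 2 m →L[ℂ] Lp ℂ 2 m :=
  multiplication m (phaseFunction (lam y)) * shift m y

/-- The conjugate `x ↦ conj(χ(x))` of a character, as an element of `C(X; 𝕋)`. -/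
def conjCharacter (χ : DualGroup X) : C(X, Circle) where
  toFun x := (character χ x)⁻¹
  continuous_toFun := (continuous_character χ).inv

/-- The Weyl system `W^lam_τ(y, χ) = χ(-τy) V(χ) T^lam(y)`, where `V(χ)` is the multiplication by
`conj(χ)`; explicitly, `[W^lam_τ(y, χ)u](x) = χ(-x - τy) lam(y)(x) u(x + y)`. -/
def weyl (τ : X →ₜ+ X) (lam : C(X, C(X, Circle))) (ξ : PhaseSpace X) :
    Lp ℂ 2 m →L[ℂ] Lp ℂ 2 m :=
  (character ξ.2 (-τ ξ.1) : ℂ) •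
    (multiplication m (phaseFunction (conjCharacter ξ.2)) * twistedShift m lam ξ.1)

/-- The value at `u ∈ L²(X)` of the integrated form
`(r ⋊_τ T^lam)(φ) = ∫ r(θ_{τy}[φ(y)]) T^lam(y) dy` of the Schrödinger covariant representation. -/
def schrodinger (τ : X →ₜ+ X) (lam : C(X, C(X, Circle))) (φ : X →₁[m] C₀(X, ℂ)) (u : Lp ℂ 2 m) :
    Lp ℂ 2 m :=
  ∫ y, multiplication m (translate (τ y) (φ y)).toBCF (twistedShift m lam y u) ∂m

end Operators

end
end TwistedWeyl

open TwistedWeyl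

/-!
The key is that every pseudo-trivialization `lam` makes `ℭ` act on `L²(X)` as the algebra of
compact operators. For continuous `f` and `g` of compact support, the element `φ_{f,g}` of `L¹(X;
C₀(X))` given by `lam(y) θ_{τy}[φ_{f,g}(y)] = f θ_y[conj g]` is sent by the Schrödinger
representation to the rank one operator `|f⟩⟨g|` (`schrodingerOp_unitL1`). Already in the twisted
convolution algebra these elements multiply like matrix units (`mulL1_unitL1`), and their span is
dense (`dense_unitSpan`, by a partition of unity). Compressing an element `a` of `ℭ` by matrix
units gives its matrix coefficients in `L²(X)`, so an element annihilated by the Schrödinger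
representation satisfies `ℭ a ℭ = 0` and vanishes. The representation is thus a faithful map of
`ℭ` onto a closed ideal of `B(L²(X))` that contains the operators of rank one
(`IsMatrixUnits.isIdealRep`). For such an ideal the multipliers are exactly the operators, acting
by left and right multiplication (`IsIdealRep.multiplier_bijective`); this gives the isomorphism
of `𝒩` onto `B(L²(X))` and the uniqueness of the extension.

The Schrödinger representation is a representation of the space of symbols only because the
partial Fourier transformation is injective. This, and all the other statements on Fourier
transforms, follow from the fact that characters separate the points of `X`
(`exists_character_ne_one`). Here it is derived from Gelfand duality for the commutative
`C*`-algebra generated by the translations of `L²(X)`, by looking at the convolution operators in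
it. Since `X` is Polish, a finite complex measure on `X` or on `X × X` is then determined by its
Fourier transform.

The embedding `J` sends `F_Ξ μ` to the multiplier that corresponds to `∫ W(ξ) dμ(ξ)`
(`transformEmbedding`). It is well defined and injective, since this operator and the function
`F_Ξ μ` vanish simultaneously (`weylIntegral_eq_zero_iff`). It agrees with the inclusion of `ℭ` on
symbols: if `F_Ξ μ = 𝔉 φ`, then for every `x` the measures `conj(κ(x)) μ(dy, dκ)`, projected to
`X`, and `φ(y)(x) dy` have the same Fourier transform, hence `∫ W(ξ) dμ(ξ)` and the Schrödinger
operator of `φ` have the same matrix coefficients (`weylIntegral_eq_schrodingerOp`). Finally `J`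
does not depend on `lam`: any two pseudo-trivializations differ by a coboundary, `lam' = lam θ[b]
b⁻¹`, and the Weyl systems and the Schrödinger representations are conjugate by the unitary
operator `r(b)` (`multiplier_weylIntegral`). Pseudo-trivializations exist, for instance `lam(x)(q)
= ω(q, x)(0)` (`canonicalTrivialization`), so `J` can be defined by one of them.
-/

namespace TwistedWeyl
noncomputable section
universe u

/-! ### Strong integrals of operator families -/

section StrongIntegral
variable {Y E F : Type*} [MeasurableSpace Y] [NormedAddCommGroup E] [NormedSpace ℂ E]
  [NormedAddCommGroup F] [NormedSpace ℂ F]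

/-- A family `G` of bounded operators is strongly integrable if it is strongly measurable pointwise
and dominated in norm by an integrable function. -/
def StronglyIntegrable (G : Y → E →L[ℂ] F) (ν : Measure Y) : Prop :=
  (∀ u, AEStronglyMeasurable (fun y => G y u) ν) ∧
    ∃ k : Y → ℝ, Integrable k ν ∧ ∀ᵐ y ∂ν, ‖G y‖ ≤ k y

variable {G : Y → E →L[ℂ] F} {ν : Measure Y}

lemma StronglyIntegrable.integrable (hG : StronglyIntegrable G ν) (u : E) :
    Integrable (fun y => G y u) ν := by
  obtain ⟨h1, k, hk, hle⟩ := hG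
  refine (hk.mul_const ‖u‖).mono' (h1 u) ?_
  filter_upwards [hle] with y hy
  exact (G y).le_of_opNorm_le hy u

/-- The operator `u ↦ ∫ G(y) u dν(y)`. -/
def strongIntegral (hG : StronglyIntegrable G ν) : E →L[ℂ] F :=
  LinearMap.mkContinuousOfExistsBound
    { toFun := fun u => ∫ y, G y u ∂ν
      map_add' := fun u v => by
        simp only [map_add]
        exact integral_add (hG.integrable u) (hG.integrable v)
      map_smul' := fun c u => by
        simp only [map_smul, RingHom.id_apply]
        exact integral_smul c _ } (by
    obtain ⟨h1, k, hk, hle⟩ := hG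
    refine ⟨∫ y, k y ∂ν, fun u => ?_⟩
    rw [← integral_mul_const]
    refine norm_integral_le_of_norm_le (hk.mul_const _) ?_
    filter_upwards [hle] with y hy
    exact (G y).le_of_opNorm_le hy u)

lemma strongIntegral_apply (hG : StronglyIntegrable G ν) (u : E) :
    strongIntegral hG u = ∫ y, G y u ∂ν := rfl

lemma norm_strongIntegral_le (hG : StronglyIntegrable G ν) {k : Y → ℝ} (hk : Integrable k ν)
    (hle : ∀ᵐ y ∂ν, ‖G y‖ ≤ k y) : ‖strongIntegral hG‖ ≤ ∫ y, k y ∂ν := by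
  have h0 : ∀ᵐ y ∂ν, 0 ≤ k y := hle.mono fun y hy => (norm_nonneg _).trans hy
  refine ContinuousLinearMap.opNorm_le_bound _ (integral_nonneg_of_ae h0) fun u => ?_
  rw [strongIntegral_apply, ← integral_mul_const]
  refine norm_integral_le_of_norm_le (hk.mul_const _) ?_
  filter_upwards [hle] with y hy
  exact (G y).le_of_opNorm_le hy u

lemma strongIntegral_inner {H H' : Type*} [NormedAddCommGroup H] [InnerProductSpace ℂ H]
    [NormedAddCommGroup H'] [InnerProductSpace ℂ H'] [CompleteSpace H']
    {G : Y → H →L[ℂ] H'} (hG : StronglyIntegrable G ν) (v : H') (u : H) :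
    inner ℂ v (strongIntegral hG u) = ∫ y, inner ℂ v (G y u) ∂ν :=
  (integral_inner (hG.integrable u) v).symm

lemma map_strongIntegral [CompleteSpace F] {F' : Type*} [NormedAddCommGroup F'] [NormedSpace ℂ F']
    [CompleteSpace F'] (hG : StronglyIntegrable G ν) (S : F →L[ℂ] F') (u : E) :
    S (strongIntegral hG u) = ∫ y, S (G y u) ∂ν :=
  (S.integral_comp_comm (hG.integrable u)).symm

end StrongIntegral

/-! ### Shifts and multiplications in `L²(X)` -/

section Operators
variable {X : Type u} [AddCommGroup X] [TopologicalSpace X] [IsTopologicalAddGroup X]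
  [LocallyCompactSpace X] [T2Space X] [SecondCountableTopology X]
  [MeasurableSpace X] [BorelSpace X] {m : Measure X} [m.IsAddHaarMeasure]

lemma ae_comp_add_right {p : X → Prop} (h : ∀ᵐ x ∂m, p x) (y : X) : ∀ᵐ x ∂m, p (x + y) :=
  (measurePreserving_add_right m y).quasiMeasurePreserving.ae h

lemma coeFn_shift (y : X) (u : Lp ℂ 2 m) : shift m y u =ᵐ[m] fun x => u (x + y) :=
  Lp.coeFn_compMeasurePreserving u (measurePreserving_add_right m y)

lemma norm_shift_apply (y : X) (u : Lp ℂ 2 m) : ‖shift m y u‖ = ‖u‖ :=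
  (Lp.compMeasurePreservingₗᵢ ℂ (fun x : X => x + y)
    (measurePreserving_add_right m y)).norm_map u

lemma norm_shift_le (y : X) : ‖shift m y‖ ≤ 1 :=
  ContinuousLinearMap.opNorm_le_bound _ zero_le_one fun u => by rw [norm_shift_apply, one_mul]

lemma shift_add (x y : X) : shift m (x + y) = shift m x * shift m y := by
  ext1 u
  apply Lp.ext
  rw [mul_apply_eq_comp]
  filter_upwards [coeFn_shift (x + y) u, coeFn_shift x (shift m y u),
    ae_comp_add_right (coeFn_shift y u) x] with q h1 h2 h3
  rw [h1, h2, h3, add_assoc]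

lemma shift_zero : shift m (0 : X) = 1 := by
  ext1 u
  apply Lp.ext
  filter_upwards [coeFn_shift 0 u] with q h1
  rw [h1, add_zero]; rfl

lemma adjoint_shift (x : X) : star (shift m x) = shift m (-x) := by
  rw [ContinuousLinearMap.star_eq_adjoint, eq_comm, ContinuousLinearMap.eq_adjoint_iff]
  intro u v
  rw [← (Lp.compMeasurePreservingₗᵢ ℂ (fun q : X => q + x)
    (measurePreserving_add_right m x)).inner_map_map (shift m (-x) u) v]
  change inner ℂ (shift m x (shift m (-x) u)) (shift m x v) = _
  rw [← mul_apply_eq_comp, ← shift_add, add_neg_cancel, shift_zero]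
  rfl

lemma continuous_shift_uncurry : Continuous fun p : X × Lp ℂ 2 m => shift m p.1 p.2 := by
  let f : X → C(X, X) := fun y => ⟨fun x => x + y, by fun_prop⟩
  have hf : Continuous f :=
    ContinuousMap.continuous_of_continuous_uncurry _ (by
      change Continuous fun p : X × X => p.2 + p.1
      fun_prop)
  exact Continuous.compMeasurePreservingLp (p := 2) (μ := m) (ν := m)
    (f := fun p : X × Lp ℂ 2 m => p.2) (g := fun p => f p.1) continuous_snd
    (hf.comp continuous_fst) (fun p => measurePreserving_add_right m p.1) ENNReal.ofNat_ne_top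

lemma continuous_shift (u : Lp ℂ 2 m) : Continuous fun y : X => shift m y u :=
  continuous_shift_uncurry.comp (continuous_id.prodMk continuous_const)

lemma coeFn_multiplication (g : BoundedContinuousFunction X ℂ) (u : Lp ℂ 2 m) :
    multiplication m g u =ᵐ[m] fun x => g x * u x :=
  (norm_mul_memLp m g.continuous g.norm_coe_le_norm u).coeFn_toLp

lemma norm_multiplication_le (g : BoundedContinuousFunction X ℂ) : ‖multiplication m g‖ ≤ ‖g‖ :=
  LinearMap.mkContinuous_norm_le _ (norm_nonneg _) _

lemma multiplication_mul (g h : BoundedContinuousFunction X ℂ) :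
    multiplication m (g * h) = multiplication m g * multiplication m h := by
  ext1 u
  apply Lp.ext
  rw [mul_apply_eq_comp]
  filter_upwards [coeFn_multiplication (g * h) u, coeFn_multiplication g (multiplication m h u),
    coeFn_multiplication h u] with q h1 h2 h3
  rw [h1, h2, h3, BoundedContinuousFunction.coe_mul, Pi.mul_apply, mul_assoc]

lemma multiplication_one : multiplication m (1 : BoundedContinuousFunction X ℂ) = 1 := by
  ext1 u
  apply Lp.ext
  filter_upwards [coeFn_multiplication 1 u] with q h1
  rw [h1, BoundedContinuousFunction.coe_one, Pi.one_apply, one_mul]; rfl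

lemma multiplication_star (g : BoundedContinuousFunction X ℂ) :
    star (multiplication m g) = multiplication m (star g) := by
  rw [ContinuousLinearMap.star_eq_adjoint, eq_comm, ContinuousLinearMap.eq_adjoint_iff]
  intro u v
  rw [L2.inner_def, L2.inner_def]
  refine integral_congr_ae ?_
  filter_upwards [coeFn_multiplication (star g) u, coeFn_multiplication g v] with q h1 h2
  rw [h1, h2, RCLike.inner_apply, RCLike.inner_apply, BoundedContinuousFunction.star_apply,
    map_mul, RCLike.star_def, Complex.conj_conj]
  ring

/-- The representation `r` of `C₀(X)` by multiplication operators. -/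
def rep (m : Measure X) [m.IsAddHaarMeasure] : C₀(X, ℂ) →L[ℂ] (Lp ℂ 2 m →L[ℂ] Lp ℂ 2 m) :=
  LinearMap.mkContinuous
    { toFun := fun a => multiplication m a.toBCF
      map_add' := fun a b => by
        ext1 u
        apply Lp.ext
        rw [add_apply]
        filter_upwards [coeFn_multiplication (a + b).toBCF u, coeFn_multiplication a.toBCF u,
          coeFn_multiplication b.toBCF u,
          Lp.coeFn_add (multiplication m a.toBCF u) (multiplication m b.toBCF u)] with q h1 h2 h3 h4
        rw [h4, Pi.add_apply, h1, h2, h3, ← add_mul]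
        rfl
      map_smul' := fun c a => by
        ext1 u
        apply Lp.ext
        rw [RingHom.id_apply, smul_apply]
        filter_upwards [coeFn_multiplication (c • a).toBCF u, coeFn_multiplication a.toBCF u,
          Lp.coeFn_smul c (multiplication m a.toBCF u)] with q h1 h2 h3
        rw [h3, Pi.smul_apply, h1, h2, smul_eq_mul, ← mul_assoc]
        rfl } 1 fun a => by
      rw [one_mul]
      exact (norm_multiplication_le a.toBCF).trans_eq (ZeroAtInftyContinuousMap.norm_toBCF_eq_norm)

lemma rep_def (a : C₀(X, ℂ)) : rep m a = multiplication m a.toBCF := rfl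

lemma coeFn_rep (a : C₀(X, ℂ)) (u : Lp ℂ 2 m) : rep m a u =ᵐ[m] fun x => a x * u x :=
  coeFn_multiplication _ u

lemma norm_rep_le (a : C₀(X, ℂ)) : ‖rep m a‖ ≤ ‖a‖ :=
  (norm_multiplication_le a.toBCF).trans_eq (ZeroAtInftyContinuousMap.norm_toBCF_eq_norm)

lemma rep_mul (a b : C₀(X, ℂ)) : rep m (a * b) = rep m a * rep m b := by
  rw [rep_def, rep_def, rep_def, ← multiplication_mul]; rfl

lemma rep_star (a : C₀(X, ℂ)) : star (rep m a) = rep m (star a) :=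
  multiplication_star a.toBCF

lemma phase_mul_rep (v : C(X, Circle)) (a : C₀(X, ℂ)) :
    multiplication m (phaseFunction v) * rep m a = rep m (phaseMul v a) := by
  rw [rep_def, rep_def, ← multiplication_mul]; rfl

lemma shift_mul_rep (y : X) (a : C₀(X, ℂ)) :
    shift m y * rep m a = rep m (translate y a) * shift m y := by
  ext1 u
  apply Lp.ext
  rw [mul_apply_eq_comp, mul_apply_eq_comp]
  filter_upwards [coeFn_shift y (rep m a u), coeFn_shift y u, ae_comp_add_right (coeFn_rep a u) y,
    coeFn_rep (translate y a) (shift m y u)] with q h1 h2 h3 h4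
  rw [h1, h3, h4, h2]; rfl

lemma phase_mul_phase (v w : C(X, Circle)) :
    multiplication m (phaseFunction v) * multiplication m (phaseFunction w) =
      multiplication m (phaseFunction (v * w)) := by
  rw [← multiplication_mul]
  congr 1

lemma phase_one : multiplication m (phaseFunction (1 : C(X, Circle))) = 1 := by
  rw [← multiplication_one]
  congr 1

lemma norm_phase_le (v : C(X, Circle)) : ‖multiplication m (phaseFunction v)‖ ≤ 1 :=
  (norm_multiplication_le _).trans
    ((BoundedContinuousFunction.norm_le zero_le_one).2 fun x => (Circle.norm_coe (v x)).le)

/-- A continuous function of compact support, as an element of `C₀(X)`. -/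
def ofCompact (f : X → ℂ) (hf : Continuous f) (hs : HasCompactSupport f) : C₀(X, ℂ) where
  toFun := f
  continuous_toFun := hf
  zero_at_infty' := hs.is_zero_at_infty

lemma exists_bump {K : Set X} (hK : IsCompact K) :
    ∃ a : C₀(X, ℂ), HasCompactSupport a ∧ (∀ x ∈ K, a x = 1) ∧ ∀ x, ‖a x‖ ≤ 1 := by
  obtain ⟨c, h1, -, hc, h2⟩ := exists_continuous_one_zero_of_isCompact hK isClosed_empty
    (Set.disjoint_empty K)
  refine ⟨ofCompact (fun x => ((c x : ℝ) : ℂ)) (Complex.continuous_ofReal.comp c.continuous)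
    (HasCompactSupport.comp_left (g := fun t : ℝ => (t : ℂ)) hc (by simp)),
    HasCompactSupport.comp_left (g := fun t : ℝ => (t : ℂ)) hc (by simp), fun x hx => ?_,
    fun x => ?_⟩
  · change ((c x : ℝ) : ℂ) = 1
    rw [h1 hx]; simp
  · change ‖((c x : ℝ) : ℂ)‖ ≤ 1
    rw [Complex.norm_real, Real.norm_of_nonneg (h2 x).1]
    exact (h2 x).2

/-- The vectors `r(a) w` are dense in `L²(X)`: they include all continuous functions of compact
support. -/
lemma dense_range_rep :
    Dense {u : Lp ℂ 2 m | ∃ (a : C₀(X, ℂ)) (w : Lp ℂ 2 m), rep m a w = u} := by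
  rw [Metric.dense_iff]
  intro u r hr
  obtain ⟨g, hgc, hgd, hg, hgL⟩ := (Lp.memLp u).exists_hasCompactSupport_eLpNorm_sub_le
    (by norm_num) (ε := ENNReal.ofReal (r / 2)) (by simpa using hr)
  -- a bump function equal to `1` on the support of `g` gives `r(a) g = g`
  obtain ⟨a, -, ha, -⟩ := exists_bump (X := X) hgc.isCompact
  refine ⟨hgL.toLp g, ?_, a, hgL.toLp g, ?_⟩
  · rw [Metric.mem_ball, dist_comm, dist_eq_norm]
    have : u = (Lp.memLp u).toLp u := (Lp.toLp_coeFn u (Lp.memLp u)).symm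
    rw [this, ← MemLp.toLp_sub, Lp.norm_toLp]
    refine lt_of_le_of_lt (ENNReal.toReal_mono ENNReal.ofReal_ne_top hgd) ?_
    rw [ENNReal.toReal_ofReal (by positivity)]
    linarith
  · apply Lp.ext
    filter_upwards [coeFn_rep a (hgL.toLp g), hgL.coeFn_toLp] with x h1 h2
    rw [h1, h2]
    by_cases hx : x ∈ tsupport g
    · rw [ha x hx, one_mul]
    · rw [image_eq_zero_of_notMem_tsupport hx, mul_zero]

/-- Strong continuity of the multiplication operators with respect to the compact-open topology. -/
lemma continuous_phase (u : Lp ℂ 2 m) :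
    Continuous fun v : C(X, Circle) => multiplication m (phaseFunction v) u := by
  refine continuous_of_uniform_approx_of_continuous (fun s hs => ?_)
  obtain ⟨ε, hε, hεs⟩ := Metric.mem_uniformity_dist.1 hs
  obtain ⟨_, hu, a, w, rfl⟩ := Metric.dense_iff.1 (dense_range_rep (m := m)) u ε hε
  refine ⟨fun v => multiplication m (phaseFunction v) (rep m a w), ?_, fun v => hεs ?_⟩
  · have h : ∀ v : C(X, Circle), multiplication m (phaseFunction v) (rep m a w) =
        rep m (phaseMul v a) w := fun v => by
      rw [← phase_mul_rep]; rfl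
    simp only [h]
    have h2 : Continuous fun v : C(X, Circle) => phaseMul v a :=
      continuous_phaseMul.comp (continuous_id.prodMk continuous_const)
    exact ((rep m).continuous.comp h2).clm_apply continuous_const
  · rw [dist_eq_norm, ← map_sub]
    refine (ContinuousLinearMap.le_of_opNorm_le _ (norm_phase_le v) _).trans_lt ?_
    rwa [one_mul, ← dist_eq_norm, dist_comm]

lemma continuous_phase_uncurry :
    Continuous fun p : C(X, Circle) × Lp ℂ 2 m => multiplication m (phaseFunction p.1) p.2 := by
  rw [continuous_iff_continuousAt]
  rintro ⟨x₀, u₀⟩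
  rw [ContinuousAt, tendsto_iff_dist_tendsto_zero]
  let M := fun v : C(X, Circle) => multiplication m (phaseFunction v)
  have h1 : Tendsto (fun p : C(X, Circle) × Lp ℂ 2 m =>
      dist p.2 u₀ + dist (M p.1 u₀) (M x₀ u₀)) (𝓝 (x₀, u₀)) (𝓝 0) := by
    have : Continuous fun p : C(X, Circle) × Lp ℂ 2 m =>
        dist p.2 u₀ + dist (M p.1 u₀) (M x₀ u₀) :=
      (continuous_snd.dist continuous_const).add
        (((continuous_phase u₀).comp continuous_fst).dist continuous_const)
    simpa using this.tendsto (x₀, u₀)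
  refine squeeze_zero (fun _ => dist_nonneg) (fun p => ?_) h1
  refine (dist_triangle _ (M p.1 u₀) _).trans ?_
  gcongr
  rw [dist_eq_norm, dist_eq_norm]
  change ‖M p.1 p.2 - M p.1 u₀‖ ≤ _
  rw [← map_sub]
  exact (ContinuousLinearMap.le_of_opNorm_le _ (norm_phase_le p.1) _).trans_eq (one_mul _)

end Operators

/-! ### Characters separate points -/

section Characters
variable {X : Type u} [AddCommGroup X] [TopologicalSpace X] [IsTopologicalAddGroup X]
  [LocallyCompactSpace X] [T2Space X] [SecondCountableTopology X]
  [MeasurableSpace X] [BorelSpace X] (m : Measure X) [m.IsAddHaarMeasure]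

/-- The von Neumann algebra generated by the translations of `L²(X)`, as a bicommutant. -/
def shiftAlgebra : StarSubalgebra ℂ (Lp ℂ 2 m →L[ℂ] Lp ℂ 2 m) :=
  StarSubalgebra.centralizer ℂ (Set.centralizer (Set.range (shift m)))

variable {m}

lemma mem_centralizer_range_shift {a : Lp ℂ 2 m →L[ℂ] Lp ℂ 2 m} :
    a ∈ Set.centralizer (Set.range (shift m)) ↔ ∀ x, shift m x * a = a * shift m x := by
  simp [Set.mem_centralizer_iff]

lemma star_mem_centralizer_range_shift {a : Lp ℂ 2 m →L[ℂ] Lp ℂ 2 m}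
    (ha : a ∈ Set.centralizer (Set.range (shift m))) :
    star a ∈ Set.centralizer (Set.range (shift m)) := by
  rw [mem_centralizer_range_shift] at ha ⊢
  intro x
  have h := congrArg star (ha (-x))
  rw [star_mul, star_mul, adjoint_shift, neg_neg] at h
  exact h.symm

lemma mem_shiftAlgebra {z : Lp ℂ 2 m →L[ℂ] Lp ℂ 2 m} :
    z ∈ shiftAlgebra m ↔
      ∀ a, (∀ x, shift m x * a = a * shift m x) → a * z = z * a := by
  rw [shiftAlgebra, StarSubalgebra.mem_centralizer_iff]
  refine ⟨fun h a ha => (h a (mem_centralizer_range_shift.2 ha)).1, fun h a ha => ⟨?_, ?_⟩⟩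
  · exact h a (mem_centralizer_range_shift.1 ha)
  · exact h _ (mem_centralizer_range_shift.1 (star_mem_centralizer_range_shift ha))

lemma shift_comm (x y : X) : shift m x * shift m y = shift m y * shift m x := by
  rw [← shift_add, ← shift_add, add_comm]

lemma shift_mem_shiftAlgebra (x : X) : shift m x ∈ shiftAlgebra m :=
  mem_shiftAlgebra.2 fun _ ha => (ha x).symm

lemma shiftAlgebra_comm {a b : Lp ℂ 2 m →L[ℂ] Lp ℂ 2 m} (ha : a ∈ shiftAlgebra m)
    (hb : b ∈ shiftAlgebra m) : a * b = b * a := by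
  refine (mem_shiftAlgebra.1 ha b fun x => ?_).symm
  exact mem_shiftAlgebra.1 hb _ fun y => shift_comm y x

instance : CommCStarAlgebra (shiftAlgebra m) where
  __ := StarSubalgebra.cstarAlgebra (shiftAlgebra m)
    (h_closed := Set.isClosed_centralizer _)
  mul_comm a b := Subtype.ext (shiftAlgebra_comm a.2 b.2)

lemma stronglyIntegrable_convolution (g : X →₁[m] ℂ) :
    StronglyIntegrable (fun y => g y • shift m y) m :=
  ⟨fun u => (Lp.aestronglyMeasurable g).smul (continuous_shift u).aestronglyMeasurable,
    fun y => ‖g y‖, (L1.integrable_coeFn g).norm, Eventually.of_forall fun y => by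
      rw [norm_smul]
      exact mul_le_of_le_one_right (norm_nonneg _) (norm_shift_le y)⟩

/-- The operator `∫ g(y) T(y) dy` for `g ∈ L¹(X)`. -/
def convolutionOp (g : X →₁[m] ℂ) : Lp ℂ 2 m →L[ℂ] Lp ℂ 2 m :=
  strongIntegral (stronglyIntegrable_convolution g)

lemma convolutionOp_apply (g : X →₁[m] ℂ) (u : Lp ℂ 2 m) :
    convolutionOp g u = ∫ y, g y • shift m y u ∂m := rfl

lemma convolutionOp_mem (g : X →₁[m] ℂ) : convolutionOp g ∈ shiftAlgebra m := by
  refine mem_shiftAlgebra.2 fun a ha => ?_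
  ext1 u
  rw [mul_apply_eq_comp, mul_apply_eq_comp, convolutionOp, map_strongIntegral,
    strongIntegral_apply]
  refine integral_congr_ae (Eventually.of_forall fun y => ?_)
  change a (g y • shift m y u) = g y • shift m y (a u)
  rw [map_smul]
  exact congrArg (fun T : Lp ℂ 2 m →L[ℂ] Lp ℂ 2 m => g y • T u) (ha y).symm

lemma norm_convolutionOp_sub_le (g g' : X →₁[m] ℂ) :
    ‖convolutionOp g - convolutionOp g'‖ ≤ ‖g - g'‖ := by
  refine ContinuousLinearMap.opNorm_le_bound _ (norm_nonneg _) fun u => ?_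
  have h : (convolutionOp g - convolutionOp g') u =
      ∫ y, ((g y • shift m y) u - (g' y • shift m y) u) ∂m :=
    (integral_sub ((stronglyIntegrable_convolution g).integrable u)
      ((stronglyIntegrable_convolution g').integrable u)).symm
  rw [h, L1.norm_eq_integral_norm, ← integral_mul_const]
  refine norm_integral_le_of_norm_le ((L1.integrable_coeFn (g - g')).norm.mul_const _) ?_
  filter_upwards [Lp.coeFn_sub g g'] with y hy
  rw [hy, Pi.sub_apply, smul_apply, smul_apply, ← sub_smul, norm_smul, norm_shift_apply]

lemma continuous_convolutionOp :
    Continuous (convolutionOp : (X →₁[m] ℂ) → Lp ℂ 2 m →L[ℂ] Lp ℂ 2 m) := by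
  refine (LipschitzWith.of_dist_le_mul (K := 1) fun g g' => ?_).continuous
  rw [dist_eq_norm, dist_eq_norm, NNReal.coe_one, one_mul]
  exact norm_convolutionOp_sub_le g g'

/-- A translation is absorbed by the convolution operators, where it acts on `L¹(X)`; hence
`x ↦ (∫ g(y) T(y) dy) T(x)` is norm continuous although `T` is only strongly continuous. -/
lemma convolutionOp_mul_shift (g : X →₁[m] ℂ) (x : X) :
    convolutionOp g * shift m x = convolutionOp (Lp.compMeasurePreserving (fun y : X => y + -x)
      (measurePreserving_add_right m (-x)) g) := by
  ext1 u
  rw [mul_apply_eq_comp, convolutionOp_apply, convolutionOp_apply]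
  rw [← integral_add_right_eq_self _ (-x)]
  refine integral_congr_ae ?_
  filter_upwards [Lp.coeFn_compMeasurePreserving g (measurePreserving_add_right m (-x))] with y hy
  rw [hy, Function.comp_apply, ← mul_apply_eq_comp, ← shift_add, neg_add_cancel_right]

lemma continuous_convolutionOp_mul_shift (g : X →₁[m] ℂ) :
    Continuous fun x => convolutionOp g * shift m x := by
  simp only [convolutionOp_mul_shift]
  refine continuous_convolutionOp.comp ?_
  let f : X → C(X, X) := fun x => ⟨fun y => y + -x, by fun_prop⟩
  have hf : Continuous f :=
    ContinuousMap.continuous_of_continuous_uncurry _ (by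
      change Continuous fun p : X × X => p.2 + -p.1
      fun_prop)
  exact Continuous.compMeasurePreservingLp (p := 1) (μ := m) (ν := m)
    (f := fun _ : X => g) (g := f) continuous_const hf
    (fun x => measurePreserving_add_right m (-x)) ENNReal.one_ne_top

lemma exists_shift_ne {y : X} (hy : y ≠ 0) : ∃ u : Lp ℂ 2 m, shift m y u ≠ u := by
  obtain ⟨V, W, hV, hW, hyV, h0W, hVW⟩ := t2_separation hy
  obtain ⟨K, hK, hKi, hKU⟩ := exists_compact_subset
    (hW.inter (hV.preimage (continuous_add_const y)))
    (show (0 : X) ∈ W ∩ (fun q => q + y) ⁻¹' V from ⟨h0W, by simpa using hyV⟩)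
  have hdisj : ∀ q ∈ K, q + y ∉ K := fun q hq hq' =>
    Set.disjoint_left.1 hVW (hKU hq).2 (hKU hq').1
  have hpos : 0 < m K := (isOpen_interior.measure_pos m ⟨0, hKi⟩).trans_le
    (measure_mono interior_subset)
  refine ⟨indicatorConstLp 2 hK.measurableSet (hK.measure_lt_top (μ := m)).ne 1,
    fun h => hpos.ne' ?_⟩
  have hae : ∀ᵐ q ∂m, q ∉ K := by
    have h1 := coeFn_shift y
      (indicatorConstLp 2 hK.measurableSet (hK.measure_lt_top (μ := m)).ne (1 : ℂ))
    rw [h] at h1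
    have h2 : (indicatorConstLp 2 hK.measurableSet hK.measure_lt_top.ne (1 : ℂ) : Lp ℂ 2 m)
      =ᵐ[m] K.indicator fun _ => (1 : ℂ) := indicatorConstLp_coeFn
    filter_upwards [h1, h2, ae_comp_add_right h2 y] with q e1 e2 e3 hq
    rw [e2, e3, Set.indicator_of_mem hq, Set.indicator_of_notMem (hdisj q hq)] at e1
    exact one_ne_zero e1
  simpa using measure_eq_zero_iff_ae_notMem.2 hae

/-- The convolution operators see the translations: for `d = T(y)u - u ≠ 0`, the function
`⟨d, T(x)d⟩` has positive real part on a neighbourhood `K` of `0`, so `∫_K T(x) dx` does not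
annihilate `d`. -/
lemma exists_convolutionOp_ne {y : X} (hy : y ≠ 0) :
    ∃ g : X →₁[m] ℂ, convolutionOp g * shift m y ≠ convolutionOp g := by
  obtain ⟨u, hu⟩ := exists_shift_ne (m := m) hy
  set d := shift m y u - u with hd
  have hd0 : d ≠ 0 := sub_ne_zero.2 hu
  have hc' : Continuous fun x : X => inner ℂ d (shift m x d) :=
    continuous_const.inner (continuous_shift d)
  have hc : Continuous fun x : X => (inner ℂ d (shift m x d)).re :=
    Complex.continuous_re.comp hc'
  have hpos : 0 < (inner ℂ d (shift m (0 : X) d)).re := by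
    rw [shift_zero]
    change 0 < RCLike.re (inner ℂ d d)
    rw [inner_self_eq_norm_sq]
    have := norm_pos_iff.2 hd0
    positivity
  obtain ⟨K, hK, hKi, hKU⟩ := exists_compact_subset
    (isOpen_lt continuous_const hc)
    (show (0 : X) ∈ {x | 0 < (inner ℂ d (shift m x d)).re} from hpos)
  have hmK : 0 < m K := (isOpen_interior.measure_pos m ⟨0, hKi⟩).trans_le
    (measure_mono interior_subset)
  have hint : 0 < ∫ x in K, (inner ℂ d (shift m x d)).re ∂m := by
    rw [setIntegral_pos_iff_support_of_nonneg_ae]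
    · refine hmK.trans_le (measure_mono fun x hx => ⟨(hKU hx).ne', hx⟩)
    · exact (ae_restrict_iff' hK.measurableSet).2
        (Eventually.of_forall fun x hx => (hKU hx).le)
    · exact hc.continuousOn.integrableOn_compact hK
  refine ⟨indicatorConstLp 1 hK.measurableSet hK.measure_lt_top.ne 1, fun h => ?_⟩
  set g : X →₁[m] ℂ := indicatorConstLp 1 hK.measurableSet hK.measure_lt_top.ne 1 with hg
  have h0 : convolutionOp g d = 0 := by
    rw [hd, map_sub, ← mul_apply_eq_comp, h, sub_self]
  have h1 : inner ℂ d (convolutionOp g d) = ∫ x in K, inner ℂ d (shift m x d) ∂m := by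
    rw [convolutionOp, strongIntegral_inner, ← integral_indicator hK.measurableSet]
    refine integral_congr_ae ?_
    have h2 : g =ᵐ[m] K.indicator fun _ => (1 : ℂ) := indicatorConstLp_coeFn
    filter_upwards [h2] with x hx
    rw [hx, smul_apply, inner_smul_right]
    by_cases hxK : x ∈ K <;> simp [hxK]
  have h2 : (∫ x in K, inner ℂ d (shift m x d) ∂m).re = ∫ x in K, (inner ℂ d (shift m x d)).re ∂m :=
    (integral_re (hc'.continuousOn.integrableOn_compact hK)).symm
  rw [h0, inner_zero_right] at h1
  rw [← h2, ← h1] at hint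
  exact lt_irrefl _ hint

/-- A character `φ` of a commutative `C*`-algebra that contains a unitary representation `t` of `X`
restricts to a continuous character of `X`, provided that `x ↦ c t(x)` is norm continuous for some
`c` with `φ(c) ≠ 0`. -/
lemma exists_character_of_unitaries {A : Type*} [CommCStarAlgebra A] {t : X → A} {c : A} {y : X}
    (ht_add : ∀ x x', t (x + x') = t x * t x') (ht_zero : t 0 = 1)
    (ht_star : ∀ x, star (t x) = t (-x)) (hct : c * t y - c ≠ 0)
    (hcont : Continuous fun x => c * t x) : ∃ χ : DualGroup X, character χ y ≠ 1 := by
  obtain ⟨φ, hφ⟩ : ∃ φ : WeakDual.characterSpace ℂ A, φ (c * t y - c) ≠ 0 := by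
    by_contra! h
    refine hct ((gelfandTransform_isometry A).injective ?_)
    rw [map_zero]
    ext φ
    exact h φ
  -- `φ(c t(x)) = φ(c) φ(t(x))`, so `φ(c) ≠ 0` and `φ ∘ t` inherits the continuity of `c t`
  have hsub : φ (c * t y - c) = φ c * (φ (t y) - 1) := by
    rw [map_sub, map_mul, mul_sub, mul_one]
  rw [hsub] at hφ
  have hc0 : φ c ≠ 0 := left_ne_zero_of_mul hφ
  have hy1 : φ (t y) ≠ 1 := sub_ne_zero.1 (right_ne_zero_of_mul hφ)
  have hmul : ∀ x x', φ (t (x + x')) = φ (t x) * φ (t x') := fun x x' => by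
    rw [ht_add, map_mul]
  have hone : φ (t 0) = 1 := by rw [ht_zero, map_one]
  have hnorm : ∀ x, ‖φ (t x)‖ = 1 := fun x => by
    have h1 : φ (star (t x)) = star (φ (t x)) := map_star φ (t x)
    have h2 : φ (t x) * star (φ (t x)) = 1 := by
      rw [← h1, ht_star, ← hmul, add_neg_cancel, hone]
    rw [RCLike.star_def, Complex.mul_conj, Complex.normSq_eq_norm_sq] at h2
    have h3 : ‖φ (t x)‖ ^ 2 = 1 := by exact_mod_cast h2
    exact (pow_eq_one_iff_of_nonneg (norm_nonneg _) two_ne_zero).1 h3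
  have hcont' : Continuous fun x => φ (t x) := by
    have h1 : Continuous fun x => φ (c * t x) := (map_continuous φ).comp hcont
    have h2 : (fun x => φ (t x)) = fun x => (φ c)⁻¹ * φ (c * t x) := by
      funext x
      rw [map_mul, inv_mul_cancel_left₀ hc0]
    rw [h2]
    exact continuous_const.mul h1
  let χ : DualGroup X :=
    { toFun := fun x => ⟨φ (t x.toAdd), mem_sphere_zero_iff_norm.2 (hnorm _)⟩
      map_one' := Subtype.ext hone
      map_mul' := fun x x' => Subtype.ext (hmul _ _)
      continuous_toFun := Continuous.subtype_mk (hcont'.comp continuous_toAdd) _ }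
  exact ⟨χ, fun h => hy1 (congrArg (fun z : Circle => (z : ℂ)) h)⟩

/-- The continuous characters of a locally compact abelian group separate its points. -/
theorem exists_character_ne_one (m : Measure X) [m.IsAddHaarMeasure] {y : X} (hy : y ≠ 0) :
    ∃ χ : DualGroup X, character χ y ≠ 1 := by
  obtain ⟨g, hne⟩ := exists_convolutionOp_ne (m := m) hy
  exact exists_character_of_unitaries (A := shiftAlgebra m)
    (t := fun x => ⟨shift m x, shift_mem_shiftAlgebra x⟩)
    (c := ⟨convolutionOp g, convolutionOp_mem g⟩)
    (fun x x' => Subtype.ext (shift_add x x')) (Subtype.ext shift_zero)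
    (fun x => Subtype.ext (adjoint_shift x))
    (fun h => hne (congrArg Subtype.val (sub_eq_zero.1 h)))
    (Continuous.subtype_mk (continuous_convolutionOp_mul_shift g) _)

end Characters

/-! ### Uniqueness of Fourier transforms -/

section Uniqueness
open BoundedContinuousFunction

variable {E Z : Type*} [TopologicalSpace E] [PolishSpace E] [MeasurableSpace E] [BorelSpace E]
  [MeasurableSpace Z] {ρ : Measure Z}

lemma integrable_comp_mul {h : Z → ℂ} (hh : Integrable h ρ) {p : Z → E} (hp : Measurable p)
    (g : E →ᵇ ℂ) : Integrable (fun z => g (p z) * h z) ρ :=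
  hh.bdd_mul (g.continuous.measurable.comp hp).aestronglyMeasurable
    (Eventually.of_forall fun z => g.norm_coe_le_norm (p z))

/-- The subalgebra spanned by a self-adjoint monoid of bounded continuous functions. -/
def spanStarSubalgebra (M : Submonoid (E →ᵇ ℂ)) (hstar : ∀ g ∈ M, star g ∈ M) :
    StarSubalgebra ℂ (E →ᵇ ℂ) where
  toSubalgebra := Algebra.adjoin ℂ (M : Set (E →ᵇ ℂ))
  star_mem' := by
    intro a ha
    induction ha using Algebra.adjoin_induction with
    | mem x hx => exact Algebra.subset_adjoin (hstar x hx)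
    | algebraMap r =>
      change star (algebraMap ℂ (E →ᵇ ℂ) r) ∈ Algebra.adjoin ℂ (M : Set (E →ᵇ ℂ))
      rw [← algebraMap_star_comm]
      exact Subalgebra.algebraMap_mem _ _
    | add x y _ _ hx hy =>
      change star (x + y) ∈ Algebra.adjoin ℂ (M : Set (E →ᵇ ℂ))
      rw [star_add]; exact add_mem hx hy
    | mul x y _ _ hx hy =>
      change star (x * y) ∈ Algebra.adjoin ℂ (M : Set (E →ᵇ ℂ))
      rw [star_mul']; exact mul_mem hx hy

lemma mem_spanStarSubalgebra {M : Submonoid (E →ᵇ ℂ)} {hstar : ∀ g ∈ M, star g ∈ M} {g : E →ᵇ ℂ} :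
    g ∈ spanStarSubalgebra M hstar ↔ g ∈ Submodule.span ℂ (M : Set (E →ᵇ ℂ)) := by
  change g ∈ Subalgebra.toSubmodule (Algebra.adjoin ℂ (M : Set (E →ᵇ ℂ))) ↔ _
  rw [Algebra.adjoin_eq_span, Submonoid.closure_eq]

/-- The signed measure `p_*(f ρ)` is the difference of two finite measures on a Polish space, which
agree if their integrals agree on a self-adjoint algebra that separates points. -/
lemma integral_comp_mul_ofReal_eq_zero {A : StarSubalgebra ℂ (E →ᵇ ℂ)}
    (hA : (A.map (toContinuousMapStarₐ ℂ)).SeparatesPoints)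
    {f : Z → ℝ} (hf : Integrable f ρ) {p : Z → E} (hp : Measurable p)
    (h0 : ∀ g ∈ A, ∫ z, g (p z) * (f z : ℂ) ∂ρ = 0) (g : E →ᵇ ℂ) :
    ∫ z, g (p z) * (f z : ℂ) ∂ρ = 0 := by
  let P : (Z → ℝ) → Measure E := fun f => (ρ.withDensity fun z => ENNReal.ofReal (f z)).map p
  have key : ∀ {f : Z → ℝ}, Integrable f ρ → ∀ g : E →ᵇ ℂ,
      ∫ x, g x ∂(P f) = ∫ z, g (p z) * ((max (f z) 0 : ℝ) : ℂ) ∂ρ := by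
    intro f hf g
    rw [integral_map hp.aemeasurable g.continuous.aestronglyMeasurable,
      integral_withDensity_eq_integral_toReal_smul₀ hf.1.aemeasurable.ennreal_ofReal
        (Eventually.of_forall fun _ => ENNReal.ofReal_lt_top)]
    refine integral_congr_ae (Eventually.of_forall fun z => ?_)
    simp only [ENNReal.toReal_ofReal', Complex.real_smul]
    ring
  have hfin : ∀ {f : Z → ℝ}, Integrable f ρ → IsFiniteMeasure (P f) := by
    intro f hf
    have := isFiniteMeasure_withDensity_ofReal hf.2
    exact Measure.isFiniteMeasure_map _ _
  have hsub : ∀ g : E →ᵇ ℂ, ∫ x, g x ∂(P f) - ∫ x, g x ∂(P (-f)) = ∫ z, g (p z) * (f z : ℂ) ∂ρ := by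
    intro g
    have e1 : Integrable (fun z => ((max (f z) 0 : ℝ) : ℂ)) ρ := hf.pos_part.ofReal
    have e2 : Integrable (fun z => ((max ((-f) z) 0 : ℝ) : ℂ)) ρ := hf.neg.pos_part.ofReal
    rw [key hf, key hf.neg, ← integral_sub (integrable_comp_mul e1 hp g)
      (integrable_comp_mul e2 hp g)]
    refine integral_congr_ae (Eventually.of_forall fun z => ?_)
    simp only [Pi.neg_apply]
    rw [← mul_sub, ← Complex.ofReal_sub, max_zero_sub_max_neg_zero_eq_self]
  have := hfin hf
  have := hfin hf.neg
  have hP : P f = P (-f) := ext_of_forall_mem_subalgebra_integral_eq_of_polish hA fun g hg =>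
    sub_eq_zero.1 ((hsub g).trans (h0 g hg))
  rw [← hsub, hP, sub_self]

/-- A complex measure `p_*(h ρ)` is determined by its integrals against a self-adjoint monoid of
bounded continuous functions that separates points. -/
theorem integral_comp_mul_eq_zero (M : Submonoid (E →ᵇ ℂ)) (hstar : ∀ g ∈ M, star g ∈ M)
    (hsep : ∀ x y, x ≠ y → ∃ g ∈ M, g x ≠ g y) {h : Z → ℂ} (hh : Integrable h ρ)
    {p : Z → E} (hp : Measurable p) (h0 : ∀ g ∈ M, ∫ z, g (p z) * h z ∂ρ = 0) (g : E →ᵇ ℂ) :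
    ∫ z, g (p z) * h z ∂ρ = 0 := by
  let A := spanStarSubalgebra M hstar
  have hA : (A.map (toContinuousMapStarₐ ℂ)).SeparatesPoints := by
    intro x y hxy
    obtain ⟨g, hg, hne⟩ := hsep x y hxy
    exact ⟨_, ⟨_, ⟨g, Algebra.subset_adjoin hg, rfl⟩, rfl⟩, hne⟩
  have hint := fun g : E →ᵇ ℂ => integrable_comp_mul hh hp g
  have h1 : ∀ g ∈ A, ∫ z, g (p z) * h z ∂ρ = 0 := by
    intro g hg
    have hg' := mem_spanStarSubalgebra.1 hg
    induction hg' using Submodule.span_induction with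
    | mem x hx => exact h0 x hx
    | zero => simp
    | add x y hx hy ihx ihy =>
      have e : ∀ z, (x + y) (p z) * h z = x (p z) * h z + y (p z) * h z := fun z => add_mul _ _ _
      simp only [e]
      rw [integral_add (hint x) (hint y), ihx (mem_spanStarSubalgebra.2 hx),
        ihy (mem_spanStarSubalgebra.2 hy), add_zero]
    | smul c x hx ih =>
      have e : ∀ z, (c • x) (p z) * h z = c * (x (p z) * h z) := fun z => mul_assoc _ _ _
      simp only [e]
      rw [integral_const_mul, ih (mem_spanStarSubalgebra.2 hx), mul_zero]
  have h2 : ∀ g ∈ A, ∫ z, g (p z) * starRingEnd ℂ (h z) ∂ρ = 0 := by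
    intro g hg
    have e := h1 _ (star_mem hg)
    rw [← map_eq_zero (starRingEnd ℂ), ← integral_conj] at e
    rw [← e]
    refine integral_congr_ae (Eventually.of_forall fun z => ?_)
    simp
  have hconj : Integrable (fun z => starRingEnd ℂ (h z)) ρ :=
    (LinearIsometryEquiv.integrable_comp_iff Complex.conjLIE).2 hh
  have hre : ∀ g : E →ᵇ ℂ, ∫ z, g (p z) * ((h z).re : ℂ) ∂ρ =
      2⁻¹ * (∫ z, g (p z) * h z ∂ρ + ∫ z, g (p z) * starRingEnd ℂ (h z) ∂ρ) := by
    intro g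
    rw [← integral_add (hint g) (integrable_comp_mul hconj hp g), ← integral_const_mul]
    refine integral_congr_ae (Eventually.of_forall fun z => ?_)
    simp only [Complex.re_eq_add_conj]
    ring
  have him : ∀ g : E →ᵇ ℂ, ∫ z, g (p z) * ((h z).im : ℂ) ∂ρ =
      (2 * Complex.I)⁻¹ * (∫ z, g (p z) * h z ∂ρ - ∫ z, g (p z) * starRingEnd ℂ (h z) ∂ρ) := by
    intro g
    rw [← integral_sub (hint g) (integrable_comp_mul hconj hp g), ← integral_const_mul]
    refine integral_congr_ae (Eventually.of_forall fun z => ?_)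
    simp only [Complex.im_eq_sub_conj]
    ring
  have r1 := integral_comp_mul_ofReal_eq_zero hA hh.re hp (fun g hg => by
    rw [RCLike.re_eq_complex_re, hre, h1 g hg, h2 g hg, add_zero, mul_zero]) g
  have r2 := integral_comp_mul_ofReal_eq_zero hA hh.im hp (fun g hg => by
    rw [RCLike.im_eq_complex_im, him, h1 g hg, h2 g hg, sub_zero, mul_zero]) g
  have e1 : Integrable (fun z => ((h z).re : ℂ)) ρ := hh.re.ofReal
  have e2 : Integrable (fun z => ((h z).im : ℂ)) ρ := hh.im.ofReal
  have e : ∀ z, g (p z) * h z =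
      g (p z) * ((h z).re : ℂ) + Complex.I * (g (p z) * ((h z).im : ℂ)) := by
    intro z
    conv_lhs => rw [← Complex.re_add_im (h z)]
    ring
  simp only [e]
  rw [integral_add (integrable_comp_mul e1 hp g) ((integrable_comp_mul e2 hp g).const_mul _),
    integral_const_mul]
  change ∫ z, g (p z) * ((h z).re : ℂ) ∂ρ = 0 at r1
  change ∫ z, g (p z) * ((h z).im : ℂ) ∂ρ = 0 at r2
  rw [r1, r2, mul_zero, add_zero]

end Uniqueness

section FourierUniqueness
open BoundedContinuousFunction
variable {X : Type u} [AddCommGroup X] [TopologicalSpace X] [IsTopologicalAddGroup X]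
  [LocallyCompactSpace X] [T2Space X] [SecondCountableTopology X]
  [MeasurableSpace X] [BorelSpace X]
  {Z : Type*} [MeasurableSpace Z] {ρ : Measure Z}

variable (X) in
lemma polishSpace : PolishSpace X := by
  let : UniformSpace X := IsTopologicalAddGroup.rightUniformSpace X
  have : IsUniformAddGroup X := isUniformAddGroup_of_addCommGroup
  have : CompleteSpace X := IsRightUniformAddGroup.completeSpace_of_weaklyLocallyCompactSpace
  have : (uniformity X).IsCountablyGenerated := IsUniformAddGroup.uniformity_countably_generated
  let : MetricSpace X := UniformSpace.metricSpace X
  exact inferInstance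

lemma character_mul (χ χ' : DualGroup X) (x : X) :
    character (χ * χ') x = character χ x * character χ' x := rfl

lemma character_inv (χ : DualGroup X) (x : X) : character χ⁻¹ x = (character χ x)⁻¹ := rfl

lemma character_one (x : X) : character (1 : DualGroup X) x = 1 := rfl

lemma character_add (χ : DualGroup X) (x y : X) :
    character χ (x + y) = character χ x * character χ y :=
  map_mul χ (Multiplicative.ofAdd x) (Multiplicative.ofAdd y)

lemma character_neg (χ : DualGroup X) (x : X) : character χ (-x) = (character χ x)⁻¹ :=
  map_inv χ (Multiplicative.ofAdd x)

lemma character_zero (χ : DualGroup X) : character χ (0 : X) = 1 := map_one χ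

/-- A character of `X` as an element of `C(X; 𝕋)`. -/
def characterMap (χ : DualGroup X) : C(X, Circle) := ⟨character χ, continuous_character χ⟩

/-- The product character `(x, y) ↦ χ₁(x) χ₂(y)` as a bounded continuous function on `X × X`. -/
def pairFunction (χ : DualGroup X × DualGroup X) : X × X →ᵇ ℂ :=
  phaseFunction (X := X × X) ((characterMap χ.1).comp ContinuousMap.fst *
    (characterMap χ.2).comp ContinuousMap.snd)

lemma pairFunction_apply (χ : DualGroup X × DualGroup X) (p : X × X) :
    pairFunction χ p = (character χ.1 p.1 : ℂ) * (character χ.2 p.2 : ℂ) := rfl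

/-- A complex measure on `X × X` is determined by its Fourier transform. -/
theorem integral_comp_eq_zero_of_fourier_prod (m : Measure X) [m.IsAddHaarMeasure]
    {h : Z → ℂ} (hh : Integrable h ρ)
    {p : Z → X × X} (hp : Measurable p)
    (h0 : ∀ χ₁ χ₂ : DualGroup X,
      ∫ z, (character χ₁ (p z).1 : ℂ) * (character χ₂ (p z).2 : ℂ) * h z ∂ρ = 0)
    (g : X × X →ᵇ ℂ) : ∫ z, g (p z) * h z ∂ρ = 0 := by
  have := polishSpace X
  let M : Submonoid (X × X →ᵇ ℂ) :=
    { carrier := Set.range pairFunction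
      one_mem' := ⟨1, by
        ext p
        simp [pairFunction_apply, character_one]⟩
      mul_mem' := by
        rintro _ _ ⟨χ, rfl⟩ ⟨χ', rfl⟩
        refine ⟨χ * χ', ?_⟩
        ext p
        simp only [pairFunction_apply, Prod.fst_mul, Prod.snd_mul, character_mul, Circle.coe_mul,
          BoundedContinuousFunction.coe_mul, Pi.mul_apply]
        ring }
  refine integral_comp_mul_eq_zero M ?_ ?_ hh hp ?_ g
  · rintro _ ⟨χ, rfl⟩
    refine ⟨χ⁻¹, ?_⟩
    ext p
    simp only [pairFunction_apply, Prod.fst_inv, Prod.snd_inv, character_inv,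
      Circle.coe_inv_eq_conj, BoundedContinuousFunction.star_apply, RCLike.star_def, map_mul]
  · rintro ⟨x₁, x₂⟩ ⟨y₁, y₂⟩ hne
    by_cases h1 : x₁ = y₁
    · have h2 : x₂ - y₂ ≠ 0 := fun h => hne (by rw [h1, sub_eq_zero.1 h])
      obtain ⟨χ, hχ⟩ := exists_character_ne_one m h2
      refine ⟨_, ⟨(1, χ), rfl⟩, fun h => hχ ?_⟩
      simp only [pairFunction_apply, character_one, Circle.coe_one, one_mul] at h
      rw [sub_eq_add_neg, character_add, character_neg, Circle.coe_injective h, mul_inv_cancel]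
    · obtain ⟨χ, hχ⟩ := exists_character_ne_one m (sub_ne_zero.2 h1)
      refine ⟨_, ⟨(χ, 1), rfl⟩, fun h => hχ ?_⟩
      simp only [pairFunction_apply, character_one, Circle.coe_one, mul_one] at h
      rw [sub_eq_add_neg, character_add, character_neg, Circle.coe_injective h, mul_inv_cancel]
  · rintro _ ⟨χ, rfl⟩
    exact h0 χ.1 χ.2

/-- A complex measure on `X` is determined by its Fourier transform. -/
theorem integral_comp_eq_zero_of_fourier (m : Measure X) [m.IsAddHaarMeasure]
    {h : Z → ℂ} (hh : Integrable h ρ)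
    {p : Z → X} (hp : Measurable p)
    (h0 : ∀ χ : DualGroup X, ∫ z, (character χ (p z) : ℂ) * h z ∂ρ = 0)
    (g : X →ᵇ ℂ) : ∫ z, g (p z) * h z ∂ρ = 0 := by
  have := integral_comp_eq_zero_of_fourier_prod m hh (p := fun z => (p z, 0))
    (hp.prodMk measurable_const) (fun χ₁ χ₂ => by
      simpa [character_zero] using h0 χ₁) (g.compContinuous ⟨Prod.fst, continuous_fst⟩)
  exact this

end FourierUniqueness

/-! ### Densities of complex measures -/

section ComplexMeasures
variable {Y : Type*} [MeasurableSpace Y]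

lemma SignedMeasure.exists_bounded_density (s : SignedMeasure Y) (ρ : Measure Y)
    [IsFiniteMeasure ρ] (hs : ∀ E, |s E| ≤ ρ.real E) :
    ∃ h : Y → ℝ, Measurable h ∧ (∀ᵐ y ∂ρ, |h y| ≤ 1) ∧
      ∀ E, MeasurableSet E → s E = ∫ y in E, h y ∂ρ := by
  have hac : s ≪ᵥ ρ.toENNRealVectorMeasure := by
    refine VectorMeasure.AbsolutelyContinuous.mk fun E hE h0 => ?_
    rw [Measure.toENNRealVectorMeasure_apply_measurable hE] at h0
    have := hs E
    rw [measureReal_def, h0, ENNReal.toReal_zero] at this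
    exact abs_nonpos_iff.1 this
  have hd := (SignedMeasure.absolutelyContinuous_iff_withDensityᵥ_rnDeriv_eq s ρ).1 hac
  have hint := SignedMeasure.integrable_rnDeriv s ρ
  have key : ∀ E, MeasurableSet E → s E = ∫ y in E, s.rnDeriv ρ y ∂ρ := fun E hE => by
    conv_lhs => rw [← hd]
    exact withDensityᵥ_apply hint hE
  refine ⟨s.rnDeriv ρ, SignedMeasure.measurable_rnDeriv s ρ, ?_, key⟩
  have h1 : s.rnDeriv ρ ≤ᵐ[ρ] fun _ => (1 : ℝ) := by
    refine ae_le_of_forall_setIntegral_le hint (integrable_const 1) fun E hE _ => ?_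
    rw [← key E hE, setIntegral_const, smul_eq_mul, mul_one]
    exact (le_abs_self _).trans (hs E)
  have h2 : (fun _ => (-1 : ℝ)) ≤ᵐ[ρ] s.rnDeriv ρ := by
    refine ae_le_of_forall_setIntegral_le (integrable_const _) hint fun E hE _ => ?_
    rw [← key E hE, setIntegral_const, smul_eq_mul, mul_neg, mul_one]
    exact neg_le_of_neg_le ((neg_le_abs _).trans (hs E))
  filter_upwards [h1, h2] with y e1 e2
  exact abs_le.2 ⟨e2, e1⟩

/-- A complex measure has an integrable density with respect to its variation. -/
lemma exists_density (μ : ComplexMeasure Y) :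
    ∃ h : Y → ℂ, Measurable h ∧ Integrable h μ.variation ∧
      ∀ f : Y → ℂ, Integrable f μ.variation →
        complexIntegral μ f = ∫ y, f y * h y ∂μ.variation := by
  have hfin := isFiniteMeasure_variation μ
  have hle : ∀ E, ‖μ E‖ ≤ μ.variation.real E := fun E =>
    VectorMeasure.norm_measure_le_variation (measure_ne_top _ _)
  obtain ⟨a, ha, ha1, hae⟩ := SignedMeasure.exists_bounded_density (ComplexMeasure.re μ) μ.variation
    fun E => (Complex.abs_re_le_norm (μ E)).trans (hle E)
  obtain ⟨b, hb, hb1, hbe⟩ := SignedMeasure.exists_bounded_density (ComplexMeasure.im μ) μ.variation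
    fun E => (Complex.abs_im_le_norm (μ E)).trans (hle E)
  have hm : Measurable fun y => (a y : ℂ) + b y * Complex.I := by fun_prop
  have hbd : ∀ᵐ y ∂μ.variation, ‖(a y : ℂ) + b y * Complex.I‖ ≤ 2 := by
    filter_upwards [ha1, hb1] with y h1 h2
    refine (norm_add_le _ _).trans ?_
    rw [norm_mul, Complex.norm_I, mul_one, Complex.norm_real, Complex.norm_real, Real.norm_eq_abs,
      Real.norm_eq_abs]
    linarith
  have hia : Integrable a μ.variation := Integrable.of_bound ha.aestronglyMeasurable 1 ha1
  have hib : Integrable b μ.variation := Integrable.of_bound hb.aestronglyMeasurable 1 hb1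
  have hfh : ∀ {f : Y → ℂ}, Integrable f μ.variation →
      Integrable (fun y => f y * ((a y : ℂ) + b y * Complex.I)) μ.variation := fun hf => by
    simpa only [mul_comm] using hf.bdd_mul hm.aestronglyMeasurable hbd
  refine ⟨fun y => a y + b y * Complex.I, hm, Integrable.of_bound hm.aestronglyMeasurable 2 hbd,
    fun f hf => ?_⟩
  have hT := dominatedFinMeasAdditive_cbmApplyMeasure μ (ContinuousLinearMap.mul ℝ ℂ)
  change setToFun μ.variation _ hT f = _
  refine hf.induction (P := fun f => setToFun μ.variation _ hT f =
    ∫ y, f y * ((a y : ℂ) + b y * Complex.I) ∂μ.variation) ?_ ?_ ?_ ?_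
  · intro c s hs hsf
    rw [setToFun_indicator_const hT hs hsf.ne]
    have e : ∀ y, s.indicator (fun _ => c) y * ((a y : ℂ) + b y * Complex.I) =
        c * s.indicator (fun y => (a y : ℂ) + b y * Complex.I) y := by
      intro y
      by_cases hy : y ∈ s <;> simp [hy]
    simp only [e]
    rw [integral_const_mul, integral_indicator hs, integral_add hia.ofReal.restrict
      (hib.ofReal.mul_const _).restrict, integral_mul_const]
    change c * μ s = _
    have e1 : (∫ y in s, (a y : ℂ) ∂μ.variation) = ((μ s).re : ℂ) :=
      (integral_ofReal (𝕜 := ℂ)).trans (by rw [← hae s hs]; rfl)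
    have e2 : (∫ y in s, (b y : ℂ) ∂μ.variation) = ((μ s).im : ℂ) :=
      (integral_ofReal (𝕜 := ℂ)).trans (by rw [← hbe s hs]; rfl)
    rw [e1, e2, Complex.re_add_im]
  · intro f g _ hf hg hPf hPg
    rw [setToFun_add hT hf hg, hPf, hPg, ← integral_add (hfh hf) (hfh hg)]
    refine integral_congr_ae (Eventually.of_forall fun y => ?_)
    simp only [Pi.add_apply]
    ring
  · refine isClosed_eq (continuous_setToFun hT) ?_
    refine (LipschitzWith.of_dist_le_mul (K := 2) fun f g => ?_).continuous
    rw [dist_eq_norm, dist_eq_norm, ← integral_sub (hfh (L1.integrable_coeFn f))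
      (hfh (L1.integrable_coeFn g)), L1.norm_eq_integral_norm, NNReal.coe_ofNat,
      ← integral_const_mul]
    refine norm_integral_le_of_norm_le ((L1.integrable_coeFn (f - g)).norm.const_mul _) ?_
    filter_upwards [Lp.coeFn_sub f g, hbd] with y hy hb
    rw [hy, Pi.sub_apply, ← sub_mul, norm_mul, mul_comm]
    gcongr
  · intro f g hfg _ hPf
    rw [← setToFun_congr_ae hT hfg, hPf]
    refine integral_congr_ae ?_
    filter_upwards [hfg] with y hy
    rw [hy]

lemma complexIntegral_dirac [TopologicalSpace Y] [OpensMeasurableSpace Y] (y : Y) {f : Y → ℂ}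
    (hf : Continuous f) : complexIntegral (VectorMeasure.dirac y (1 : ℂ)) f = f y := by
  have hf' : StronglyMeasurable f := hf.stronglyMeasurable
  refine (VectorMeasure.integral_dirac' (B := ContinuousLinearMap.mul ℝ ℂ) hf').trans ?_
  exact mul_one _

end ComplexMeasures

section Fourier
variable {X : Type u} [AddCommGroup X] [TopologicalSpace X] [IsTopologicalAddGroup X]
  [LocallyCompactSpace X] [T2Space X] [SecondCountableTopology X]
  [MeasurableSpace X] [BorelSpace X] (m : Measure X) [m.IsAddHaarMeasure]

/-- Bounded continuous functions approximate the indicators of closed sets, so a density is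
determined by its integrals against them. -/
lemma ae_eq_zero_of_integral_bounded_continuous {E : Type*} [TopologicalSpace E]
    [HasOuterApproxClosed E] [MeasurableSpace E] [BorelSpace E] {ρ : Measure E} {f : E → ℂ}
    (hf : Integrable f ρ) (h : ∀ g : BoundedContinuousFunction E ℂ, ∫ x, g x * f x ∂ρ = 0) :
    f =ᵐ[ρ] 0 := by
  refine ae_eq_zero_of_forall_setIntegral_isClosed_eq_zero hf fun s hs => ?_
  let g : ℕ → BoundedContinuousFunction E ℂ := fun n =>
    BoundedContinuousFunction.ofNormedAddCommGroup (fun x => ((hs.apprSeq n x : ℝ) : ℂ))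
      (by fun_prop) 1 fun x => by
        rw [Complex.norm_real, NNReal.norm_eq]
        exact_mod_cast HasOuterApproxClosed.apprSeq_apply_le_one hs n x
  have hg : ∀ n x, g n x = ((hs.apprSeq n x : ℝ) : ℂ) := fun _ _ => rfl
  have hlim : Tendsto (fun n => ∫ x, g n x * f x ∂ρ) atTop
      (𝓝 (∫ x, s.indicator f x ∂ρ)) := by
    refine tendsto_integral_of_dominated_convergence (fun x => ‖f x‖)
      (fun n => (g n).continuous.aestronglyMeasurable.mul hf.1) hf.norm
      (fun n => Eventually.of_forall fun x => ?_) (Eventually.of_forall fun x => ?_)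
    · rw [norm_mul, hg, Complex.norm_real, NNReal.norm_eq]
      exact mul_le_of_le_one_left (norm_nonneg _)
        (by exact_mod_cast HasOuterApproxClosed.apprSeq_apply_le_one hs n x)
    · have h1 := tendsto_pi_nhds.1 (HasOuterApproxClosed.tendsto_apprSeq hs) x
      have h2 : Tendsto (fun n => g n x) atTop
          (𝓝 (((s.indicator (fun _ => (1 : NNReal)) x : NNReal) : ℝ) : ℂ)) :=
        (Complex.continuous_ofReal.tendsto _).comp ((NNReal.continuous_coe.tendsto _).comp h1)
      have h3 : s.indicator f x =
          (((s.indicator (fun _ => (1 : NNReal)) x : NNReal) : ℝ) : ℂ) * f x := by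
        by_cases hx : x ∈ s <;> simp [hx]
      rw [h3]
      exact h2.mul_const _
  rw [← integral_indicator hs.measurableSet]
  simp only [h] at hlim
  exact (tendsto_nhds_unique tendsto_const_nhds hlim).symm

/-- Evaluation at a point, as a continuous functional on `C₀(X)`. -/
def evalC (q : X) : C₀(X, ℂ) →L[ℂ] ℂ :=
  LinearMap.mkContinuous
    { toFun := fun a => a q
      map_add' := fun _ _ => rfl
      map_smul' := fun _ _ => rfl } 1 fun a => by
    rw [one_mul]; exact norm_apply_le a q

lemma integral_apply_eq {Z : Type*} [MeasurableSpace Z] {ρ : Measure Z} {f : Z → C₀(X, ℂ)}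
    (hf : Integrable f ρ) (q : X) : (∫ z, f z ∂ρ) q = ∫ z, f z q ∂ρ :=
  ((evalC q).integral_comp_comm hf).symm

lemma continuous_symplecticKernel (ξ : PhaseSpace X) : Continuous (symplecticKernel ξ) := by
  have h1 : Continuous fun η : PhaseSpace X => (character ξ.2 η.1 : ℂ) :=
    continuous_circle_coe.comp ((continuous_character ξ.2).comp continuous_fst)
  have h2 : Continuous fun η : PhaseSpace X => (character η.2 ξ.1 : ℂ) :=
    continuous_circle_coe.comp
      (continuous_character_uncurry.comp (continuous_snd.prodMk continuous_const))
  exact h1.mul (Complex.continuous_conj.comp h2)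

lemma symplecticFourier_dirac (ξ₀ : PhaseSpace X) :
    symplecticFourier (VectorMeasure.dirac ξ₀ (1 : ℂ)) = exponential ξ₀ := by
  ext ξ
  exact complexIntegral_dirac ξ₀ (continuous_symplecticKernel ξ)

lemma partialFourier_apply (φ : X →₁[m] C₀(X, ℂ)) (ξ : PhaseSpace X) :
    partialFourier m φ ξ = ∫ y, (character ξ.2 y : ℂ) * φ y ξ.1 ∂m :=
  integral_apply_eq (integrable_character_smul m ξ.2 (L1.integrable_coeFn φ)) ξ.1

lemma integrable_apply {φ : X → C₀(X, ℂ)} (hφ : Integrable φ m) (q : X) :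
    Integrable (fun y => φ y q) m := (evalC q).integrable_comp hφ

/-- For fixed `q`, the Fourier transform of `y ↦ φ(y)(q)` determines this function almost
everywhere; a countable dense set of points `q` determines `φ`. -/
lemma partialFourier_injective : Function.Injective (partialFourier (X := X) m) := by
  rw [injective_iff_map_eq_zero]
  intro φ h
  have hφ := L1.integrable_coeFn φ
  have h1 : ∀ q : X, ∀ᵐ y ∂m, φ y q = 0 := by
    intro q
    have hq : ∀ g : BoundedContinuousFunction X ℂ, ∫ y, g y * φ y q ∂m = 0 :=
      integral_comp_eq_zero_of_fourier m (integrable_apply m hφ q) measurable_id fun χ => by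
        rw [← partialFourier_apply m φ (q, χ), h]; rfl
    have := polishSpace X
    let := TopologicalSpace.upgradeIsCompletelyMetrizable X
    exact ae_eq_zero_of_integral_bounded_continuous (integrable_apply m hφ q) hq
  have h2 : ∀ᵐ y ∂m, ∀ n, φ y (TopologicalSpace.denseSeq X n) = 0 :=
    ae_all_iff.2 fun n => h1 _
  apply Lp.ext
  filter_upwards [h2, Lp.coeFn_zero (C₀(X, ℂ)) 1 m] with y hy hz
  rw [hz]
  ext q
  have := (map_continuous (φ y)).ext_on (TopologicalSpace.denseRange_denseSeq X)
    (continuous_const (y := (0 : ℂ))) (by rintro _ ⟨n, rfl⟩; exact hy n)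
  exact congrFun this q

end Fourier

/-! ### The Schrödinger representation -/

section Schrodinger
variable {X : Type u} [AddCommGroup X] [TopologicalSpace X] [IsTopologicalAddGroup X]
  [LocallyCompactSpace X] [T2Space X] [SecondCountableTopology X]
  [MeasurableSpace X] [BorelSpace X] {m : Measure X} [m.IsAddHaarMeasure]
  {ω : TwoCocycle X} (τ : X →ₜ+ X) (lam : C(X, C(X, Circle)))

/-- The isometry `a ↦ lam(y) θ_{τy}[a]` of `C₀(X)`. Applied to the values of functions in
`L¹(X; C₀(X))`, it turns the twisted product with parameter `τ` into the untwisted product with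
`τ = 0`. -/
def untwist (y : X) : C₀(X, ℂ) →L[ℂ] C₀(X, ℂ) :=
  LinearMap.mkContinuous
    { toFun := fun a => phaseMul (lam y) (translate (τ y) a)
      map_add' := fun a b => by
        ext q
        exact mul_add _ _ _
      map_smul' := fun c a => by
        ext q
        exact mul_left_comm _ _ _ } 1 fun a => by
    rw [one_mul]
    exact (norm_phaseMul_le _ _).trans (norm_translate_le _ _)

lemma untwist_apply (y : X) (a : C₀(X, ℂ)) (q : X) :
    untwist τ lam y a q = (lam y q : ℂ) * a (q + τ y) := rfl

lemma norm_untwist_le (y : X) (a : C₀(X, ℂ)) : ‖untwist τ lam y a‖ ≤ ‖a‖ :=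
  (norm_phaseMul_le _ _).trans (norm_translate_le _ _)

lemma continuous_untwist : Continuous fun p : X × C₀(X, ℂ) => untwist τ lam p.1 p.2 := by
  have hτ : Continuous τ := map_continuous τ
  have h2 : Continuous fun p : X × C₀(X, ℂ) => translate (τ p.1) p.2 :=
    continuous_translate.comp ((hτ.comp continuous_fst).prodMk continuous_snd)
  exact continuous_phaseMul.comp ((lam.continuous.comp continuous_fst).prodMk h2)

variable (m) in
/-- The operator `r(θ_{τy}[a]) T^lam(y)`. -/
def schrodingerKernel (y : X) (a : C₀(X, ℂ)) : Lp ℂ 2 m →L[ℂ] Lp ℂ 2 m :=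
  rep m (untwist τ lam y a) * shift m y

lemma schrodingerKernel_apply (y : X) (a : C₀(X, ℂ)) (u : Lp ℂ 2 m) :
    schrodingerKernel m τ lam y a u = rep m (untwist τ lam y a) (shift m y u) := rfl

lemma schrodingerKernel_eq (y : X) (a : C₀(X, ℂ)) (u : Lp ℂ 2 m) :
    multiplication m (translate (τ y) a).toBCF (twistedShift m lam y u) =
      schrodingerKernel m τ lam y a u := by
  have h : untwist τ lam y a = phaseMul (lam y) (translate (τ y) a) := rfl
  rw [schrodingerKernel_apply, h, ← phase_mul_rep, rep_def, ← multiplication_mul, mul_comm,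
    multiplication_mul]
  rfl

lemma norm_schrodingerKernel_le (y : X) (a : C₀(X, ℂ)) : ‖schrodingerKernel m τ lam y a‖ ≤ ‖a‖ := by
  refine (norm_mul_le _ _).trans ?_
  calc _ ≤ ‖a‖ * 1 := by
        gcongr
        · exact (norm_rep_le _).trans (norm_untwist_le τ lam y a)
        · exact norm_shift_le y
    _ = ‖a‖ := mul_one _

lemma continuous_schrodingerKernel (u : Lp ℂ 2 m) :
    Continuous fun p : X × C₀(X, ℂ) => schrodingerKernel m τ lam p.1 p.2 u :=
  ((rep m).continuous.comp (continuous_untwist τ lam)).clm_apply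
    ((continuous_shift u).comp continuous_fst)

/-- The linear map `a ↦ r(θ_{τy}[a]) T^lam(y) u`. -/
def schrodingerKernelL (y : X) (u : Lp ℂ 2 m) : C₀(X, ℂ) →L[ℂ] Lp ℂ 2 m :=
  (ContinuousLinearMap.apply ℂ (Lp ℂ 2 m) (shift m y u)) ∘L (rep m ∘L untwist τ lam y)

lemma schrodingerKernelL_apply (y : X) (u : Lp ℂ 2 m) (a : C₀(X, ℂ)) :
    schrodingerKernelL τ lam y u a = schrodingerKernel m τ lam y a u := rfl

lemma stronglyIntegrable_schrodinger {φ : X → C₀(X, ℂ)} (hφ : Integrable φ m) :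
    StronglyIntegrable (fun y => schrodingerKernel m τ lam y (φ y)) m := by
  refine ⟨fun u => ?_, fun y => ‖φ y‖, hφ.norm,
    Eventually.of_forall fun y => norm_schrodingerKernel_le τ lam y (φ y)⟩
  have hid : AEStronglyMeasurable (fun y : X => y) m := continuous_id.aestronglyMeasurable
  have h3 : AEStronglyMeasurable (fun y : X => (y, φ y)) m := hid.prodMk hφ.1
  exact aestronglyMeasurable_comp (fun y : X => (y, φ y)) _
    (continuous_schrodingerKernel τ lam u) h3

/-- The integrated form of the Schrödinger representation on `L¹(X; C₀(X))`. -/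
def schrodingerOp : (X →₁[m] C₀(X, ℂ)) →ₗ[ℂ] (Lp ℂ 2 m →L[ℂ] Lp ℂ 2 m) where
  toFun φ := strongIntegral (stronglyIntegrable_schrodinger τ lam (L1.integrable_coeFn φ))
  map_add' φ ψ := by
    ext1 u
    have hφ := (stronglyIntegrable_schrodinger τ lam (L1.integrable_coeFn φ)).integrable u
    have hψ := (stronglyIntegrable_schrodinger τ lam (L1.integrable_coeFn ψ)).integrable u
    rw [add_apply, strongIntegral_apply, strongIntegral_apply, strongIntegral_apply]
    refine Eq.trans (integral_congr_ae ?_) (integral_add hφ hψ)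
    filter_upwards [Lp.coeFn_add φ ψ] with y hy
    rw [hy, Pi.add_apply, ← schrodingerKernelL_apply, map_add]; rfl
  map_smul' c φ := by
    ext1 u
    rw [smul_apply, strongIntegral_apply, strongIntegral_apply, RingHom.id_apply]
    refine Eq.trans (integral_congr_ae ?_) (integral_smul c _)
    filter_upwards [Lp.coeFn_smul c φ] with y hy
    rw [hy, Pi.smul_apply, ← schrodingerKernelL_apply, map_smul]; rfl

lemma schrodingerOp_apply (φ : X →₁[m] C₀(X, ℂ)) (u : Lp ℂ 2 m) :
    schrodingerOp τ lam φ u = ∫ y, schrodingerKernel m τ lam y (φ y) u ∂m := rfl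

lemma schrodingerOp_toL1 {φ : X → C₀(X, ℂ)} (hφ : Integrable φ m) (u : Lp ℂ 2 m) :
    schrodingerOp τ lam (hφ.toL1 φ) u = ∫ y, schrodingerKernel m τ lam y (φ y) u ∂m := by
  rw [schrodingerOp_apply]
  refine integral_congr_ae ?_
  filter_upwards [hφ.coeFn_toL1] with y hy
  rw [hy]

lemma schrodinger_eq (φ : X →₁[m] C₀(X, ℂ)) (u : Lp ℂ 2 m) :
    schrodinger m τ lam φ u = schrodingerOp τ lam φ u := by
  rw [schrodinger, schrodingerOp_apply]
  simp only [schrodingerKernel_eq]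

lemma norm_schrodingerOp_le (φ : X →₁[m] C₀(X, ℂ)) : ‖schrodingerOp τ lam φ‖ ≤ ‖φ‖ := by
  rw [L1.norm_eq_integral_norm]
  exact norm_strongIntegral_le
    (stronglyIntegrable_schrodinger τ lam (L1.integrable_coeFn φ)) (L1.integrable_coeFn φ).norm
    (Eventually.of_forall fun y => norm_schrodingerKernel_le τ lam y (φ y))

variable {lam}

lemma IsPseudoTrivialization.apply (hlam : IsPseudoTrivialization ω lam) (x y q : X) :
    (lam x q : ℂ) * lam y (q + x) = ω.toMap (x, y) q * lam (x + y) q := by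
  have h := congrArg (fun v : C(X, Circle) => v q) (hlam x y)
  have h' : lam x q * lam y (q + x) / lam (x + y) q = ω.toMap (x, y) q := h
  rw [div_eq_iff_eq_mul] at h'
  rw [← Circle.coe_mul, h', Circle.coe_mul]

lemma IsPseudoTrivialization.zero (hlam : IsPseudoTrivialization ω lam) : lam 0 = 1 := by
  ext q
  have h := hlam.apply 0 0 q
  rw [ω.right_zero, add_zero, add_zero] at h
  have h2 : lam 0 q * lam 0 q = 1 * lam 0 q := Circle.coe_injective h
  rw [mul_right_cancel h2]; rfl

lemma untwist_twistedIntegrand (hlam : IsPseudoTrivialization ω lam) (φ ψ : X → C₀(X, ℂ))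
    (x y : X) :
    untwist τ lam x (twistedIntegrand ω τ φ ψ x y) =
      untwist τ lam y (φ y) * translate y (untwist τ lam (x - y) (ψ (x - y))) := by
  ext q
  have e := hlam.apply y (x - y) q
  rw [add_sub_cancel] at e
  change (lam x q : ℂ) * (ω.toMap (y, x - y) (q + τ x + -τ x) *
    (φ y (q + τ x + τ (y - x)) * ψ (x - y) (q + τ x + (y - τ y)))) =
    (lam y q * φ y (q + τ y)) * (lam (x - y) (q + y) * ψ (x - y) (q + y + τ (x - y)))
  have e1 : q + τ x + -τ x = q := by abel
  have e2 : q + τ x + τ (y - x) = q + τ y := by rw [map_sub]; abel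
  have e3 : q + τ x + (y - τ y) = q + y + τ (x - y) := by rw [map_sub]; abel
  rw [e1, e2, e3]
  linear_combination (-(φ y (q + τ y)) * ψ (x - y) (q + y + τ (x - y))) * e

lemma schrodingerKernel_twistedIntegrand (hlam : IsPseudoTrivialization ω lam)
    (φ ψ : X → C₀(X, ℂ)) (x y : X) :
    schrodingerKernel m τ lam x (twistedIntegrand ω τ φ ψ x y) =
      schrodingerKernel m τ lam y (φ y) * schrodingerKernel m τ lam (x - y) (ψ (x - y)) := by
  rw [schrodingerKernel, untwist_twistedIntegrand τ hlam, rep_mul, schrodingerKernel,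
    schrodingerKernel, mul_assoc, mul_assoc, ← mul_assoc (shift m y), shift_mul_rep, mul_assoc,
    ← shift_add, add_sub_cancel]

lemma schrodingerOp_mul (hlam : IsPseudoTrivialization ω lam) (φ ψ : X →₁[m] C₀(X, ℂ)) :
    schrodingerOp τ lam (mulL1 ω τ m φ ψ) = schrodingerOp τ lam φ * schrodingerOp τ lam ψ := by
  ext1 u
  have hφ := L1.integrable_coeFn φ
  have hψ := L1.integrable_coeFn ψ
  have hI := integrable_twistedIntegrand ω τ m hφ hψ
  rw [mulL1, schrodingerOp_toL1, mul_apply_eq_comp, schrodingerOp_apply]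
  have h1 : ∀ᵐ x ∂m, schrodingerKernel m τ lam x (twistedProduct ω τ m φ ψ x) u =
      ∫ y, schrodingerKernel m τ lam x (twistedIntegrand ω τ φ ψ x y) u ∂m := by
    filter_upwards [hI.prod_right_ae] with x hx
    exact ((schrodingerKernelL τ lam x u).integral_comp_comm hx).symm
  rw [integral_congr_ae h1, integral_integral_swap]
  · refine integral_congr_ae (Eventually.of_forall fun y => ?_)
    have hψu := (stronglyIntegrable_schrodinger τ lam hψ).integrable u
    simp only [schrodingerKernel_twistedIntegrand τ hlam, mul_apply_eq_comp]
    rw [(schrodingerKernel m τ lam y (φ y)).integral_comp_comm (hψu.comp_sub_right y),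
      integral_sub_right_eq_self (fun x => schrodingerKernel m τ lam x (ψ x) u) y]
    rfl
  · refine (hI.norm.mul_const ‖u‖).mono' ?_ (Eventually.of_forall fun p =>
      (schrodingerKernel m τ lam _ _).le_of_opNorm_le (norm_schrodingerKernel_le τ lam _ _) u)
    have hid : AEStronglyMeasurable (fun p : X × X => p.1) (m.prod m) :=
      continuous_fst.aestronglyMeasurable
    have h3 : AEStronglyMeasurable
        (fun p : X × X => (p.1, twistedIntegrand ω τ φ ψ p.1 p.2)) (m.prod m) := hid.prodMk hI.1
    exact aestronglyMeasurable_comp (fun p : X × X => (p.1, twistedIntegrand ω τ φ ψ p.1 p.2)) _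
      (continuous_schrodingerKernel τ lam u) h3

lemma untwist_twistedStar (hlam : IsPseudoTrivialization ω lam) (φ : X → C₀(X, ℂ)) (x : X) :
    untwist τ lam x (twistedStar ω τ φ x) =
      translate x (star (untwist τ lam (-x) (φ (-x)))) := by
  ext q
  have e := hlam.apply x (-x) q
  rw [add_neg_cancel, hlam.zero] at e
  change (lam x q : ℂ) * (((ω.toMap (x, -x))⁻¹ (q + τ x + -τ x) : Circle) *
    star (φ (-x) (q + τ x + (x - 2 • τ x)))) =
    star ((lam (-x) (q + x) : ℂ) * φ (-x) (q + x + τ (-x)))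
  have e1 : q + τ x + -τ x = q := by abel
  have e2 : q + τ x + (x - 2 • τ x) = q + x + τ (-x) := by rw [map_neg]; abel
  have e3 : (((ω.toMap (x, -x))⁻¹ q : Circle) : ℂ) = ((ω.toMap (x, -x) q)⁻¹ : Circle) := rfl
  have e4 : star (lam (-x) (q + x) : ℂ) = (lam (-x) (q + x) : ℂ)⁻¹ := by
    rw [← Circle.coe_inv, Circle.coe_inv_eq_conj]; rfl
  rw [e1, e2, star_mul', e3, e4, ← mul_assoc, Circle.coe_inv]
  congr 1
  have n1 : (ω.toMap (x, -x) q : ℂ) ≠ 0 := Circle.coe_ne_zero _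
  have n2 : (lam (-x) (q + x) : ℂ) ≠ 0 := Circle.coe_ne_zero _
  field_simp
  rw [e]
  change (ω.toMap (x, -x) q : ℂ) * ((1 : Circle) : ℂ) = _
  rw [Circle.coe_one, mul_one]

lemma schrodingerKernel_star (hlam : IsPseudoTrivialization ω lam) (φ : X → C₀(X, ℂ)) (x : X) :
    schrodingerKernel m τ lam x (twistedStar ω τ φ x) =
      star (schrodingerKernel m τ lam (-x) (φ (-x))) := by
  rw [schrodingerKernel, untwist_twistedStar τ hlam, schrodingerKernel, star_mul, adjoint_shift,
    neg_neg, rep_star, shift_mul_rep]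

lemma schrodingerOp_star (hlam : IsPseudoTrivialization ω lam) (φ : X →₁[m] C₀(X, ℂ)) :
    schrodingerOp τ lam (starL1 ω τ m φ) = star (schrodingerOp τ lam φ) := by
  rw [ContinuousLinearMap.star_eq_adjoint, ContinuousLinearMap.eq_adjoint_iff]
  intro u v
  have hφ := L1.integrable_coeFn φ
  rw [starL1, schrodingerOp_toL1, schrodingerOp_apply, ← inner_conj_symm,
    ← integral_inner ((stronglyIntegrable_schrodinger τ lam
      (integrable_twistedStar ω τ m hφ)).integrable u) v,
    ← integral_inner ((stronglyIntegrable_schrodinger τ lam hφ).integrable v) u, ← integral_conj,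
    ← integral_neg_eq_self (fun y => inner ℂ u (schrodingerKernel m τ lam y (φ y) v))]
  refine integral_congr_ae (Eventually.of_forall fun x => ?_)
  simp only [schrodingerKernel_star τ hlam, ContinuousLinearMap.star_eq_adjoint, inner_conj_symm,
    ContinuousLinearMap.adjoint_inner_left]

/-- The symbol map `φ ↦ 𝔉 φ` as a linear equivalence onto the space of symbols. -/
def symbolEquiv : (X →₁[m] C₀(X, ℂ)) ≃ₗ[ℂ] symbolSpace m :=
  LinearEquiv.ofInjective (partialFourier m) (partialFourier_injective m)

lemma symbolEquiv_symm_symbol (φ : X →₁[m] C₀(X, ℂ)) : symbolEquiv.symm (symbol m φ) = φ :=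
  symbolEquiv.symm_apply_apply φ

/-- The Schrödinger representation as a representation of the symbol algebra. -/
def schrodingerRep (hlam : IsPseudoTrivialization ω lam) : SymbolRep ω τ m where
  H := Lp ℂ 2 m
  π := schrodingerOp τ lam ∘ₗ (symbolEquiv (m := m)).symm.toLinearMap
  map_mul φ ψ := by
    simp only [LinearMap.comp_apply, LinearEquiv.coe_coe, symbolEquiv_symm_symbol]
    exact schrodingerOp_mul τ hlam φ ψ
  map_star φ := by
    simp only [LinearMap.comp_apply, LinearEquiv.coe_coe, symbolEquiv_symm_symbol]
    exact schrodingerOp_star τ hlam φ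
  norm_le φ := by
    simp only [LinearMap.comp_apply, LinearEquiv.coe_coe, symbolEquiv_symm_symbol]
    exact norm_schrodingerOp_le τ lam φ

end Schrodinger

/-! ### Matrix units in `L¹(X; C₀(X))` -/

section MatrixUnits
open scoped CompactlySupported
variable {X : Type u} [AddCommGroup X] [TopologicalSpace X] [IsTopologicalAddGroup X]
  [LocallyCompactSpace X] [T2Space X] [SecondCountableTopology X]
  [MeasurableSpace X] [BorelSpace X] {m : Measure X} [m.IsAddHaarMeasure]
  {ω : TwoCocycle X} (τ : X →ₜ+ X) (lam : C(X, C(X, Circle)))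

/-- A continuous function of compact support as an element of `C₀(X)`. -/
def toC0 (f : C_c(X, ℂ)) : C₀(X, ℂ) := ofCompact f f.continuous f.hasCompactSupport

lemma memLp_compactlySupported (f : C_c(X, ℂ)) : MemLp f 2 m :=
  f.continuous.memLp_of_hasCompactSupport f.hasCompactSupport

variable (m) in
/-- The inclusion of the continuous functions of compact support into `L²(X)`. -/
def toL2 : C_c(X, ℂ) →ₗ[ℂ] Lp ℂ 2 m where
  toFun f := (memLp_compactlySupported f).toLp f
  map_add' f g := MemLp.toLp_add (memLp_compactlySupported f) (memLp_compactlySupported g)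
  map_smul' c f := MemLp.toLp_const_smul c (memLp_compactlySupported f)

lemma coeFn_toL2 (f : C_c(X, ℂ)) : toL2 m f =ᵐ[m] f := (memLp_compactlySupported f).coeFn_toLp

lemma inner_toL2 (f g : C_c(X, ℂ)) :
    inner ℂ (toL2 m f) (toL2 m g) = ∫ x, starRingEnd ℂ (f x) * g x ∂m := by
  rw [L2.inner_def]
  refine integral_congr_ae ?_
  filter_upwards [coeFn_toL2 f, coeFn_toL2 g] with x hf hg
  rw [hf, hg, RCLike.inner_apply, mul_comm]

lemma dense_range_toL2 : DenseRange (toL2 (X := X) m) := by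
  rw [DenseRange, Metric.dense_iff]
  intro u r hr
  obtain ⟨g, hgs, hgd, hgc, hgL⟩ := (Lp.memLp u).exists_hasCompactSupport_eLpNorm_sub_le
    (by norm_num) (ε := ENNReal.ofReal (r / 2)) (by simpa using hr)
  refine ⟨toL2 m ⟨⟨g, hgc⟩, hgs⟩, ?_, ⟨_, rfl⟩⟩
  rw [Metric.mem_ball, dist_comm, dist_eq_norm]
  have h1 : u = (Lp.memLp u).toLp u := (Lp.toLp_coeFn u (Lp.memLp u)).symm
  have h2 : toL2 m ⟨⟨g, hgc⟩, hgs⟩ = hgL.toLp g := rfl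
  rw [h1, h2, ← MemLp.toLp_sub, Lp.norm_toLp]
  refine lt_of_le_of_lt (ENNReal.toReal_mono ENNReal.ofReal_ne_top hgd) ?_
  rw [ENNReal.toReal_ofReal (by positivity)]
  linarith

/-- The inverse of `untwist`. -/
def retwist (y : X) (a : C₀(X, ℂ)) : C₀(X, ℂ) :=
  translate (-τ y) (phaseMul (lam y)⁻¹ a)

lemma untwist_retwist (y : X) (a : C₀(X, ℂ)) : untwist τ lam y (retwist τ lam y a) = a := by
  ext q
  change (lam y q : ℂ) * (((lam y)⁻¹ (q + τ y + -τ y) : Circle) * a (q + τ y + -τ y)) = a q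
  have e1 : q + τ y + -τ y = q := by abel
  have e2 : (((lam y)⁻¹ q : Circle) : ℂ) = ((lam y q)⁻¹ : Circle) := rfl
  rw [e1, e2, ← mul_assoc, ← Circle.coe_mul, mul_inv_cancel, Circle.coe_one, one_mul]

lemma norm_retwist_le (y : X) (a : C₀(X, ℂ)) : ‖retwist τ lam y a‖ ≤ ‖a‖ :=
  (norm_translate_le _ _).trans (norm_phaseMul_le _ _)

lemma norm_untwist (y : X) (a : C₀(X, ℂ)) : ‖untwist τ lam y a‖ = ‖a‖ := by
  refine le_antisymm (norm_untwist_le τ lam y a) ?_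
  refine (norm_le_iff' (norm_nonneg _)).2 fun q => ?_
  have h := norm_apply_le (untwist τ lam y a) (q - τ y)
  rwa [untwist_apply, norm_mul, Circle.norm_coe, one_mul, sub_add_cancel] at h

lemma untwist_injective (y : X) : Function.Injective (untwist τ lam y) := by
  rw [injective_iff_map_eq_zero]
  intro a ha
  rw [← norm_eq_zero, ← norm_untwist τ lam y, ha, norm_zero]

lemma continuous_retwist : Continuous fun p : X × C₀(X, ℂ) => retwist τ lam p.1 p.2 := by
  have hτ : Continuous τ := map_continuous τ
  have h1 : Continuous fun p : X × C₀(X, ℂ) => (lam p.1)⁻¹ :=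
    (lam.continuous.comp continuous_fst).inv
  have h2 : Continuous fun p : X × C₀(X, ℂ) => phaseMul (lam p.1)⁻¹ p.2 :=
    continuous_phaseMul.comp (h1.prodMk continuous_snd)
  exact continuous_translate.comp ((hτ.comp continuous_fst).neg.prodMk h2)

/-- The function `y ↦ f θ_y[conj g]`, the kernel of the operator `|f⟩⟨g|`. -/
def unitKernel (f g : C_c(X, ℂ)) (y : X) : C₀(X, ℂ) :=
  toC0 f * translate y (star (toC0 g))

lemma unitKernel_apply (f g : C_c(X, ℂ)) (y q : X) :
    unitKernel f g y q = f q * starRingEnd ℂ (g (q + y)) := rfl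

lemma continuous_unitKernel (f g : C_c(X, ℂ)) : Continuous (unitKernel f g) :=
  continuous_const.mul (continuous_translate_left _)

lemma hasCompactSupport_unitKernel (f g : C_c(X, ℂ)) : HasCompactSupport (unitKernel f g) := by
  refine HasCompactSupport.intro
    ((g.hasCompactSupport.isCompact.prod f.hasCompactSupport.isCompact).image
      (f := fun p : X × X => p.1 - p.2) continuous_sub) fun y hy => ?_
  ext q
  rw [unitKernel_apply]
  by_cases hq : q ∈ tsupport f
  · have : q + y ∉ tsupport g := fun h => hy ⟨(q + y, q), ⟨h, hq⟩, by simp⟩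
    rw [image_eq_zero_of_notMem_tsupport this, map_zero, mul_zero]; rfl
  · rw [image_eq_zero_of_notMem_tsupport hq, zero_mul]; rfl

/-- The element `φ_{f,g}` of `L¹(X; C₀(X))` that the Schrödinger representation sends to the rank
one operator `|f⟩⟨g|`. -/
def unitFun (f g : C_c(X, ℂ)) (y : X) : C₀(X, ℂ) := retwist τ lam y (unitKernel f g y)

lemma untwist_unitFun (f g : C_c(X, ℂ)) (y : X) :
    untwist τ lam y (unitFun τ lam f g y) = unitKernel f g y := untwist_retwist τ lam y _

lemma retwist_zero (y : X) : retwist τ lam y 0 = 0 := by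
  rw [← norm_le_zero_iff]
  exact (norm_retwist_le τ lam y _).trans_eq norm_zero

lemma continuous_unitFun (f g : C_c(X, ℂ)) : Continuous (unitFun τ lam f g) := by
  have h : Continuous fun y : X => (y, unitKernel f g y) :=
    continuous_id.prodMk (continuous_unitKernel f g)
  have h' := (continuous_retwist τ lam).comp h
  exact h'

lemma hasCompactSupport_unitFun (f g : C_c(X, ℂ)) : HasCompactSupport (unitFun τ lam f g) := by
  refine HasCompactSupport.intro (hasCompactSupport_unitKernel f g).isCompact fun y hy => ?_
  rw [unitFun, image_eq_zero_of_notMem_tsupport hy, retwist_zero]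

lemma integrable_unitFun (f g : C_c(X, ℂ)) : Integrable (unitFun τ lam f g) m :=
  (continuous_unitFun τ lam f g).integrable_of_hasCompactSupport
    (hasCompactSupport_unitFun τ lam f g)

variable (m) in
/-- The class of `φ_{f,g}` in `L¹(X; C₀(X))`. -/
def unitL1 (f g : C_c(X, ℂ)) : X →₁[m] C₀(X, ℂ) := (integrable_unitFun τ lam f g).toL1 _

lemma twistedProduct_congr {φ φ' ψ ψ' : X → C₀(X, ℂ)} (hφ : φ =ᵐ[m] φ') (hψ : ψ =ᵐ[m] ψ') :
    twistedProduct ω τ m φ ψ = twistedProduct ω τ m φ' ψ' := by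
  funext x
  refine integral_congr_ae ?_
  have h : ∀ᵐ y ∂m, ψ (x - y) = ψ' (x - y) :=
    (Measure.measurePreserving_sub_left m x).quasiMeasurePreserving.ae hψ
  filter_upwards [hφ, h] with y h1 h2
  rw [twistedIntegrand, twistedIntegrand, h1, h2]

lemma mulL1_toL1 {φ ψ : X → C₀(X, ℂ)} (hφ : Integrable φ m) (hψ : Integrable ψ m) :
    mulL1 ω τ m (hφ.toL1 φ) (hψ.toL1 ψ) = (integrable_twistedProduct ω τ m hφ hψ).toL1 _ := by
  refine (Integrable.toL1_eq_toL1_iff _ _ _ _).2 (Eventually.of_forall fun x => ?_)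
  rw [twistedProduct_congr τ hφ.coeFn_toL1 hψ.coeFn_toL1]

variable {lam}

/-- The elements `φ_{f,g}` multiply like the operators `|f⟩⟨g|`. -/
lemma mulL1_unitL1 (hlam : IsPseudoTrivialization ω lam) (f g f' g' : C_c(X, ℂ)) :
    mulL1 ω τ m (unitL1 m τ lam f g) (unitL1 m τ lam f' g') =
      inner ℂ (toL2 m g) (toL2 m f') • unitL1 m τ lam f g' := by
  have hφ := integrable_unitFun (m := m) τ lam f g
  have hψ := integrable_unitFun (m := m) τ lam f' g'
  rw [unitL1, unitL1, mulL1_toL1, unitL1, ← Integrable.toL1_smul]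
  refine (Integrable.toL1_eq_toL1_iff _ _ _ _).2 ?_
  filter_upwards [(integrable_twistedIntegrand ω τ m hφ hψ).prod_right_ae] with x hx
  refine untwist_injective τ lam x ?_
  rw [twistedProduct, map_smul, untwist_unitFun,
    ← (untwist τ lam x).integral_comp_comm hx]
  simp only [untwist_twistedIntegrand τ hlam, untwist_unitFun]
  have hint :
      Integrable (fun y => unitKernel f g y * translate y (unitKernel f' g' (x - y))) m := by
    have := (untwist τ lam x).integrable_comp hx
    simpa only [untwist_twistedIntegrand τ hlam, untwist_unitFun] using this
  ext q
  rw [integral_apply_eq hint]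
  have e : ∀ y, (unitKernel f g y * translate y (unitKernel f' g' (x - y))) q =
      (starRingEnd ℂ (g (q + y)) * f' (q + y)) * unitKernel f g' x q := by
    intro y
    change f q * starRingEnd ℂ (g (q + y)) * (f' (q + y) * starRingEnd ℂ (g' (q + y + (x - y)))) =
      _ * (f q * starRingEnd ℂ (g' (q + x)))
    have : q + y + (x - y) = q + x := by abel
    rw [this]; ring
  simp only [e]
  rw [integral_mul_const, integral_add_left_eq_self (fun y => starRingEnd ℂ (g y) * f' y) q,
    inner_toL2]
  rfl

/-- The Schrödinger representation sends `φ_{f,g}` to the operator `|f⟩⟨g|`. -/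
lemma schrodingerOp_unitL1 (f g : C_c(X, ℂ)) :
    schrodingerOp τ lam (unitL1 m τ lam f g) =
      InnerProductSpace.rankOne ℂ (toL2 m f) (toL2 m g) := by
  ext1 u
  refine ext_inner_left ℂ fun v => ?_
  have hS := stronglyIntegrable_schrodinger τ lam (integrable_unitFun (m := m) τ lam f g)
  rw [unitL1, schrodingerOp_toL1, ← integral_inner (hS.integrable u) v,
    InnerProductSpace.rankOne_apply, inner_smul_right]
  have hv : Integrable (fun x => starRingEnd ℂ (v x) * f x) m :=
    (Lp.memLp v).star.integrable_mul (memLp_compactlySupported f)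
  have hw : Integrable (fun x => starRingEnd ℂ (g x) * u x) m :=
    (memLp_compactlySupported (m := m) g).star.integrable_mul (Lp.memLp u)
  have e : ∀ y, inner ℂ v (schrodingerKernel m τ lam y (unitFun τ lam f g y) u) =
      ∫ x, (starRingEnd ℂ (v x) * f x) * (starRingEnd ℂ (g (x + y)) * u (x + y)) ∂m := by
    intro y
    rw [schrodingerKernel_apply, untwist_unitFun, L2.inner_def]
    refine integral_congr_ae ?_
    filter_upwards [coeFn_rep (unitKernel f g y) (shift m y u), coeFn_shift y u] with x h1 h2
    rw [h1, h2, unitKernel_apply, RCLike.inner_apply]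
    ring
  simp only [e]
  have hprod : Integrable (fun p : X × X => (starRingEnd ℂ (v p.1) * f p.1) *
      (starRingEnd ℂ (g (p.1 + p.2)) * u (p.1 + p.2))) (m.prod m) :=
    (measurePreserving_prod_add m m).integrable_comp_of_integrable (hv.mul_prod hw)
  rw [integral_integral_swap (f := fun y x => (starRingEnd ℂ (v x) * f x) *
    (starRingEnd ℂ (g (x + y)) * u (x + y))) hprod.swap]
  simp only [integral_const_mul]
  simp only [integral_add_left_eq_self (fun x => starRingEnd ℂ (g x) * u x)]
  rw [integral_mul_const, L2.inner_def, L2.inner_def, mul_comm]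
  congr 1
  · refine integral_congr_ae ?_
    filter_upwards [coeFn_toL2 (m := m) g] with x hx
    rw [hx, RCLike.inner_apply, mul_comm]
  · refine integral_congr_ae ?_
    filter_upwards [coeFn_toL2 (m := m) f] with x hx
    rw [hx, RCLike.inner_apply, mul_comm]

end MatrixUnits

/-! ### Density of the span of the matrix units -/

section Density
open scoped CompactlySupported
variable {X : Type u} [AddCommGroup X] [TopologicalSpace X] [IsTopologicalAddGroup X]
  [LocallyCompactSpace X] [T2Space X] [SecondCountableTopology X]
  [MeasurableSpace X] [BorelSpace X] {m : Measure X} [m.IsAddHaarMeasure]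
  {ω : TwoCocycle X} (τ : X →ₜ+ X) (lam : C(X, C(X, Circle)))

lemma continuous_apply_uncurry : Continuous fun p : C₀(X, ℂ) × X => p.1 p.2 := by
  have h : Continuous fun p : BoundedContinuousFunction X ℂ × X => p.1 p.2 := by fun_prop
  have h' := h.comp ((ZeroAtInftyContinuousMap.isometry_toBCF (β := ℂ)).continuous.comp
    continuous_fst |>.prodMk continuous_snd)
  exact h'

/-- A continuous function of compact support with values in `C₀(X)` vanishes at infinity
uniformly. -/
lemma exists_compact_forall_norm_le {Y : Type*} [TopologicalSpace Y] {k : Y → C₀(X, ℂ)}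
    (hk : Continuous k) (hks : HasCompactSupport k) {ε : ℝ} (hε : 0 < ε) :
    ∃ C : Set X, IsCompact C ∧ ∀ y, ∀ q ∉ C, ‖k y q‖ ≤ ε := by
  obtain ⟨t, -, htf, ht⟩ := finite_cover_balls_of_compact (hks.isCompact_range hk)
    (half_pos hε)
  choose C hC hCa using fun a : C₀(X, ℂ) => exists_compact a (half_pos hε)
  refine ⟨⋃ a ∈ t, C a, htf.isCompact_biUnion fun a _ => hC a, fun y q hq => ?_⟩
  obtain ⟨a, hat, hya⟩ := Set.mem_iUnion₂.1 (ht ⟨y, rfl⟩)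
  have h1 : ‖a q‖ < ε / 2 := hCa a q fun h => hq (Set.mem_biUnion hat h)
  have h2 : ‖k y q - a q‖ ≤ ‖k y - a‖ := norm_apply_le (k y - a) q
  rw [Metric.mem_ball, dist_eq_norm] at hya
  calc ‖k y q‖ = ‖(k y q - a q) + a q‖ := by rw [sub_add_cancel]
    _ ≤ ‖k y q - a q‖ + ‖a q‖ := norm_add_le _ _
    _ ≤ ε := by linarith

/-- A continuous kernel of compact support is uniformly approximated by sums of the kernels
`f θ_y[conj g]`, with supports in a fixed compact set. The approximants are
`∑ p_i(q) k(q + y - x_i)(x_i)`, for a partition of unity `(p_i)` concentrated near the points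
`x_i`. -/
lemma exists_sum_unitKernel_near {k : X → C₀(X, ℂ)} (hk : Continuous k)
    (hks : HasCompactSupport k) :
    ∃ L : Set X, IsCompact L ∧ ∀ ε > 0, ∃ (s : Finset X) (f g : s → C_c(X, ℂ)), ∀ y,
      ‖k y - ∑ i, unitKernel (f i) (g i) y‖ ≤ L.indicator (fun _ => ε) y := by
  obtain ⟨N, hN, h0N⟩ := exists_compact_mem_nhds (0 : X)
  have hK : IsCompact (tsupport k) := hks.isCompact
  set L : Set X := tsupport k ∪ (fun p : X × X => p.1 - p.2) '' (tsupport k ×ˢ N) with hL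
  have hLc : IsCompact L := hK.union ((hK.prod hN).image continuous_sub)
  refine ⟨L, hLc, fun ε hε => ?_⟩
  obtain ⟨C, hC, hCk⟩ := exists_compact_forall_norm_le hk hks (half_pos hε)
  have hkc : Continuous fun p : X × X => k p.1 p.2 :=
    continuous_apply_uncurry.comp ((hk.comp continuous_fst).prodMk continuous_snd)
  have hU : ∀ x₀ : X, ∃ U : Set X, IsOpen U ∧ x₀ ∈ U ∧ (∀ q ∈ U, q - x₀ ∈ N) ∧
      ∀ q ∈ U, ∀ y ∈ L, ‖k y q - k (q + y - x₀) x₀‖ ≤ ε / 2 := by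
    intro x₀
    have hD : Continuous fun p : X × X => ‖k p.2 p.1 - k (p.1 + p.2 - x₀) x₀‖ :=
      ((hkc.comp (continuous_snd.prodMk continuous_fst)).sub (hkc.comp
        (((continuous_fst.add continuous_snd).sub continuous_const).prodMk
          continuous_const))).norm
    have h1 : ∀ᶠ q in 𝓝 x₀, ∀ y ∈ L, ‖k y q - k (q + y - x₀) x₀‖ < ε / 2 := by
      refine hLc.eventually_forall_of_forall_eventually
        (P := fun q y => ‖k y q - k (q + y - x₀) x₀‖ < ε / 2) fun y _ => ?_
      refine hD.continuousAt.eventually (gt_mem_nhds ?_)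
      simpa using hε
    have h2 : ∀ᶠ q in 𝓝 x₀, q - x₀ ∈ N := by
      have : Tendsto (fun q : X => q - x₀) (𝓝 x₀) (𝓝 0) := by
        simpa using (continuous_id.sub continuous_const).tendsto (f := fun q : X => q - x₀) x₀
      exact this h0N
    obtain ⟨U, hUs, hUo, hxU⟩ := mem_nhds_iff.1 (h1.and h2)
    exact ⟨U, hUo, hxU, fun q hq => (hUs hq).2, fun q hq y hy => ((hUs hq).1 y hy).le⟩
  choose U hUo hxU hUN hUD using hU
  obtain ⟨s, -, hs⟩ := hC.elim_nhds_subcover U fun x _ => (hUo x).mem_nhds (hxU x)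
  obtain ⟨p, hpU, hpc⟩ := PartitionOfUnity.exists_isSubordinate_of_locallyFinite_t2space hC
    (fun i : s => U i) (fun i => hUo i) (locallyFinite_of_finite _)
    (hs.trans fun x hx => by
      obtain ⟨i, hi, hxi⟩ := Set.mem_iUnion₂.1 hx
      exact Set.mem_iUnion.2 ⟨⟨i, hi⟩, hxi⟩)
  have hpn : ∀ (i : s) (q : X), q ∉ U i → p i q = 0 := fun i q hq =>
    image_eq_zero_of_notMem_tsupport fun h => hq (hpU i h)
  let f : s → C_c(X, ℂ) := fun i =>
    ⟨⟨fun q => (p i q : ℂ), Complex.continuous_ofReal.comp (p i).continuous⟩,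
      (hpc i).comp_left Complex.ofReal_zero⟩
  have hgc : ∀ i : s, Continuous fun z : X => starRingEnd ℂ (k (z - i) (i : X)) := fun i =>
    Complex.continuous_conj.comp
      (hkc.comp ((continuous_id.sub continuous_const).prodMk continuous_const))
  have hgs : ∀ i : s, HasCompactSupport fun z : X => starRingEnd ℂ (k (z - i) (i : X)) := by
    intro i
    refine HasCompactSupport.intro
      (hK.image (f := fun x : X => x + i) (continuous_id.add continuous_const)) fun z hz => ?_
    have : k (z - i) = 0 := image_eq_zero_of_notMem_tsupport fun h => hz ⟨_, h, by simp⟩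
    rw [this]; exact map_zero _
  let g : s → C_c(X, ℂ) := fun i => ⟨⟨_, hgc i⟩, hgs i⟩
  have hfg : ∀ i y q, unitKernel (f i) (g i) y q = (p i q : ℂ) * k (q + y - i) (i : X) := by
    intro i y q
    rw [unitKernel_apply]
    change (p i q : ℂ) * starRingEnd ℂ (starRingEnd ℂ _) = _
    rw [Complex.conj_conj]
  have hsum : ∀ y q, (k y - ∑ i, unitKernel (f i) (g i) y) q =
      (1 - ((∑ i, p i q : ℝ) : ℂ)) * k y q +
        ∑ i, (p i q : ℂ) * (k y q - k (q + y - i) (i : X)) := by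
    intro y q
    have e1 : (∑ i, unitKernel (f i) (g i) y) q = ∑ i, unitKernel (f i) (g i) y q :=
      map_sum (evalC q) _ _
    change k y q - (∑ i, unitKernel (f i) (g i) y) q = _
    rw [e1]
    simp only [hfg, mul_sub, Finset.sum_sub_distrib, Complex.ofReal_sum, ← Finset.sum_mul]
    ring
  have hp1 : ∀ q, ∑ i, p i q ≤ 1 := fun q => by
    rw [← finsum_eq_sum_of_fintype]; exact p.sum_le_one q
  have hp0 : ∀ q, 0 ≤ ∑ i, p i q := fun q => Finset.sum_nonneg fun i _ => p.nonneg i q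
  refine ⟨s, f, g, fun y => ?_⟩
  by_cases hy : y ∈ L
  · rw [Set.indicator_of_mem hy]
    refine (norm_le_iff' hε.le).2 fun q => ?_
    rw [hsum]
    have b1 : ‖(1 - ((∑ i, p i q : ℝ) : ℂ)) * k y q‖ ≤ ε / 2 := by
      by_cases hq : q ∈ C
      · have : ∑ i, p i q = 1 := by rw [← finsum_eq_sum_of_fintype]; exact p.sum_eq_one hq
        rw [this, Complex.ofReal_one, sub_self, zero_mul, norm_zero]
        positivity
      · rw [norm_mul, ← Complex.ofReal_one, ← Complex.ofReal_sub, Complex.norm_real,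
          Real.norm_of_nonneg (sub_nonneg.2 (hp1 q))]
        have := hCk y q hq
        have h0 := norm_nonneg (k y q)
        nlinarith [hp0 q, hp1 q]
    have b2 : ‖∑ i, (p i q : ℂ) * (k y q - k (q + y - i) (i : X))‖ ≤ ε / 2 := by
      calc ‖∑ i, (p i q : ℂ) * (k y q - k (q + y - i) (i : X))‖
          ≤ ∑ i, p i q * (ε / 2) := by
            refine norm_sum_le_of_le _ fun i _ => ?_
            rw [norm_mul, Complex.norm_real, Real.norm_of_nonneg (p.nonneg i q)]
            by_cases hq : q ∈ U i
            · exact mul_le_mul_of_nonneg_left (hUD i q hq y hy) (p.nonneg i q)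
            · rw [hpn i q hq, zero_mul, zero_mul]
        _ = (∑ i, p i q) * (ε / 2) := (Finset.sum_mul _ _ _).symm
        _ ≤ ε / 2 := by nlinarith [hp1 q]
    calc _ ≤ _ := norm_add_le _ _
      _ ≤ ε := by linarith
  · rw [Set.indicator_of_notMem hy]
    refine (norm_le_iff' le_rfl).2 fun q => ?_
    have hky : k y q = 0 := by
      rw [image_eq_zero_of_notMem_tsupport fun h => hy (Or.inl h)]; rfl
    rw [hsum, hky, mul_zero, zero_add, norm_le_zero_iff]
    refine Finset.sum_eq_zero fun i _ => ?_
    by_cases hq : q ∈ U i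
    · have : k (q + y - i) = 0 := image_eq_zero_of_notMem_tsupport fun h =>
        hy (Or.inr ⟨(q + y - i, q - i), ⟨h, hUN i q hq⟩, by
          change q + y - i - (q - i) = y
          abel⟩)
      rw [this]
      change _ * (0 - (0 : ℂ)) = 0
      rw [sub_zero, mul_zero]
    · rw [hpn i q hq, Complex.ofReal_zero, zero_mul]

lemma integrable_untwist {φ : X → C₀(X, ℂ)} (hφ : Integrable φ m) :
    Integrable (fun y => untwist τ lam y (φ y)) m := by
  have h3 : AEStronglyMeasurable (fun y : X => (y, φ y)) m :=
    continuous_id.aestronglyMeasurable.prodMk hφ.1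
  exact hφ.mono (aestronglyMeasurable_comp (fun y : X => (y, φ y)) _ (continuous_untwist τ lam) h3)
    (Eventually.of_forall fun y => norm_untwist_le τ lam y (φ y))

variable (m) in
/-- The span of the matrix units `φ_{f,g}` in `L¹(X; C₀(X))`. -/
def unitSpan : Submodule ℂ (X →₁[m] C₀(X, ℂ)) :=
  Submodule.span ℂ (Set.range fun p : C_c(X, ℂ) × C_c(X, ℂ) => unitL1 m τ lam p.1 p.2)

/-- After untwisting, an integrable function is approximated by a continuous kernel of compact
support, which in turn is uniformly approximated by sums of the kernels of `|f⟩⟨g|`, on a fixed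
compact set. -/
lemma dense_unitSpan : Dense (unitSpan m τ lam : Set (X →₁[m] C₀(X, ℂ))) := by
  have := polishSpace X
  rw [Metric.dense_iff]
  intro φ r hr
  have hφ := L1.integrable_coeFn φ
  have hψ := integrable_untwist τ lam hφ
  obtain ⟨k, hks, hkd, hk, hki⟩ := hψ.exists_hasCompactSupport_integral_sub_le
    (ε := r / 4) (by positivity)
  obtain ⟨L, hL, hLε⟩ := exists_sum_unitKernel_near hk hks
  have hLm : MeasurableSet L := hL.isClosed.measurableSet
  have hLfin : m L ≠ ∞ := hL.measure_lt_top.ne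
  set ε : ℝ := r / 4 / (m.real L + 1) with hεd
  have hM : 0 ≤ m.real L := measureReal_nonneg
  have hε : 0 < ε := by positivity
  obtain ⟨s, f, g, hfg⟩ := hLε ε hε
  refine ⟨∑ i, unitL1 m τ lam (f i) (g i), ?_,
    Submodule.sum_mem _ fun i _ => Submodule.subset_span ⟨(f i, g i), rfl⟩⟩
  rw [Metric.mem_ball, dist_comm, dist_eq_norm, L1.norm_eq_integral_norm]
  have hae : ∀ᵐ y ∂m, ‖(φ - ∑ i, unitL1 m τ lam (f i) (g i)) y‖ =
      ‖untwist τ lam y (φ y) - ∑ i, unitKernel (f i) (g i) y‖ := by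
    have hall : ∀ᵐ y ∂m, ∀ i, unitL1 m τ lam (f i) (g i) y = unitFun τ lam (f i) (g i) y :=
      ae_all_iff.2 fun i => (integrable_unitFun τ lam (f i) (g i)).coeFn_toL1
    filter_upwards [Lp.coeFn_sub φ (∑ i, unitL1 m τ lam (f i) (g i)),
      Lp.coeFn_finsetSum Finset.univ (fun i => unitL1 m τ lam (f i) (g i)), hall] with y h1 h2 h3
    rw [h1, Pi.sub_apply, h2, ← norm_untwist τ lam y, map_sub, Finset.sum_apply, map_sum]
    congr 2
    refine Finset.sum_congr rfl fun i _ => ?_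
    rw [h3, untwist_unitFun]
  rw [integral_congr_ae hae]
  have hb : Integrable (L.indicator fun _ : X => ε) m :=
    (integrable_indicator_iff hLm).2 (integrableOn_const hLfin)
  have hd : Integrable (fun y => ‖untwist τ lam y (φ y) - k y‖) m := (hψ.sub hki).norm
  calc ∫ y, ‖untwist τ lam y (φ y) - ∑ i, unitKernel (f i) (g i) y‖ ∂m
      ≤ ∫ y, (‖untwist τ lam y (φ y) - k y‖ + L.indicator (fun _ => ε) y) ∂m := by
        refine integral_mono_of_nonneg (Eventually.of_forall fun _ => norm_nonneg _)
          (hd.add hb) (Eventually.of_forall fun y => ?_)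
        calc _ = ‖(untwist τ lam y (φ y) - k y) +
              (k y - ∑ i, unitKernel (f i) (g i) y)‖ := by rw [sub_add_sub_cancel]
          _ ≤ _ := (norm_add_le _ _).trans (add_le_add_right (hfg y) _)
    _ ≤ r / 4 + m.real L * ε := by
        rw [integral_add hd hb, integral_indicator hLm, setIntegral_const, smul_eq_mul]
        gcongr
    _ < r := by
        have : m.real L * ε ≤ r / 4 := by
          rw [hεd, mul_div_assoc', div_le_iff₀ (by positivity)]
          nlinarith
        linarith

end Density

/-! ### Multipliers of a `C*`-algebra represented as an ideal of `B(H)` -/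

section Multipliers
open InnerProductSpace
open scoped MultiplierAlgebra
variable {A H : Type*} [NonUnitalCStarAlgebra A] [NormedAddCommGroup H] [InnerProductSpace ℂ H]
  [CompleteSpace H]

/-- A faithful representation of `A` on `H` whose image is an ideal of `B(H)` containing the
operators of rank one. (Only the left ideal property is recorded: the image is closed under
adjoints.) -/
structure IsIdealRep (Φ : A →⋆ₙₐ[ℂ] (H →L[ℂ] H)) : Prop where
  injective : Function.Injective Φ
  exists_mul : ∀ (T : H →L[ℂ] H) (a : A), ∃ b, Φ b = T * Φ a
  exists_rankOne : ∀ u v : H, ∃ a, Φ a = rankOne ℂ u v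

lemma mul_rankOne (T : H →L[ℂ] H) (u v : H) : T * rankOne ℂ u v = rankOne ℂ (T u) v :=
  comp_rankOne u v T

namespace IsIdealRep
variable {Φ : A →⋆ₙₐ[ℂ] (H →L[ℂ] H)}

lemma norm_map (h : IsIdealRep Φ) (a : A) : ‖Φ a‖ = ‖a‖ :=
  NonUnitalStarAlgHom.norm_map Φ h.injective a

lemma exists_mul_right (h : IsIdealRep Φ) (T : H →L[ℂ] H) (a : A) : ∃ b, Φ b = Φ a * T := by
  obtain ⟨b, hb⟩ := h.exists_mul (star T) (star a)
  refine ⟨star b, ?_⟩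
  rw [map_star, hb, star_mul, map_star, star_star, star_star]

/-- An operator is determined by its products with the elements of the ideal. -/
lemma eq_of_mul_eq [Nontrivial H] (h : IsIdealRep Φ) {S T : H →L[ℂ] H}
    (hST : ∀ a, S * Φ a = T * Φ a) : S = T := by
  obtain ⟨e, he⟩ := exists_norm_eq H zero_le_one
  ext1 u
  obtain ⟨a, ha⟩ := h.exists_rankOne u e
  have h1 := DFunLike.congr_fun (hST a) e
  rw [ha, mul_rankOne, mul_rankOne, rankOne_apply, rankOne_apply, inner_self_eq_norm_sq_to_K, he]
    at h1
  simpa using h1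

/-- Left multiplication by `T ∈ B(H)` on the ideal. -/
def left (h : IsIdealRep Φ) (T : H →L[ℂ] H) : A →L[ℂ] A :=
  LinearMap.mkContinuous
    { toFun := fun a => (h.exists_mul T a).choose
      map_add' := fun a b => h.injective ((h.exists_mul T _).choose_spec.trans (by
        rw [map_add, map_add, mul_add, (h.exists_mul T _).choose_spec,
          (h.exists_mul T _).choose_spec]))
      map_smul' := fun c a => h.injective ((h.exists_mul T _).choose_spec.trans (by
        rw [RingHom.id_apply, map_smul, map_smul, (h.exists_mul T _).choose_spec,
          mul_smul_comm])) }
    ‖T‖ fun a => by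
      rw [← h.norm_map, ← h.norm_map]
      exact (congr_arg _ (h.exists_mul T a).choose_spec).trans_le (norm_mul_le _ _)

lemma map_left (h : IsIdealRep Φ) (T : H →L[ℂ] H) (a : A) : Φ (h.left T a) = T * Φ a :=
  (h.exists_mul T a).choose_spec

/-- Right multiplication by `T ∈ B(H)` on the ideal. -/
def right (h : IsIdealRep Φ) (T : H →L[ℂ] H) : A →L[ℂ] A :=
  LinearMap.mkContinuous
    { toFun := fun a => (h.exists_mul_right T a).choose
      map_add' := fun a b => h.injective ((h.exists_mul_right T _).choose_spec.trans (by
        rw [map_add, map_add, add_mul, (h.exists_mul_right T _).choose_spec,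
          (h.exists_mul_right T _).choose_spec]))
      map_smul' := fun c a => h.injective ((h.exists_mul_right T _).choose_spec.trans (by
        rw [RingHom.id_apply, map_smul, map_smul, (h.exists_mul_right T _).choose_spec,
          smul_mul_assoc])) }
    ‖T‖ fun a => by
      rw [← h.norm_map, ← h.norm_map, mul_comm]
      exact (congr_arg _ (h.exists_mul_right T a).choose_spec).trans_le (norm_mul_le _ _)

lemma map_right (h : IsIdealRep Φ) (T : H →L[ℂ] H) (a : A) : Φ (h.right T a) = Φ a * T :=
  (h.exists_mul_right T a).choose_spec

/-- A multiplier is determined by the operators representing its left and right actions. -/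
lemma multiplier_ext (h : IsIdealRep Φ) {M N : 𝓜(ℂ, A)} (h1 : ∀ a, Φ (M.fst a) = Φ (N.fst a))
    (h2 : ∀ a, Φ (M.snd a) = Φ (N.snd a)) : M = N := by
  refine DoubleCentralizer.ext _ _ _ _ (Prod.ext ?_ ?_)
  · ext1 a
    exact h.injective (h1 a)
  · ext1 a
    exact h.injective (h2 a)

/-- The multiplier of the ideal defined by an operator. -/
def multiplier (h : IsIdealRep Φ) : (H →L[ℂ] H) →⋆ₐ[ℂ] 𝓜(ℂ, A) where
  toFun T := ⟨(h.left T, h.right T), fun x y => h.injective (by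
    rw [map_mul, map_mul, h.map_left, h.map_right, mul_assoc])⟩
  map_one' := h.multiplier_ext (fun a => (h.map_left 1 a).trans (one_mul _))
    (fun a => (h.map_right 1 a).trans (mul_one _))
  map_mul' S T := h.multiplier_ext
    (fun a => by
      change Φ (h.left (S * T) a) = Φ (h.left S (h.left T a))
      rw [h.map_left, h.map_left, h.map_left, mul_assoc])
    (fun a => by
      change Φ (h.right (S * T) a) = Φ (h.right T (h.right S a))
      rw [h.map_right, h.map_right, h.map_right, mul_assoc])
  map_zero' := h.multiplier_ext
    (fun a => by
      change Φ (h.left 0 a) = Φ 0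
      rw [h.map_left, zero_mul, map_zero])
    (fun a => by
      change Φ (h.right 0 a) = Φ 0
      rw [h.map_right, mul_zero, map_zero])
  map_add' S T := h.multiplier_ext
    (fun a => by
      change Φ (h.left (S + T) a) = Φ (h.left S a + h.left T a)
      rw [map_add, h.map_left, h.map_left, h.map_left, add_mul])
    (fun a => by
      change Φ (h.right (S + T) a) = Φ (h.right S a + h.right T a)
      rw [map_add, h.map_right, h.map_right, h.map_right, mul_add])
  commutes' c := h.multiplier_ext
    (fun a => by
      rw [DoubleCentralizer.algebraMap_fst]
      change Φ (h.left (algebraMap ℂ _ c) a) = Φ (c • a)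
      rw [h.map_left, Algebra.algebraMap_eq_smul_one, smul_mul_assoc, one_mul, map_smul])
    (fun a => by
      rw [DoubleCentralizer.algebraMap_snd]
      change Φ (h.right (algebraMap ℂ _ c) a) = Φ (c • a)
      rw [h.map_right, Algebra.algebraMap_eq_smul_one, mul_smul_comm, mul_one, map_smul])
  map_star' T := h.multiplier_ext
    (fun a => by
      rw [DoubleCentralizer.star_fst]
      change Φ (h.left (star T) a) = Φ (star (h.right T (star a)))
      rw [h.map_left, map_star, h.map_right, map_star, star_mul, star_star])
    (fun a => by
      rw [DoubleCentralizer.star_snd]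
      change Φ (h.right (star T) a) = Φ (star (h.left T (star a)))
      rw [h.map_right, map_star, h.map_left, map_star, star_mul, star_star])

lemma multiplier_fst (h : IsIdealRep Φ) (T : H →L[ℂ] H) (a : A) :
    Φ ((h.multiplier T).fst a) = T * Φ a := h.map_left T a

lemma multiplier_snd (h : IsIdealRep Φ) (T : H →L[ℂ] H) (a : A) :
    Φ ((h.multiplier T).snd a) = Φ a * T := h.map_right T a

lemma multiplier_map (h : IsIdealRep Φ) (a : A) :
    h.multiplier (Φ a) = DoubleCentralizer.coe ℂ a :=
  h.multiplier_ext (fun b => by rw [h.multiplier_fst, DoubleCentralizer.coe_fst,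
      ContinuousLinearMap.mul_apply', map_mul])
    (fun b => by rw [h.multiplier_snd, DoubleCentralizer.coe_snd,
      ContinuousLinearMap.flip_apply, ContinuousLinearMap.mul_apply', map_mul])

lemma map_central (M : 𝓜(ℂ, A)) (a b : A) : Φ (M.snd a) * Φ b = Φ a * Φ (M.fst b) := by
  rw [← map_mul, ← map_mul, M.central]

/-- A multiplier commutes with right multiplications. -/
lemma fst_mul [Nontrivial H] (h : IsIdealRep Φ) (M : 𝓜(ℂ, A)) (a b : A) :
    Φ (M.fst (a * b)) = Φ (M.fst a) * Φ b := by
  -- the identity holds after multiplication by the ideal on the left; take adjoints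
  have key : ∀ c, Φ c * Φ (M.fst (a * b)) = Φ c * (Φ (M.fst a) * Φ b) := fun c => by
    rw [← map_central, map_mul, ← mul_assoc, map_central, mul_assoc]
  have := h.eq_of_mul_eq (S := star (Φ (M.fst (a * b)))) (T := star (Φ (M.fst a) * Φ b))
    fun c => by
      have := congr_arg star (key (star c))
      rwa [star_mul, star_mul, map_star, star_star] at this
  exact star_injective this

/-- The left action of a multiplier is the left multiplication by an operator. -/
lemma exists_fst_eq [Nontrivial H] (h : IsIdealRep Φ) (M : 𝓜(ℂ, A)) :
    ∃ T : H →L[ℂ] H, ∀ a, Φ (M.fst a) = T * Φ a := by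
  -- for a unit vector `e`, the operator is `T u = Φ (M |u⟩⟨e|) e`
  obtain ⟨e, he⟩ := exists_norm_eq H zero_le_one
  choose x hx using fun u : H => h.exists_rankOne u e
  have hxn : ∀ u, ‖x u‖ = ‖u‖ := fun u => by
    rw [← h.norm_map, hx, norm_rankOne, he, mul_one]
  have hadd : ∀ u v, x (u + v) = x u + x v := fun u v => h.injective (by
    rw [map_add, hx, hx, hx, map_add, add_apply])
  have hsmul : ∀ (c : ℂ) u, x (c • u) = c • x u := fun c u => h.injective (by
    rw [map_smul, hx, hx, map_smul, smul_apply])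
  have hee : rankOne ℂ e e e = e := by
    rw [rankOne_apply, inner_self_eq_norm_sq_to_K, he]; simp
  let T : H →L[ℂ] H := LinearMap.mkContinuous
    { toFun := fun u => Φ (M.fst (x u)) e
      map_add' := fun u v => by rw [hadd, map_add, map_add, add_apply]
      map_smul' := fun c u => by
        rw [hsmul, map_smul, map_smul, smul_apply, RingHom.id_apply] }
    ‖M.fst‖ fun u => by
      refine ((Φ (M.fst (x u))).le_opNorm e).trans ?_
      rw [he, mul_one, h.norm_map, ← hxn u]
      exact M.fst.le_opNorm _
  refine ⟨T, fun a => ?_⟩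
  ext1 v
  change _ = Φ (M.fst (x (Φ a v))) e
  have h1 : x (Φ a v) = a * x v := h.injective (by
    rw [map_mul, hx, hx, mul_rankOne])
  have h2 : rankOne ℂ v e e = v := by
    rw [rankOne_apply, inner_self_eq_norm_sq_to_K, he]; simp
  rw [h1, h.fst_mul, hx, mul_apply_eq_comp, h2]

lemma multiplier_bijective [Nontrivial H] (h : IsIdealRep Φ) :
    Function.Bijective h.multiplier := by
  constructor
  · intro S T hST
    exact h.eq_of_mul_eq fun a => by rw [← h.multiplier_fst, hST, h.multiplier_fst]
  · intro M
    obtain ⟨T, hT⟩ := h.exists_fst_eq M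
    refine ⟨T, h.multiplier_ext (fun a => by rw [h.multiplier_fst, hT]) fun a => ?_⟩
    rw [h.multiplier_snd]
    exact h.eq_of_mul_eq fun b => by rw [map_central, hT, mul_assoc]

/-- The isomorphism of the multiplier algebra of the ideal onto `B(H)`. -/
def extension [Nontrivial H] (h : IsIdealRep Φ) : 𝓜(ℂ, A) ≃⋆ₐ[ℂ] (H →L[ℂ] H) :=
  (StarAlgEquiv.ofBijective h.multiplier h.multiplier_bijective).symm

lemma extension_multiplier [Nontrivial H] (h : IsIdealRep Φ) (T : H →L[ℂ] H) :
    h.extension (h.multiplier T) = T :=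
  (StarAlgEquiv.ofBijective h.multiplier h.multiplier_bijective).symm_apply_apply T

lemma extension_coe [Nontrivial H] (h : IsIdealRep Φ) (a : A) :
    h.extension (DoubleCentralizer.coe ℂ a) = Φ a := by
  rw [← h.multiplier_map, h.extension_multiplier]

/-- The extension of `Φ` to the multipliers is unique. -/
lemma hom_ext [Nontrivial H] (h : IsIdealRep Φ) {F G : 𝓜(ℂ, A) →⋆ₐ[ℂ] (H →L[ℂ] H)}
    (hF : ∀ a : A, F (DoubleCentralizer.coe ℂ a) = Φ a)
    (hG : ∀ a : A, G (DoubleCentralizer.coe ℂ a) = Φ a) : F = G := by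
  have hM : ∀ (M : 𝓜(ℂ, A)) (a : A), M * DoubleCentralizer.coe ℂ a =
      DoubleCentralizer.coe ℂ (M.fst a) := fun M a => h.multiplier_ext
    (fun b => by
      rw [DoubleCentralizer.mul_fst, DoubleCentralizer.coe_fst, DoubleCentralizer.coe_fst,
        mul_apply_eq_comp, ContinuousLinearMap.mul_apply', ContinuousLinearMap.mul_apply',
        h.fst_mul, map_mul])
    (fun b => by
      rw [DoubleCentralizer.mul_snd, DoubleCentralizer.coe_snd, DoubleCentralizer.coe_snd,
        mul_apply_eq_comp, ContinuousLinearMap.flip_apply, ContinuousLinearMap.flip_apply,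
        ContinuousLinearMap.mul_apply', ContinuousLinearMap.mul_apply', map_mul, map_mul,
        map_central])
  refine StarAlgHom.ext fun M => h.eq_of_mul_eq fun a => ?_
  rw [← hF, ← map_mul, hM, hF, hF, ← hG a, ← map_mul, hM, hG]

end IsIdealRep
end Multipliers

/-! ### Representations generated by matrix units -/

section MatrixUnits
open InnerProductSpace
variable {A H : Type*} [NonUnitalCStarAlgebra A] [NormedAddCommGroup H] [InnerProductSpace ℂ H]
  [CompleteSpace H]

lemma continuous_rankOne : Continuous fun p : H × H => rankOne ℂ p.1 p.2 := by
  have h := (ContinuousLinearMap.smulRightL ℂ H H).continuous₂.comp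
    (((innerSL ℂ).continuous.comp continuous_snd).prodMk continuous_fst)
  exact h

lemma continuous_starHom (Φ : A →⋆ₙₐ[ℂ] (H →L[ℂ] H)) : Continuous Φ :=
  AddMonoidHomClass.continuous_of_bound _ 1 fun a =>
    (NonUnitalStarAlgHom.norm_apply_le _ a).trans_eq (one_mul _).symm

/-- Operators `e i j` of a `C*`-algebra that multiply like the rank one operators
`|v i⟩⟨v j|`, that span a dense subspace, and that `Φ` sends to these operators. -/
structure IsMatrixUnits {I : Type*} (v : I → H) (e : I → I → A) (Φ : A →⋆ₙₐ[ℂ] (H →L[ℂ] H)) :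
    Prop where
  mul : ∀ i j k l, e i j * e k l = inner ℂ (v j) (v k) • e i l
  map : ∀ i j, Φ (e i j) = rankOne ℂ (v i) (v j)
  dense : Dense (Submodule.span ℂ (Set.range fun p : I × I => e p.1 p.2) : Set A)
  denseRange : DenseRange v

namespace IsMatrixUnits
variable {I : Type*} {v : I → H} {e : I → I → A} {Φ : A →⋆ₙₐ[ℂ] (H →L[ℂ] H)}

lemma induction (h : IsMatrixUnits v e Φ) {p : A → Prop} (closed : IsClosed {a | p a})
    (zero : p 0) (add : ∀ a b, p a → p b → p (a + b)) (smul : ∀ (c : ℂ) a, p a → p (c • a))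
    (unit : ∀ i j, p (e i j)) (a : A) : p a := by
  refine closed.closure_subset_iff.2 ?_ (h.dense a)
  intro b hb
  refine Submodule.span_induction (p := fun b _ => p b) ?_ zero (fun b c _ _ => add b c)
    (fun c b _ => smul c b) hb
  rintro _ ⟨⟨i, j⟩, rfl⟩
  exact unit i j

/-- Compressing an element by matrix units gives its matrix elements in the representation. -/
lemma mul_mul (h : IsMatrixUnits v e Φ) (i j k l : I) (a : A) :
    e i j * a * e k l = inner ℂ (v j) (Φ a (v k)) • e i l := by
  have hΦ := continuous_starHom Φ
  have hev : Continuous fun a => inner ℂ (v j) (Φ a (v k)) :=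
    continuous_const.inner (hΦ.clm_apply continuous_const)
  refine h.induction (p := fun a => e i j * a * e k l = inner ℂ (v j) (Φ a (v k)) • e i l)
    (isClosed_eq (by fun_prop) (by fun_prop)) ?_ ?_ ?_ ?_ a
  · rw [map_zero, mul_zero, zero_mul, zero_apply, inner_zero_right, zero_smul]
  · intro a b ha hb
    rw [mul_add, add_mul, ha, hb, map_add, add_apply, inner_add_right, add_smul]
  · intro c a ha
    rw [mul_smul_comm, smul_mul_assoc, ha, map_smul, smul_apply, inner_smul_right, smul_smul]
  · intro i' j'
    rw [h.mul, smul_mul_assoc, h.mul, h.map, rankOne_apply, inner_smul_right, smul_smul, mul_comm]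

/-- The representation is faithful: an element that it annihilates is annihilated by all the
compressions `e a e'` with matrix units, hence `a^* a a^* = 0`. -/
lemma injective (h : IsMatrixUnits v e Φ) : Function.Injective Φ := by
  rw [injective_iff_map_eq_zero]
  intro a ha
  have h1 : ∀ i j b, e i j * a * b = 0 := by
    intro i j b
    refine h.induction (p := fun b => e i j * a * b = 0)
      (isClosed_eq (by fun_prop) continuous_const) (mul_zero _) ?_ ?_ ?_ b
    · intro b c hb hc
      rw [mul_add, hb, hc, add_zero]
    · intro c b hb
      rw [mul_smul_comm, hb, smul_zero]
    · intro k l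
      rw [h.mul_mul, ha, zero_apply, inner_zero_right, zero_smul]
  have h2 : ∀ c b : A, c * a * b = 0 := by
    intro c b
    refine h.induction (p := fun c => c * a * b = 0)
      (isClosed_eq (by fun_prop) continuous_const) ?_ ?_ ?_ (fun i j => h1 i j b) c
    · rw [zero_mul, zero_mul]
    · intro c d hc hd
      rw [add_mul, add_mul, hc, hd, add_zero]
    · intro z c hc
      rw [smul_mul_assoc, smul_mul_assoc, hc, smul_zero]
  have h3 : star (star a * a) * (star a * a) = 0 := by
    rw [star_mul, star_star, ← mul_assoc, h2, zero_mul]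
  rwa [CStarRing.star_mul_self_eq_zero_iff, CStarRing.star_mul_self_eq_zero_iff] at h3

lemma isClosed_range (h : IsMatrixUnits v e Φ) : IsClosed (Set.range Φ) :=
  (NonUnitalStarAlgHom.isometry _ h.injective).isClosedEmbedding.isClosed_range

lemma rankOne_mem_range (h : IsMatrixUnits v e Φ) (x y : H) : rankOne ℂ x y ∈ Set.range Φ := by
  have hcl : IsClosed ((fun p : H × H => rankOne ℂ p.1 p.2) ⁻¹' Set.range Φ) :=
    h.isClosed_range.preimage continuous_rankOne
  have hsub : Set.range (Prod.map v v) ⊆ (fun p : H × H => rankOne ℂ p.1 p.2) ⁻¹' Set.range Φ := by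
    rintro _ ⟨p, rfl⟩
    exact ⟨_, h.map p.1 p.2⟩
  exact hcl.closure_subset_iff.2 hsub ((h.denseRange.prodMap h.denseRange) (x, y))

/-- A representation generated by matrix units maps onto an ideal of `B(H)` (which consists of the
compact operators) containing the operators of rank one. -/
lemma isIdealRep (h : IsMatrixUnits v e Φ) : IsIdealRep Φ where
  injective := h.injective
  exists_rankOne := h.rankOne_mem_range
  exists_mul T a := by
    have hΦ := continuous_starHom Φ
    refine h.induction (p := fun a => T * Φ a ∈ Set.range Φ)
      (h.isClosed_range.preimage (continuous_const.mul hΦ)) ?_ ?_ ?_ ?_ a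
    · exact ⟨0, by rw [map_zero, mul_zero]⟩
    · rintro a b ⟨a', ha⟩ ⟨b', hb⟩
      exact ⟨a' + b', by rw [map_add, map_add, mul_add, ha, hb]⟩
    · rintro c a ⟨a', ha⟩
      exact ⟨c • a', by rw [map_smul, map_smul, mul_smul_comm, ha]⟩
    · intro i j
      rw [h.map, mul_rankOne]
      exact h.rankOne_mem_range _ _

end IsMatrixUnits
end MatrixUnits

/-! ### The Schrödinger representation of the symbol algebra -/

section SchrodingerHom
open InnerProductSpace
open scoped CompactlySupported
variable {X : Type u} [AddCommGroup X] [TopologicalSpace X] [IsTopologicalAddGroup X]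
  [LocallyCompactSpace X] [T2Space X] [SecondCountableTopology X]
  [MeasurableSpace X] [BorelSpace X] {m : Measure X} [m.IsAddHaarMeasure]
  {ω : TwoCocycle X} {τ : X →ₜ+ X} {lam : C(X, C(X, Circle))}

/-- The representation of the symbol algebra that extends a representation of the space of
symbols: the evaluation of the universal representation at one coordinate. -/
def SymbolRep.hom (π : SymbolRep ω τ m) : symbolAlgebra ω τ m →⋆ₙₐ[ℂ] (π.H →L[ℂ] π.H) where
  toFun a := (a : UniversalTarget ω τ m).1 π
  map_smul' _ _ := rfl
  map_zero' := rfl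
  map_add' _ _ := rfl
  map_mul' _ _ := rfl
  map_star' _ := rfl

lemma norm_toSymbolAlgebra_le (φ : X →₁[m] C₀(X, ℂ)) :
    ‖toSymbolAlgebra ω τ m (symbol m φ)‖ ≤ ‖φ‖ :=
  lp.norm_le_of_forall_le (f := universalRep ω τ m (symbol m φ)) (norm_nonneg φ)
    fun π => π.norm_le φ

variable (m ω τ) in
/-- The canonical map from `L¹(X; C₀(X))` to the symbol algebra. -/
def ofL1 : (X →₁[m] C₀(X, ℂ)) →L[ℂ] symbolAlgebra ω τ m :=
  LinearMap.mkContinuous (toSymbolAlgebra ω τ m ∘ₗ symbol m) 1 fun φ =>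
    (norm_toSymbolAlgebra_le φ).trans_eq (one_mul _).symm

lemma denseRange_ofL1 : DenseRange (ofL1 m ω τ) := by
  refine Subtype.dense_iff.2 fun a ha => ?_
  refine closure_mono ?_ ha
  rintro _ ⟨f, rfl⟩
  obtain ⟨φ, rfl⟩ := symbol_surjective m f
  exact ⟨_, ⟨φ, rfl⟩, rfl⟩

lemma ofL1_mul (φ ψ : X →₁[m] C₀(X, ℂ)) :
    ofL1 m ω τ (mulL1 ω τ m φ ψ) = ofL1 m ω τ φ * ofL1 m ω τ ψ :=
  Subtype.ext (lp.ext (funext fun π => π.map_mul φ ψ))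

variable (m ω τ lam) in
/-- The matrix unit `e_{f,g}` of the symbol algebra. -/
def matrixUnit (f g : C_c(X, ℂ)) : symbolAlgebra ω τ m := ofL1 m ω τ (unitL1 m τ lam f g)

variable (m τ) in
/-- The Schrödinger representation of the symbol algebra. -/
def schrodingerHom (hlam : IsPseudoTrivialization ω lam) :
    symbolAlgebra ω τ m →⋆ₙₐ[ℂ] (Lp ℂ 2 m →L[ℂ] Lp ℂ 2 m) :=
  (schrodingerRep (m := m) τ hlam).hom

lemma schrodingerHom_ofL1 (hlam : IsPseudoTrivialization ω lam) (φ : X →₁[m] C₀(X, ℂ)) :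
    schrodingerHom m τ hlam (ofL1 m ω τ φ) = schrodingerOp τ lam φ :=
  congr_arg (schrodingerOp τ lam) (symbolEquiv_symm_symbol φ)

lemma dense_span_matrixUnit :
    Dense (Submodule.span ℂ (Set.range fun p : C_c(X, ℂ) × C_c(X, ℂ) =>
      matrixUnit m ω τ lam p.1 p.2) : Set (symbolAlgebra ω τ m)) := by
  have hd := denseRange_ofL1.dense_image (ofL1 m ω τ).continuous (dense_unitSpan (m := m) τ lam)
  refine hd.mono ?_
  rintro _ ⟨φ, hφ, rfl⟩
  refine Submodule.span_induction (p := fun φ _ => ofL1 m ω τ φ ∈ Submodule.span ℂ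
    (Set.range fun p : C_c(X, ℂ) × C_c(X, ℂ) => matrixUnit m ω τ lam p.1 p.2)) ?_ ?_ ?_ ?_ hφ
  · rintro _ ⟨p, rfl⟩
    exact Submodule.subset_span ⟨p, rfl⟩
  · rw [map_zero]
    exact Submodule.zero_mem _
  · intro φ ψ _ _ h1 h2
    rw [map_add]
    exact Submodule.add_mem _ h1 h2
  · intro c φ _ h
    rw [map_smul]
    exact Submodule.smul_mem _ c h

lemma isMatrixUnits (hlam : IsPseudoTrivialization ω lam) :
    IsMatrixUnits (toL2 m) (matrixUnit m ω τ lam) (schrodingerHom m τ hlam) where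
  mul f g f' g' := by
    rw [matrixUnit, matrixUnit, ← ofL1_mul, mulL1_unitL1 τ hlam, map_smul, matrixUnit]
  map f g := by rw [matrixUnit, schrodingerHom_ofL1, schrodingerOp_unitL1]
  dense := dense_span_matrixUnit
  denseRange := dense_range_toL2

/-- The Schrödinger representation maps the symbol algebra onto an ideal of `B(L²(X))` containing
the operators of rank one. -/
lemma isIdealRep_schrodingerHom (hlam : IsPseudoTrivialization ω lam) :
    IsIdealRep (schrodingerHom m τ hlam) := (isMatrixUnits hlam).isIdealRep

variable (m) in
lemma nontrivial_L2 : Nontrivial (Lp ℂ 2 m) := by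
  obtain ⟨a, has, ha1, -⟩ := exists_bump (isCompact_singleton (x := (0 : X)))
  let f : C_c(X, ℂ) := ⟨⟨a, map_continuous a⟩, has⟩
  refine ⟨toL2 m f, 0, fun h => ?_⟩
  have h1 : (f : X → ℂ) =ᵐ[m] 0 := by
    filter_upwards [coeFn_toL2 (m := m) f, Lp.coeFn_zero ℂ 2 m] with x hx hx0
    rw [← hx, h, hx0]
  have h2 := (Continuous.ae_eq_iff_eq m f.continuous continuous_zero).1 h1
  have h3 := congr_fun h2 0
  change a 0 = 0 at h3
  rw [ha1 0 rfl] at h3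
  exact one_ne_zero h3

end SchrodingerHom

/-! ### Integrals of the Weyl system against complex measures -/

section WeylIntegral
variable {X : Type u} [AddCommGroup X] [TopologicalSpace X] [IsTopologicalAddGroup X]
  [LocallyCompactSpace X] [T2Space X] [SecondCountableTopology X]
  [MeasurableSpace X] [BorelSpace X] {m : Measure X} [m.IsAddHaarMeasure]
  (τ : X →ₜ+ X) (lam : C(X, C(X, Circle)))

variable (X) in
lemma secondCountable_dualGroup : SecondCountableTopology (DualGroup X) := by
  have : SecondCountableTopology (Multiplicative X) :=
    inferInstanceAs (SecondCountableTopology X)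
  have : LocallyCompactSpace (Multiplicative X) := inferInstanceAs (LocallyCompactSpace X)
  exact (ContinuousMonoidHom.isInducing_toContinuousMap
    (Multiplicative X) Circle).secondCountableTopology

lemma norm_weyl_le (ξ : PhaseSpace X) : ‖weyl m τ lam ξ‖ ≤ 1 := by
  rw [weyl, norm_smul, Circle.norm_coe, one_mul]
  refine (norm_mul_le _ _).trans ?_
  refine mul_le_one₀ (norm_phase_le _) (norm_nonneg _) ?_
  refine (norm_mul_le _ _).trans ?_
  exact mul_le_one₀ (norm_phase_le _) (norm_nonneg _) (norm_shift_le _)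

lemma continuous_conjCharacter : Continuous fun χ : DualGroup X => conjCharacter χ :=
  ContinuousMap.continuous_of_continuous_uncurry _ continuous_character_uncurry.inv

lemma continuous_weyl (u : Lp ℂ 2 m) : Continuous fun ξ => weyl m τ lam ξ u := by
  have hτ : Continuous τ := map_continuous τ
  have h1 : Continuous fun ξ : PhaseSpace X => (character ξ.2 (-τ ξ.1) : ℂ) :=
    continuous_circle_coe.comp (continuous_character_uncurry.comp
      (continuous_snd.prodMk (hτ.comp continuous_fst).neg))
  have h2 : Continuous fun ξ : PhaseSpace X => shift m ξ.1 u :=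
    (continuous_shift u).comp continuous_fst
  have h3 := (continuous_phase_uncurry (m := m)).comp
    ((lam.continuous.comp continuous_fst).prodMk h2)
  have h4 := (continuous_phase_uncurry (m := m)).comp
    (((continuous_conjCharacter (X := X)).comp continuous_snd).prodMk h3)
  have h5 := h1.smul h4
  exact h5

/-- `[W(y, κ)u](x) = conj(κ(x + τy)) lam(y)(x) u(x + y)`. -/
lemma coeFn_weyl (ξ : PhaseSpace X) (u : Lp ℂ 2 m) : weyl m τ lam ξ u =ᵐ[m] fun x =>
    starRingEnd ℂ (character ξ.2 (x + τ ξ.1) : ℂ) * ((lam ξ.1 x : ℂ) * u (x + ξ.1)) := by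
  have e : weyl m τ lam ξ u = (character ξ.2 (-τ ξ.1) : ℂ) •
      multiplication m (phaseFunction (conjCharacter ξ.2))
        (multiplication m (phaseFunction (lam ξ.1)) (shift m ξ.1 u)) := rfl
  rw [e]
  filter_upwards [Lp.coeFn_smul (character ξ.2 (-τ ξ.1) : ℂ)
      (multiplication m (phaseFunction (conjCharacter ξ.2))
        (multiplication m (phaseFunction (lam ξ.1)) (shift m ξ.1 u))),
    coeFn_multiplication (phaseFunction (conjCharacter ξ.2))
      (multiplication m (phaseFunction (lam ξ.1)) (shift m ξ.1 u)),
    coeFn_multiplication (phaseFunction (lam ξ.1)) (shift m ξ.1 u),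
    coeFn_shift ξ.1 u] with x h1 h2 h3 h4
  rw [h1, Pi.smul_apply, h2, h3, h4, smul_eq_mul, ← mul_assoc]
  congr 1
  change (character ξ.2 (-τ ξ.1) : ℂ) * (((character ξ.2 x)⁻¹ : Circle) : ℂ) = _
  rw [character_neg, ← Circle.coe_inv_eq_conj, character_add, ← Circle.coe_mul, mul_inv_rev]

lemma continuous_inner_weyl (u v : Lp ℂ 2 m) :
    Continuous fun ξ => inner ℂ v (weyl m τ lam ξ u) :=
  continuous_const.inner (continuous_weyl τ lam u)

lemma integrable_inner_weyl (μ : ComplexMeasure (PhaseSpace X)) (u v : Lp ℂ 2 m) :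
    μ.Integrable fun ξ => inner ℂ v (weyl m τ lam ξ u) := by
  have hfin := isFiniteMeasure_variation μ
  refine Integrable.of_bound (continuous_inner_weyl τ lam u v).aestronglyMeasurable (‖v‖ * ‖u‖)
    (Eventually.of_forall fun ξ => (norm_inner_le_norm _ _).trans ?_)
  gcongr
  exact ((weyl m τ lam ξ).le_of_opNorm_le (norm_weyl_le τ lam ξ) u).trans_eq (one_mul _)

variable (m) in
lemma exists_weylIntegral (μ : ComplexMeasure (PhaseSpace X)) :
    ∃ T : Lp ℂ 2 m →L[ℂ] Lp ℂ 2 m, ∀ u v, inner ℂ v (T u) =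
      complexIntegral μ fun ξ => inner ℂ v (weyl m τ lam ξ u) := by
  have := secondCountable_dualGroup X
  obtain ⟨h, hm, hi, hh⟩ := exists_density μ
  have hG : StronglyIntegrable (fun ξ => h ξ • weyl m τ lam ξ) μ.variation := by
    refine ⟨fun u => hm.aestronglyMeasurable.smul (continuous_weyl τ lam u).aestronglyMeasurable,
      fun ξ => ‖h ξ‖, hi.norm, Eventually.of_forall fun ξ => ?_⟩
    rw [norm_smul]
    exact mul_le_of_le_one_right (norm_nonneg _) (norm_weyl_le τ lam ξ)
  refine ⟨strongIntegral hG, fun u v => ?_⟩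
  rw [strongIntegral_inner, hh _ (integrable_inner_weyl τ lam μ u v)]
  refine integral_congr_ae (Eventually.of_forall fun ξ => ?_)
  simp only [smul_apply, inner_smul_right, mul_comm]

variable (m) in
/-- The operator `∫ W(ξ) dμ(ξ)`, defined weakly. -/
def weylIntegral : ComplexMeasure (PhaseSpace X) →ₗ[ℂ] (Lp ℂ 2 m →L[ℂ] Lp ℂ 2 m) where
  toFun μ := (exists_weylIntegral m τ lam μ).choose
  map_add' μ ν := by
    ext1 u
    refine ext_inner_left ℂ fun v => ?_
    rw [add_apply, inner_add_right, (exists_weylIntegral m τ lam (μ + ν)).choose_spec,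
      (exists_weylIntegral m τ lam μ).choose_spec, (exists_weylIntegral m τ lam ν).choose_spec]
    exact complexIntegral_add (integrable_inner_weyl τ lam μ u v)
      (integrable_inner_weyl τ lam ν u v)
  map_smul' c μ := by
    ext1 u
    refine ext_inner_left ℂ fun v => ?_
    rw [RingHom.id_apply, smul_apply, inner_smul_right,
      (exists_weylIntegral m τ lam (c • μ)).choose_spec,
      (exists_weylIntegral m τ lam μ).choose_spec]
    exact complexIntegral_smul c (integrable_inner_weyl τ lam μ u v)

lemma inner_weylIntegral (μ : ComplexMeasure (PhaseSpace X)) (u v : Lp ℂ 2 m) :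
    inner ℂ v (weylIntegral m τ lam μ u) =
      complexIntegral μ fun ξ => inner ℂ v (weyl m τ lam ξ u) :=
  (exists_weylIntegral m τ lam μ).choose_spec u v

lemma weylIntegral_dirac (ξ₀ : PhaseSpace X) :
    weylIntegral m τ lam (VectorMeasure.dirac ξ₀ (1 : ℂ)) = weyl m τ lam ξ₀ := by
  ext1 u
  refine ext_inner_left ℂ fun v => ?_
  rw [inner_weylIntegral, complexIntegral_dirac ξ₀ (continuous_inner_weyl τ lam u v)]

end WeylIntegral

/-! ### Weyl integrals and the Schrödinger representation -/

section Comparison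
open scoped CompactlySupported
variable {X : Type u} [AddCommGroup X] [TopologicalSpace X] [IsTopologicalAddGroup X]
  [LocallyCompactSpace X] [T2Space X] [SecondCountableTopology X]
  [MeasurableSpace X] [BorelSpace X] {m : Measure X} [m.IsAddHaarMeasure]
  (τ : X →ₜ+ X) (lam : C(X, C(X, Circle)))

/-- Two complex measures on `X`, given as images of measures with densities, agree if their
Fourier transforms do. -/
theorem integral_comp_eq_of_fourier (m : Measure X) [m.IsAddHaarMeasure] {Z₁ Z₂ : Type*}
    [MeasurableSpace Z₁] [MeasurableSpace Z₂] {ρ₁ : Measure Z₁} {ρ₂ : Measure Z₂} {h₁ : Z₁ → ℂ}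
    {h₂ : Z₂ → ℂ} (hh₁ : Integrable h₁ ρ₁) (hh₂ : Integrable h₂ ρ₂) {p₁ : Z₁ → X} {p₂ : Z₂ → X}
    (hp₁ : Measurable p₁) (hp₂ : Measurable p₂)
    (h0 : ∀ χ : DualGroup X, ∫ z, (character χ (p₁ z) : ℂ) * h₁ z ∂ρ₁ =
      ∫ z, (character χ (p₂ z) : ℂ) * h₂ z ∂ρ₂)
    (g : BoundedContinuousFunction X ℂ) :
    ∫ z, g (p₁ z) * h₁ z ∂ρ₁ = ∫ z, g (p₂ z) * h₂ z ∂ρ₂ := by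
  have := polishSpace X
  -- the difference of the two measures is the image of a density on the disjoint union
  let ρ : Measure (Z₁ ⊕ Z₂) := ρ₁.map Sum.inl + ρ₂.map Sum.inr
  let h : Z₁ ⊕ Z₂ → ℂ := Sum.elim h₁ fun z => -h₂ z
  let p : Z₁ ⊕ Z₂ → X := Sum.elim p₁ p₂
  have hl : MeasurableEmbedding (Sum.inl : Z₁ → Z₁ ⊕ Z₂) :=
    ⟨Sum.inl_injective, measurable_inl, fun _ hs => hs.inl_image⟩
  have hr : MeasurableEmbedding (Sum.inr : Z₂ → Z₁ ⊕ Z₂) :=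
    ⟨Sum.inr_injective, measurable_inr, fun _ hs => hs.inr_image⟩
  have hint : ∀ f : Z₁ ⊕ Z₂ → ℂ, Integrable (fun z => f (Sum.inl z)) ρ₁ →
      Integrable (fun z => f (Sum.inr z)) ρ₂ → Integrable f ρ ∧
      ∫ z, f z ∂ρ = ∫ z, f (Sum.inl z) ∂ρ₁ + ∫ z, f (Sum.inr z) ∂ρ₂ := fun f h1 h2 => by
    have e1 := hl.integrable_map_iff (g := f) |>.2 h1
    have e2 := hr.integrable_map_iff (g := f) |>.2 h2
    refine ⟨e1.add_measure e2, ?_⟩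
    rw [integral_add_measure e1 e2, hl.integral_map,
      hr.integral_map]
  have key : ∀ g : BoundedContinuousFunction X ℂ, ∫ z, g (p z) * h z ∂ρ =
      ∫ z, g (p₁ z) * h₁ z ∂ρ₁ - ∫ z, g (p₂ z) * h₂ z ∂ρ₂ := fun g => by
    have i2 := integrable_comp_mul hh₂ hp₂ g
    rw [(hint (fun z => g (p z) * h z) (integrable_comp_mul hh₁ hp₁ g)
      (i2.neg.congr (Eventually.of_forall fun z => (mul_neg _ _).symm))).2, sub_eq_add_neg,
      ← integral_neg]
    congr 1
    exact integral_congr_ae (Eventually.of_forall fun z => mul_neg _ _)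
  refine sub_eq_zero.1 ((key g).symm.trans ?_)
  refine integral_comp_eq_zero_of_fourier m (hint h hh₁ hh₂.neg).1 (hp₁.sumElim hp₂) (fun χ => ?_) g
  exact (key (phaseFunction (characterMap χ))).trans (sub_eq_zero.2 (h0 χ))

/-- Matrix coefficients between functions of compact support determine an operator. -/
lemma op_ext_toL2 {S T : Lp ℂ 2 m →L[ℂ] Lp ℂ 2 m}
    (h : ∀ u v : C_c(X, ℂ), inner ℂ (toL2 m v) (S (toL2 m u)) = inner ℂ (toL2 m v) (T (toL2 m u))) :
    S = T := by
  refine ContinuousLinearMap.ext fun u => ?_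
  refine congr_fun (dense_range_toL2.equalizer S.continuous T.continuous (funext fun u => ?_)) u
  refine ext_inner_left ℂ fun v => ?_
  have hST : (fun v => (inner ℂ v (S (toL2 m u)) : ℂ)) = fun v => inner ℂ v (T (toL2 m u)) :=
    dense_range_toL2.equalizer (continuous_id.inner continuous_const)
      (continuous_id.inner continuous_const) (funext fun v => h u v)
  exact congr_fun hST v

/-- The function `(y, x) ↦ conj(v(x)) lam(y)(x) u(x + y)`. -/
def shiftCoeff (u v : C_c(X, ℂ)) (y x : X) : ℂ :=
  starRingEnd ℂ (v x) * ((lam y x : ℂ) * u (x + y))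

lemma continuous_shiftCoeff (u v : C_c(X, ℂ)) :
    Continuous fun p : X × X => shiftCoeff lam u v p.1 p.2 := by
  have h1 : Continuous fun p : X × X => (lam p.1 p.2 : ℂ) :=
    continuous_circle_coe.comp ((continuous_eval (F := C(X, Circle))).comp
      ((lam.continuous.comp continuous_fst).prodMk continuous_snd))
  exact (Complex.continuous_conj.comp (v.continuous.comp continuous_snd)).mul
    (h1.mul (u.continuous.comp (continuous_snd.add continuous_fst)))

lemma exists_norm_shiftCoeff_le (u v : C_c(X, ℂ)) :
    ∃ C : ℝ, 0 ≤ C ∧ ∀ y x, ‖shiftCoeff lam u v y x‖ ≤ C * ‖v x‖ := by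
  obtain ⟨C, hC⟩ := u.hasCompactSupport.exists_bound_of_continuous u.continuous
  refine ⟨C, (norm_nonneg _).trans (hC 0), fun y x => ?_⟩
  rw [shiftCoeff, norm_mul, norm_mul, Circle.norm_coe, one_mul, RCLike.norm_conj, mul_comm]
  gcongr
  exact hC _

lemma inner_weyl_toL2 (ξ : PhaseSpace X) (u v : C_c(X, ℂ)) :
    inner ℂ (toL2 m v) (weyl m τ lam ξ (toL2 m u)) =
      ∫ x, starRingEnd ℂ (character ξ.2 (x + τ ξ.1) : ℂ) * shiftCoeff lam u v ξ.1 x ∂m := by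
  rw [L2.inner_def]
  refine integral_congr_ae ?_
  filter_upwards [coeFn_weyl τ lam ξ (toL2 m u), coeFn_toL2 (m := m) v,
    ae_comp_add_right (coeFn_toL2 (m := m) u) ξ.1] with x h1 h2 h3
  rw [h1, h2, h3, RCLike.inner_apply, shiftCoeff]
  ring

lemma inner_schrodingerKernel_toL2 (y : X) (a : C₀(X, ℂ)) (u v : C_c(X, ℂ)) :
    inner ℂ (toL2 m v) (schrodingerKernel m τ lam y a (toL2 m u)) =
      ∫ x, a (x + τ y) * shiftCoeff lam u v y x ∂m := by
  rw [schrodingerKernel_apply, L2.inner_def]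
  refine integral_congr_ae ?_
  filter_upwards [coeFn_rep (untwist τ lam y a) (shift m y (toL2 m u)), coeFn_shift y (toL2 m u),
    coeFn_toL2 (m := m) v, ae_comp_add_right (coeFn_toL2 (m := m) u) y] with x h1 h2 h3 h4
  rw [h1, h2, h3, h4, RCLike.inner_apply, shiftCoeff, untwist_apply]
  ring

section Swap
variable {Z : Type*} [MeasurableSpace Z] {σ : Measure Z} [SFinite σ] {p : Z → X}

lemma integrable_shiftCoeff_mul (hp : Measurable p) {F : Z × X → ℂ}
    (hF : AEStronglyMeasurable F (σ.prod m)) {b : Z → ℝ} (hb : Integrable b σ)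
    (hFb : ∀ z x, ‖F (z, x)‖ ≤ b z) (u v : C_c(X, ℂ)) :
    Integrable (fun w : Z × X => shiftCoeff lam u v (p w.1) (w.2 - τ (p w.1)) * F w)
      (σ.prod m) := by
  obtain ⟨C, hC, hCb⟩ := exists_norm_shiftCoeff_le lam u v
  have hτ : Continuous τ := map_continuous τ
  have hq : Measurable fun w : Z × X => w.2 - τ (p w.1) :=
    measurable_snd.sub (hτ.measurable.comp (hp.comp measurable_fst))
  have hv : Integrable (fun x => ‖v x‖) m :=
    (v.continuous.integrable_of_hasCompactSupport v.hasCompactSupport).norm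
  have hdom : Integrable (fun w : Z × X => b w.1 * (C * ‖v (w.2 - τ (p w.1))‖)) (σ.prod m) := by
    have hm : AEStronglyMeasurable (fun w : Z × X => b w.1 * (C * ‖v (w.2 - τ (p w.1))‖))
        (σ.prod m) := by
      refine hb.1.comp_fst.mul ?_
      exact (((v.continuous.norm.measurable.comp hq)).const_mul C).aestronglyMeasurable
    refine (integrable_prod_iff hm).2 ⟨Eventually.of_forall fun z => ?_, ?_⟩
    · exact ((hv.comp_sub_right (τ (p z))).const_mul C).const_mul (b z)
    · have e : ∀ z, ∫ x, ‖b z * (C * ‖v (x - τ (p z))‖)‖ ∂m = ‖b z‖ * (C * ∫ x, ‖v x‖ ∂m) := by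
        intro z
        rw [← integral_sub_right_eq_self (fun x => ‖v x‖) (τ (p z)), ← integral_const_mul,
          ← integral_const_mul]
        refine integral_congr_ae (Eventually.of_forall fun x => ?_)
        simp only [norm_mul, norm_norm, Real.norm_of_nonneg hC]
      simp only [e]
      exact hb.norm.mul_const _
  refine hdom.mono' (((continuous_shiftCoeff lam u v).measurable.comp
    ((hp.comp measurable_fst).prodMk hq)).aestronglyMeasurable.mul hF)
    (Eventually.of_forall fun w => ?_)
  rw [norm_mul, mul_comm]
  exact mul_le_mul (hFb w.1 w.2) (hCb _ _) (norm_nonneg _) ((norm_nonneg _).trans (hFb w.1 w.2))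

/-- Fubini's theorem, after the substitution `x ↦ x - τ y` in the inner integral. -/
lemma integral_shiftCoeff_swap (hp : Measurable p) {F : Z × X → ℂ}
    (hF : AEStronglyMeasurable F (σ.prod m)) {b : Z → ℝ} (hb : Integrable b σ)
    (hFb : ∀ z x, ‖F (z, x)‖ ≤ b z) (u v : C_c(X, ℂ)) :
    ∫ z, ∫ x, F (z, x + τ (p z)) * shiftCoeff lam u v (p z) x ∂m ∂σ =
      ∫ x, ∫ z, shiftCoeff lam u v (p z) (x - τ (p z)) * F (z, x) ∂σ ∂m := by
  rw [← integral_integral_swap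
    (f := fun z x => shiftCoeff lam u v (p z) (x - τ (p z)) * F (z, x))
    (integrable_shiftCoeff_mul τ lam hp hF hb hFb u v)]
  refine integral_congr_ae (Eventually.of_forall fun z => ?_)
  change ∫ x, F (z, x + τ (p z)) * shiftCoeff lam u v (p z) x ∂m =
    ∫ x, shiftCoeff lam u v (p z) (x - τ (p z)) * F (z, x) ∂m
  rw [← integral_add_right_eq_self
    (fun x => shiftCoeff lam u v (p z) (x - τ (p z)) * F (z, x)) (τ (p z))]
  refine integral_congr_ae (Eventually.of_forall fun x => ?_)
  simp only [add_sub_cancel_right]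
  exact mul_comm _ _

end Swap

lemma continuous_character_apply_prod :
    Continuous fun w : PhaseSpace X × X => starRingEnd ℂ (character w.1.2 w.2 : ℂ) :=
  Complex.continuous_conj.comp (continuous_circle_coe.comp (continuous_character_uncurry.comp
    (continuous_fst.snd.prodMk continuous_snd)))

/-- The matrix coefficients of `∫ W(ξ) dμ(ξ)`, where `h` is the density of `μ`. -/
lemma inner_weylIntegral_toL2 {μ : ComplexMeasure (PhaseSpace X)} {h : PhaseSpace X → ℂ}
    (hi : Integrable h μ.variation) (hh : ∀ f : PhaseSpace X → ℂ, Integrable f μ.variation →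
      complexIntegral μ f = ∫ ξ, f ξ * h ξ ∂μ.variation) (u v : C_c(X, ℂ)) :
    inner ℂ (toL2 m v) (weylIntegral m τ lam μ (toL2 m u)) =
      ∫ x, ∫ ξ, shiftCoeff lam u v ξ.1 (x - τ ξ.1) *
        (h ξ * starRingEnd ℂ (character ξ.2 x : ℂ)) ∂μ.variation ∂m := by
  have hfin := isFiniteMeasure_variation μ
  rw [inner_weylIntegral, hh _ (integrable_inner_weyl τ lam μ _ _)]
  rw [← integral_shiftCoeff_swap (m := m) (σ := μ.variation) τ lam measurable_fst
    (F := fun w => h w.1 * starRingEnd ℂ (character w.1.2 w.2 : ℂ))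
    (hi.1.comp_fst.mul continuous_character_apply_prod.aestronglyMeasurable)
    hi.norm (fun z x => by rw [norm_mul, RCLike.norm_conj, Circle.norm_coe, mul_one])]
  refine integral_congr_ae (Eventually.of_forall fun ξ => ?_)
  simp only [inner_weyl_toL2]
  rw [mul_comm, ← integral_const_mul]
  simp only [mul_assoc]

/-- The matrix coefficients of the Schrödinger representation. -/
lemma inner_schrodingerOp_toL2 (φ : X →₁[m] C₀(X, ℂ)) (u v : C_c(X, ℂ)) :
    inner ℂ (toL2 m v) (schrodingerOp τ lam φ (toL2 m u)) =
      ∫ x, ∫ y, shiftCoeff lam u v y (x - τ y) * φ y x ∂m ∂m := by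
  have hφ := L1.integrable_coeFn φ
  have hS := stronglyIntegrable_schrodinger τ lam hφ
  have hpair : AEStronglyMeasurable (fun w : X × X => (φ w.1, w.2)) (m.prod m) :=
    hφ.1.comp_fst.prodMk continuous_snd.aestronglyMeasurable
  rw [schrodingerOp_apply, ← integral_inner (hS.integrable _)]
  have hswap := integral_shiftCoeff_swap (m := m) (σ := m) τ lam measurable_id
    (F := fun w => φ w.1 w.2)
    (aestronglyMeasurable_comp (fun w : X × X => (φ w.1, w.2)) _ continuous_apply_uncurry hpair)
    hφ.norm (fun z x => norm_apply_le (φ z) x) u v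
  refine Eq.trans ?_ hswap
  refine integral_congr_ae (Eventually.of_forall fun y => ?_)
  exact inner_schrodingerKernel_toL2 τ lam y (φ y) u v

/-- On functions that are both symplectic Fourier transforms of measures and symbols, the Weyl
integral is the Schrödinger representation: for every fixed `x`, the measures `conj(κ(x)) μ(dy, dκ)`
(projected to `X`) and `φ(y)(x) dy` have the same Fourier transform. -/
theorem weylIntegral_eq_schrodingerOp {μ : ComplexMeasure (PhaseSpace X)} {φ : X →₁[m] C₀(X, ℂ)}
    (hμ : symplecticFourier μ = partialFourier m φ) :
    weylIntegral m τ lam μ = schrodingerOp τ lam φ := by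
  have hfin := isFiniteMeasure_variation μ
  have hφ := L1.integrable_coeFn φ
  have hτ : Continuous τ := map_continuous τ
  obtain ⟨h, hm, hi, hh⟩ := exists_density μ
  refine op_ext_toL2 fun u v => ?_
  rw [inner_weylIntegral_toL2 τ lam hi hh, inner_schrodingerOp_toL2]
  refine integral_congr_ae (Eventually.of_forall fun x => ?_)
  obtain ⟨C, hC, hCb⟩ := exists_norm_shiftCoeff_le lam u v
  obtain ⟨D, hD⟩ := v.hasCompactSupport.exists_bound_of_continuous v.continuous
  have hc : Continuous fun y => shiftCoeff lam u v y (x - τ y) :=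
    (continuous_shiftCoeff lam u v).comp (continuous_id.prodMk (continuous_const.sub hτ))
  let g : BoundedContinuousFunction X ℂ := BoundedContinuousFunction.ofNormedAddCommGroup
    _ hc (C * D) fun y => (hCb _ _).trans (by gcongr; exact hD _)
  have hx : Integrable (fun ξ : PhaseSpace X => h ξ * starRingEnd ℂ (character ξ.2 x : ℂ))
      μ.variation := by
    refine hi.mul_bdd (c := 1) ?_ (Eventually.of_forall fun ξ => ?_)
    · exact (continuous_character_apply_prod.comp
        (continuous_id.prodMk continuous_const)).aestronglyMeasurable
    · rw [RCLike.norm_conj, Circle.norm_coe]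
  refine integral_comp_eq_of_fourier m hx (integrable_apply m hφ x) measurable_fst measurable_id
    (fun χ => ?_) g
  have e := congr_fun hμ (x, χ)
  rw [partialFourier_apply] at e
  refine Eq.trans ?_ e
  change _ = complexIntegral μ (symplecticKernel (x, χ))
  rw [hh _ (integrable_symplecticKernel μ (x, χ))]
  refine integral_congr_ae (Eventually.of_forall fun ξ => ?_)
  simp only [symplecticKernel]
  ring

end Comparison

/-! ### Injectivity of the Weyl integral -/

section Injectivity
open scoped CompactlySupported
variable {X : Type u} [AddCommGroup X] [TopologicalSpace X] [IsTopologicalAddGroup X]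
  [LocallyCompactSpace X] [T2Space X] [SecondCountableTopology X]
  [MeasurableSpace X] [BorelSpace X] {m : Measure X} [m.IsAddHaarMeasure]
  (τ : X →ₜ+ X) (lam : C(X, C(X, Circle)))

/-- The product of a continuous function and a function of compact support. -/
def mulCompact (g : C(X, ℂ)) (v : C_c(X, ℂ)) : C_c(X, ℂ) :=
  ⟨⟨fun x => g x * v x, g.continuous.mul v.continuous⟩, v.hasCompactSupport.mul_left⟩

lemma mulCompact_apply (g : C(X, ℂ)) (v : C_c(X, ℂ)) (x : X) : mulCompact g v x = g x * v x := rfl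

/-- A character as a complex continuous function. -/
def characterC (χ : DualGroup X) : C(X, ℂ) :=
  ⟨fun x => (character χ x : ℂ), continuous_circle_coe.comp (continuous_character χ)⟩

lemma characterC_apply (χ : DualGroup X) (x : X) : characterC χ x = (character χ x : ℂ) := rfl

/-- If `∫ W(ξ) dμ(ξ) = 0`, then the phase factors in the matrix coefficients can be replaced by
`χ(y) a(x)`, with a character `χ` and a function `a` of compact support: multiplying the vectors by
characters shows that the image in `X × X` of the measure that computes the matrix coefficient
has zero Fourier transform. -/
lemma integral_eq_zero_of_weylIntegral_eq_zero {μ : ComplexMeasure (PhaseSpace X)}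
    {h : PhaseSpace X → ℂ}
    (hi : Integrable h μ.variation) (hh : ∀ f : PhaseSpace X → ℂ, Integrable f μ.variation →
      complexIntegral μ f = ∫ ξ, f ξ * h ξ ∂μ.variation)
    (h0 : weylIntegral m τ lam μ = 0) (u v a : C_c(X, ℂ)) (χ : DualGroup X) :
    ∫ w : PhaseSpace X × X, (starRingEnd ℂ (v (w.2 - τ w.1.1)) * u (w.2 - τ w.1.1 + w.1.1)) *
      (a w.2 * ((character χ w.1.1 : ℂ) * (h w.1 * starRingEnd ℂ (character w.1.2 w.2 : ℂ))))
      ∂(μ.variation.prod m) = 0 := by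
  have hfin := isFiniteMeasure_variation μ
  have hτ : Continuous τ := map_continuous τ
  let F : PhaseSpace X × X → ℂ := fun w => h w.1 * starRingEnd ℂ (character w.1.2 w.2 : ℂ)
  have hint : ∀ u v : C_c(X, ℂ), Integrable (fun w : PhaseSpace X × X =>
      shiftCoeff lam u v w.1.1 (w.2 - τ w.1.1) * F w) (μ.variation.prod m) := fun u v =>
    integrable_shiftCoeff_mul (m := m) (σ := μ.variation) τ lam measurable_fst (F := F)
      (hi.1.comp_fst.mul continuous_character_apply_prod.aestronglyMeasurable)
      hi.norm (fun z x => by rw [norm_mul, RCLike.norm_conj, Circle.norm_coe, mul_one]) u v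
  have hzero : ∀ u v : C_c(X, ℂ), ∫ w : PhaseSpace X × X,
      shiftCoeff lam u v w.1.1 (w.2 - τ w.1.1) * F w ∂(μ.variation.prod m) = 0 := fun u v => by
    rw [integral_prod_symm _ (hint u v), ← inner_weylIntegral_toL2 τ lam hi hh u v, h0, zero_apply,
      inner_zero_right]
  have hp : Continuous fun w : PhaseSpace X × X =>
      (w.2 - τ w.1.1, w.2 - τ w.1.1 + w.1.1) := by
    have h1 : Continuous fun w : PhaseSpace X × X => w.2 - τ w.1.1 :=
      continuous_snd.sub (hτ.comp continuous_fst.fst)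
    exact h1.prodMk (h1.add continuous_fst.fst)
  have hfour := integral_comp_eq_zero_of_fourier_prod m (hint u v) hp.measurable
    fun χ₁ χ₂ => by
      rw [← hzero (mulCompact (characterC χ₂) u)
        (mulCompact (star (characterC χ₁)) v)]
      refine integral_congr_ae (Eventually.of_forall fun w => ?_)
      simp only [shiftCoeff, mulCompact_apply, ContinuousMap.star_apply, characterC_apply, map_mul,
        RCLike.star_def, Complex.conj_conj]
      ring
  -- the test function that cancels `lam` and produces `χ(y) a(x)`
  obtain ⟨D, hD⟩ := a.hasCompactSupport.exists_bound_of_continuous a.continuous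
  have hlam : Continuous fun p : X × X => starRingEnd ℂ (lam (p.2 - p.1) p.1 : ℂ) :=
    Complex.continuous_conj.comp (continuous_circle_coe.comp
      ((continuous_eval (F := C(X, Circle))).comp
        ((lam.continuous.comp (continuous_snd.sub continuous_fst)).prodMk continuous_fst)))
  have hc : Continuous fun p : X × X => starRingEnd ℂ (lam (p.2 - p.1) p.1 : ℂ) *
      ((character χ (p.2 - p.1) : ℂ) * a (p.1 + τ (p.2 - p.1))) :=
    hlam.mul (((characterC χ).continuous.comp (continuous_snd.sub continuous_fst)).mul
      (a.continuous.comp (continuous_fst.add (hτ.comp (continuous_snd.sub continuous_fst)))))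
  have hg := hfour (BoundedContinuousFunction.ofNormedAddCommGroup _ hc D fun p => by
    rw [norm_mul, norm_mul, RCLike.norm_conj, Circle.norm_coe, Circle.norm_coe, one_mul, one_mul]
    exact hD _)
  rw [← hg]
  refine integral_congr_ae (Eventually.of_forall fun w => ?_)
  have e1 : w.2 - τ w.1.1 + w.1.1 - (w.2 - τ w.1.1) = w.1.1 := by abel
  have e2 : w.2 - τ w.1.1 + τ w.1.1 = w.2 := sub_add_cancel _ _
  simp only [BoundedContinuousFunction.coe_ofNormedAddCommGroup, shiftCoeff, e1, e2, F]
  have e3 : starRingEnd ℂ (lam w.1.1 (w.2 - τ w.1.1) : ℂ) *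
      (lam w.1.1 (w.2 - τ w.1.1) : ℂ) = 1 := by
    rw [← Circle.coe_inv_eq_conj, ← Circle.coe_mul, inv_mul_cancel, Circle.coe_one]
  linear_combination (-(starRingEnd ℂ (v (w.2 - τ w.1.1)) * u (w.2 - τ w.1.1 + w.1.1) *
    (a w.2 * ((character χ w.1.1 : ℂ) *
      (h w.1 * starRingEnd ℂ (character w.1.2 w.2 : ℂ)))))) * e3

variable (X) in
/-- A bounded sequence of functions of compact support that is eventually constant `1` at every
point. -/
lemma exists_seq_tendsto_one : ∃ b : ℕ → C_c(X, ℂ), (∀ n x, ‖b n x‖ ≤ 1) ∧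
    ∀ x, ∀ᶠ n in atTop, b n x = 1 := by
  let K := CompactExhaustion.choice X
  choose b hbs hb1 hbn using fun n => exists_bump (K.isCompact n)
  refine ⟨fun n => ⟨⟨b n, map_continuous (b n)⟩, hbs n⟩, fun n x => hbn n x, fun x => ?_⟩
  filter_upwards [eventually_ge_atTop (K.find x)] with n hn
  exact hb1 n x (K.subset hn (K.mem_find x))

lemma symplecticFourier_apply {μ : ComplexMeasure (PhaseSpace X)} {h : PhaseSpace X → ℂ}
    (hh : ∀ f : PhaseSpace X → ℂ, Integrable f μ.variation →
      complexIntegral μ f = ∫ ξ, f ξ * h ξ ∂μ.variation) (x : X) (χ : DualGroup X) :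
    symplecticFourier μ (x, χ) = ∫ ξ, (character χ ξ.1 : ℂ) *
      (h ξ * starRingEnd ℂ (character ξ.2 x : ℂ)) ∂μ.variation := by
  change complexIntegral μ (symplecticKernel (x, χ)) = _
  rw [hh _ (integrable_symplecticKernel μ (x, χ))]
  refine integral_congr_ae (Eventually.of_forall fun ξ => ?_)
  simp only [symplecticKernel]
  ring

lemma continuous_symplecticFourier (μ : ComplexMeasure (PhaseSpace X)) (χ : DualGroup X) :
    Continuous fun x => symplecticFourier μ (x, χ) := by
  have hfin := isFiniteMeasure_variation μ
  obtain ⟨h, hm, hi, hh⟩ := exists_density μ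
  simp only [symplecticFourier_apply hh]
  have h1 : Continuous fun ξ : PhaseSpace X => (character χ ξ.1 : ℂ) :=
    (characterC χ).continuous.comp continuous_fst
  refine continuous_of_dominated (bound := fun ξ => ‖h ξ‖) (fun x => ?_) (fun x => ?_) hi.norm ?_
  · exact h1.aestronglyMeasurable.mul (hi.1.mul (continuous_character_apply_prod.comp
      (continuous_id.prodMk continuous_const)).aestronglyMeasurable)
  · refine Eventually.of_forall fun ξ => ?_
    rw [norm_mul, norm_mul, RCLike.norm_conj, Circle.norm_coe, Circle.norm_coe, one_mul, mul_one]
  · refine Eventually.of_forall fun ξ => continuous_const.mul (continuous_const.mul ?_)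
    exact Complex.continuous_conj.comp (characterC ξ.2).continuous

/-- The Weyl integral determines the symplectic Fourier transform: by
`integral_eq_zero_of_weylIntegral_eq_zero`, with `u` and `v` tending to `1`, the continuous
function `F_Ξ μ(·, χ)` is orthogonal to all the functions `a` of compact support. -/
theorem symplecticFourier_eq_zero_of_weylIntegral_eq_zero {μ : ComplexMeasure (PhaseSpace X)}
    (h0 : weylIntegral m τ lam μ = 0) : symplecticFourier μ = 0 := by
  have hfin := isFiniteMeasure_variation μ
  have hτ : Continuous τ := map_continuous τ
  obtain ⟨h, hm, hi, hh⟩ := exists_density μ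
  obtain ⟨b, hb1, hb⟩ := exists_seq_tendsto_one X
  have horth : ∀ (a : C_c(X, ℂ)) (χ : DualGroup X),
      ∫ x, a x * symplecticFourier μ (x, χ) ∂m = 0 := by
    intro a χ
    let G : PhaseSpace X × X → ℂ := fun w =>
      a w.2 * ((character χ w.1.1 : ℂ) * (h w.1 * starRingEnd ℂ (character w.1.2 w.2 : ℂ)))
    have hGn : ∀ w, ‖G w‖ = ‖h w.1‖ * ‖a w.2‖ := fun w => by
      simp only [G, norm_mul, RCLike.norm_conj, Circle.norm_coe, mul_one, mul_comm]
    have hGm : AEStronglyMeasurable G (μ.variation.prod m) := by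
      refine (a.continuous.comp continuous_snd).aestronglyMeasurable.mul
        (AEStronglyMeasurable.mul ?_
          (hi.1.comp_fst.mul continuous_character_apply_prod.aestronglyMeasurable))
      exact ((characterC χ).continuous.comp continuous_fst.fst).aestronglyMeasurable
    have ha : Integrable (fun x => ‖a x‖) m :=
      (a.continuous.integrable_of_hasCompactSupport a.hasCompactSupport).norm
    have hdom : Integrable (fun w : PhaseSpace X × X => ‖h w.1‖ * ‖a w.2‖)
        (μ.variation.prod m) := hi.norm.mul_prod ha
    have hG : Integrable G (μ.variation.prod m) :=
      hdom.mono' hGm (Eventually.of_forall fun w => (hGn w).le)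
    have hc : ∀ n, Continuous fun w : PhaseSpace X × X =>
        starRingEnd ℂ (b n (w.2 - τ w.1.1)) * b n (w.2 - τ w.1.1 + w.1.1) := fun n => by
      have h1 : Continuous fun w : PhaseSpace X × X => w.2 - τ w.1.1 :=
        continuous_snd.sub (hτ.comp continuous_fst.fst)
      exact (Complex.continuous_conj.comp ((b n).continuous.comp h1)).mul
        ((b n).continuous.comp (h1.add continuous_fst.fst))
    have hlim : Tendsto (fun n => ∫ w : PhaseSpace X × X,
        (starRingEnd ℂ (b n (w.2 - τ w.1.1)) * b n (w.2 - τ w.1.1 + w.1.1)) * G w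
          ∂(μ.variation.prod m)) atTop (𝓝 (∫ w, G w ∂(μ.variation.prod m))) := by
      refine tendsto_integral_of_dominated_convergence _
        (fun n => (hc n).aestronglyMeasurable.mul hGm) hdom
        (fun n => Eventually.of_forall fun w => ?_) (Eventually.of_forall fun w => ?_)
      · rw [norm_mul, norm_mul, RCLike.norm_conj, ← hGn w]
        exact mul_le_of_le_one_left (norm_nonneg _)
          (mul_le_one₀ (hb1 _ _) (norm_nonneg _) (hb1 _ _))
      · refine tendsto_const_nhds.congr' ?_
        filter_upwards [hb (w.2 - τ w.1.1), hb (w.2 - τ w.1.1 + w.1.1)] with n e1 e2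
        rw [e1, e2, map_one, one_mul, one_mul]
    have hz : ∀ n, ∫ w : PhaseSpace X × X,
        (starRingEnd ℂ (b n (w.2 - τ w.1.1)) * b n (w.2 - τ w.1.1 + w.1.1)) * G w
          ∂(μ.variation.prod m) = 0 := fun n =>
      integral_eq_zero_of_weylIntegral_eq_zero τ lam hi hh h0 (b n) (b n) a χ
    simp only [hz] at hlim
    have hG0 := tendsto_nhds_unique hlim tendsto_const_nhds
    rw [integral_prod_symm _ hG] at hG0
    rw [← hG0]
    refine integral_congr_ae (Eventually.of_forall fun x => ?_)
    simp only [G]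
    rw [integral_const_mul, symplecticFourier_apply hh]
  ext ⟨x₀, χ⟩
  by_contra hne
  have hF := continuous_symplecticFourier μ χ
  obtain ⟨c, hcs, hc1, -⟩ := exists_bump (isCompact_singleton (x := x₀))
  -- for `a = conj(F) |c|²`, orthogonality gives `∫ |c F|² = 0`
  let a : C_c(X, ℂ) := mulCompact (star ⟨_, hF⟩) (mulCompact (star ⟨_, map_continuous c⟩)
    ⟨⟨c, map_continuous c⟩, hcs⟩)
  have hpos : 0 < ∫ x, ‖c x * symplecticFourier μ (x, χ)‖ ^ 2 ∂m := by
    refine Continuous.integral_pos_of_hasCompactSupport_nonneg_nonzero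
      (((map_continuous c).mul hF).norm.pow 2) ?_ (fun x => by positivity) (x := x₀) ?_
    · exact (hcs.mul_right (f' := fun x => symplecticFourier μ (x, χ))).comp_left
        (g := fun z : ℂ => ‖z‖ ^ 2) (by simp)
    · rw [hc1 x₀ rfl, one_mul]
      exact pow_ne_zero 2 (norm_ne_zero_iff.2 hne)
  have hzero := horth a χ
  have e : ∀ x, a x * symplecticFourier μ (x, χ) =
      ((‖c x * symplecticFourier μ (x, χ)‖ ^ 2 : ℝ) : ℂ) := fun x => by
    change starRingEnd ℂ (symplecticFourier μ (x, χ)) * (starRingEnd ℂ (c x) * c x) * _ = _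
    rw [Complex.ofReal_pow, ← Complex.conj_mul', map_mul]
    ring
  simp only [e] at hzero
  have hr := (integral_ofReal (𝕜 := ℂ)).symm.trans hzero
  exact hpos.ne' (Complex.ofReal_eq_zero.1 hr)

end Injectivity

/-! ### Pseudo-trivializations -/

section PseudoTrivializations
variable {X : Type u} [AddCommGroup X] [TopologicalSpace X] [IsTopologicalAddGroup X]
  [LocallyCompactSpace X] [T2Space X] [SecondCountableTopology X]
  [MeasurableSpace X] [BorelSpace X] {m : Measure X} [m.IsAddHaarMeasure]
  {ω : TwoCocycle X} {τ : X →ₜ+ X} {lam lam' : C(X, C(X, Circle))}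

/-- The pseudo-trivialization `lam(x)(q) = ω(q, x)(0)`. -/
def canonicalTrivialization (ω : TwoCocycle X) : C(X, C(X, Circle)) :=
  ContinuousMap.curry ⟨fun p : X × X => ω.toMap (p.2, p.1) 0,
    (continuous_eval_const (F := C(X, Circle)) 0).comp (ω.toMap.continuous.comp continuous_swap)⟩

/-- The identity is the cocycle identity for `q, x, y`, evaluated at `0`. -/
lemma isPseudoTrivialization_canonicalTrivialization (ω : TwoCocycle X) :
    IsPseudoTrivialization ω (canonicalTrivialization ω) := by
  intro x y
  ext q
  have h := DFunLike.congr_fun (ω.cocycle q x y) 0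
  change ω.toMap (q + x, y) 0 * ω.toMap (q, x) 0 =
    ω.toMap (x, y) (0 + q) * ω.toMap (q, x + y) 0 at h
  rw [zero_add] at h
  congr 1
  change ω.toMap (q, x) 0 * ω.toMap (q + x, y) 0 / ω.toMap (q, x + y) 0 = ω.toMap (x, y) q
  rw [div_eq_iff_eq_mul, mul_comm, h]

/-- The function `b` with `lam'(y)(x) = lam(y)(x) b(x + y) / b(x)`, for two pseudo-trivializations
`lam` and `lam'` of the same cocycle. -/
def gauge (lam lam' : C(X, C(X, Circle))) : C(X, Circle) :=
  ⟨fun q => lam' q 0 / lam q 0,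
    ((continuous_eval_const (F := C(X, Circle)) 0).comp lam'.continuous).div'
      ((continuous_eval_const (F := C(X, Circle)) 0).comp lam.continuous)⟩

lemma gauge_apply (q : X) : gauge lam lam' q = lam' q 0 / lam q 0 := rfl

/-- Both pseudo-trivializations satisfy `lam(x)(0) lam(y)(x) = ω(x, y)(0) lam(x + y)(0)`, and the
quotient of the two identities eliminates `ω`. -/
lemma gauge_spec (hlam : IsPseudoTrivialization ω lam) (hlam' : IsPseudoTrivialization ω lam')
    (y x : X) : lam' y x = (gauge lam lam' x)⁻¹ * (lam y x * gauge lam lam' (x + y)) := by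
  have h : lam x 0 * lam y x = ω.toMap (x, y) 0 * lam (x + y) 0 :=
    Circle.coe_injective (by simpa using hlam.apply x y 0)
  have h' : lam' x 0 * lam' y x = ω.toMap (x, y) 0 * lam' (x + y) 0 :=
    Circle.coe_injective (by simpa using hlam'.apply x y 0)
  -- cancellation in the abelian group `𝕋`, written additively
  have key : ∀ r s t s' t' : Additive Circle,
      -r + (s + t) = -(r - s') + (-s' + (s + t') + (t - t')) := fun _ _ _ _ _ => by abel
  rw [gauge_apply, gauge_apply, eq_inv_mul_of_mul_eq h, eq_inv_mul_of_mul_eq h']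
  exact key _ _ _ _ _

lemma weyl_gauge (hlam : IsPseudoTrivialization ω lam) (hlam' : IsPseudoTrivialization ω lam')
    (ξ : PhaseSpace X) (u : Lp ℂ 2 m) : weyl m τ lam' ξ u =
      multiplication m (phaseFunction (gauge lam lam')⁻¹) (weyl m τ lam ξ
        (multiplication m (phaseFunction (gauge lam lam')) u)) := by
  apply Lp.ext
  filter_upwards [coeFn_weyl τ lam' ξ u,
    coeFn_multiplication (phaseFunction (gauge lam lam')⁻¹) (weyl m τ lam ξ
      (multiplication m (phaseFunction (gauge lam lam')) u)),
    coeFn_weyl τ lam ξ (multiplication m (phaseFunction (gauge lam lam')) u),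
    ae_comp_add_right (coeFn_multiplication (phaseFunction (gauge lam lam')) u) ξ.1]
    with x h1 h2 h3 h4
  rw [h1, h2, h3, h4, gauge_spec hlam hlam' ξ.1 x]
  change _ = (((gauge lam lam' x)⁻¹ : Circle) : ℂ) *
    (_ * (_ * ((gauge lam lam' (x + ξ.1) : Circle) * _)))
  push_cast
  ring

lemma schrodingerKernel_gauge (hlam : IsPseudoTrivialization ω lam)
    (hlam' : IsPseudoTrivialization ω lam') (y : X) (a : C₀(X, ℂ)) (u : Lp ℂ 2 m) :
    schrodingerKernel m τ lam' y a u =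
      multiplication m (phaseFunction (gauge lam lam')⁻¹) (schrodingerKernel m τ lam y a
        (multiplication m (phaseFunction (gauge lam lam')) u)) := by
  rw [schrodingerKernel_apply, schrodingerKernel_apply]
  set w := multiplication m (phaseFunction (gauge lam lam')) u with hw
  apply Lp.ext
  filter_upwards [coeFn_rep (untwist τ lam' y a) (shift m y u), coeFn_shift y u,
    coeFn_multiplication (phaseFunction (gauge lam lam')⁻¹)
      (rep m (untwist τ lam y a) (shift m y w)),
    coeFn_rep (untwist τ lam y a) (shift m y w), coeFn_shift y w,
    ae_comp_add_right (coeFn_multiplication (phaseFunction (gauge lam lam')) u) y]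
    with x h1 h2 h3 h4 h5 h6
  rw [h1, h2, h3, h4, h5, hw, h6, untwist_apply, untwist_apply, gauge_spec hlam hlam' y x]
  change _ = (((gauge lam lam' x)⁻¹ : Circle) : ℂ) *
    (_ * ((gauge lam lam' (x + y) : Circle) * _))
  push_cast
  ring

lemma schrodingerOp_gauge (hlam : IsPseudoTrivialization ω lam)
    (hlam' : IsPseudoTrivialization ω lam') (φ : X →₁[m] C₀(X, ℂ)) :
    schrodingerOp τ lam' φ = multiplication m (phaseFunction (gauge lam lam')⁻¹) *
      schrodingerOp τ lam φ * multiplication m (phaseFunction (gauge lam lam')) := by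
  ext1 u
  have hS := stronglyIntegrable_schrodinger (m := m) τ lam (L1.integrable_coeFn φ)
  rw [mul_apply_eq_comp, mul_apply_eq_comp, schrodingerOp_apply, schrodingerOp_apply,
    ← (multiplication m (phaseFunction (gauge lam lam')⁻¹)).integral_comp_comm (hS.integrable _)]
  simp only [schrodingerKernel_gauge hlam hlam']

lemma weylIntegral_gauge (hlam : IsPseudoTrivialization ω lam)
    (hlam' : IsPseudoTrivialization ω lam') (μ : ComplexMeasure (PhaseSpace X)) :
    weylIntegral m τ lam' μ = multiplication m (phaseFunction (gauge lam lam')⁻¹) *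
      weylIntegral m τ lam μ * multiplication m (phaseFunction (gauge lam lam')) := by
  ext1 u
  refine ext_inner_left ℂ fun v => ?_
  rw [mul_apply_eq_comp, mul_apply_eq_comp,
    ← ContinuousLinearMap.adjoint_inner_left (multiplication m (phaseFunction (gauge lam lam')⁻¹)),
    inner_weylIntegral, inner_weylIntegral]
  simp only [weyl_gauge hlam hlam', ContinuousLinearMap.adjoint_inner_left]

lemma schrodingerHom_gauge (hlam : IsPseudoTrivialization ω lam)
    (hlam' : IsPseudoTrivialization ω lam') (a : symbolAlgebra ω τ m) :
    schrodingerHom m τ hlam' a = multiplication m (phaseFunction (gauge lam lam')⁻¹) *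
      schrodingerHom m τ hlam a * multiplication m (phaseFunction (gauge lam lam')) := by
  refine congr_fun (denseRange_ofL1.equalizer (continuous_starHom _)
    (g := fun a => schrodingerHom m τ hlam' a) (h := fun a =>
      multiplication m (phaseFunction (gauge lam lam')⁻¹) * schrodingerHom m τ hlam a *
        multiplication m (phaseFunction (gauge lam lam')))
    ((continuous_const.mul (continuous_starHom _)).mul continuous_const) (funext fun φ => ?_)) a
  simp only [Function.comp_apply, schrodingerHom_ofL1]
  exact schrodingerOp_gauge hlam hlam' φ

/-- The multiplier defined by the Weyl integral of a measure does not depend on the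
pseudo-trivialization: changing it amounts to a unitary conjugation. -/
lemma multiplier_weylIntegral (hlam : IsPseudoTrivialization ω lam)
    (hlam' : IsPseudoTrivialization ω lam') (μ : ComplexMeasure (PhaseSpace X)) :
    (isIdealRep_schrodingerHom (m := m) (τ := τ) hlam').multiplier (weylIntegral m τ lam' μ) =
      (isIdealRep_schrodingerHom (m := m) (τ := τ) hlam).multiplier (weylIntegral m τ lam μ) := by
  have hU : multiplication m (phaseFunction (gauge lam lam')) *
      multiplication m (phaseFunction (gauge lam lam')⁻¹) = 1 := by
    rw [phase_mul_phase, mul_inv_cancel, phase_one]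
  set U := multiplication m (phaseFunction (gauge lam lam'))
  set V := multiplication m (phaseFunction (gauge lam lam')⁻¹)
  have hVU : ∀ S T : Lp ℂ 2 m →L[ℂ] Lp ℂ 2 m, V * S * U * (V * T * U) = V * (S * T) * U :=
    fun S T => by
      calc V * S * U * (V * T * U) = V * S * (U * V) * (T * U) := by simp only [mul_assoc]
        _ = V * (S * T) * U := by rw [hU, mul_one]; simp only [mul_assoc]
  have h' := isIdealRep_schrodingerHom (m := m) (τ := τ) hlam'
  have h := isIdealRep_schrodingerHom (m := m) (τ := τ) hlam
  refine h'.multiplier_ext (fun a => ?_) fun a => ?_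
  · rw [h'.multiplier_fst, schrodingerHom_gauge hlam hlam' a, schrodingerHom_gauge hlam hlam',
      weylIntegral_gauge hlam hlam', h.multiplier_fst, hVU]
  · rw [h'.multiplier_snd, schrodingerHom_gauge hlam hlam' a, schrodingerHom_gauge hlam hlam',
      weylIntegral_gauge hlam hlam', h.multiplier_snd, hVU]

end PseudoTrivializations

/-! ### The embedding of the measure transforms into the multiplier algebra -/

section Embedding
variable {X : Type u} [AddCommGroup X] [TopologicalSpace X] [IsTopologicalAddGroup X]
  [LocallyCompactSpace X] [T2Space X] [SecondCountableTopology X]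
  [MeasurableSpace X] [BorelSpace X] {m : Measure X} [m.IsAddHaarMeasure]
  {ω : TwoCocycle X} {τ : X →ₜ+ X} {lam : C(X, C(X, Circle))}

/-- `∫ W(ξ) dμ(ξ)` and `F_Ξ μ` determine each other. -/
lemma weylIntegral_eq_zero_iff (μ : ComplexMeasure (PhaseSpace X)) :
    weylIntegral m τ lam μ = 0 ↔ symplecticFourier μ = 0 := by
  refine ⟨symplecticFourier_eq_zero_of_weylIntegral_eq_zero τ lam, fun h => ?_⟩
  rw [weylIntegral_eq_schrodingerOp τ lam (φ := 0) (by rw [h, map_zero]), map_zero]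

variable (m τ) in
/-- The multiplier of the symbol algebra that acts in the Schrödinger representation as
`∫ W(ξ) dμ(ξ)`. -/
def measureMultiplier (hlam : IsPseudoTrivialization ω lam) :
    ComplexMeasure (PhaseSpace X) →ₗ[ℂ] symbolMultipliers ω τ m :=
  (isIdealRep_schrodingerHom (m := m) (τ := τ) hlam).multiplier.toAlgHom.toLinearMap ∘ₗ
    weylIntegral m τ lam

lemma measureMultiplier_apply (hlam : IsPseudoTrivialization ω lam)
    (μ : ComplexMeasure (PhaseSpace X)) : measureMultiplier m τ hlam μ =
      (isIdealRep_schrodingerHom (m := m) (τ := τ) hlam).multiplier (weylIntegral m τ lam μ) := rfl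

lemma measureMultiplier_eq_zero_iff (hlam : IsPseudoTrivialization ω lam)
    (μ : ComplexMeasure (PhaseSpace X)) :
    measureMultiplier m τ hlam μ = 0 ↔ symplecticFourier μ = 0 := by
  have := nontrivial_L2 m
  rw [measureMultiplier_apply, ← weylIntegral_eq_zero_iff (m := m) (τ := τ) (lam := lam)]
  exact map_eq_zero_iff _ (isIdealRep_schrodingerHom hlam).multiplier_bijective.1

variable (m τ) in
/-- The embedding `F_Ξ μ ↦ ∫ W(ξ) dμ(ξ)` of `F_Ξ 𝕄(Ξ)` into the multiplier algebra. -/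
def transformEmbedding (hlam : IsPseudoTrivialization ω lam) :
    measureTransforms X →ₗ[ℂ] symbolMultipliers ω τ m :=
  (LinearMap.ker (symplecticFourier (X := X))).liftQ (measureMultiplier m τ hlam)
      (fun μ hμ => (measureMultiplier_eq_zero_iff hlam μ).2 hμ) ∘ₗ
    (symplecticFourier (X := X)).quotKerEquivRange.symm.toLinearMap

lemma transformEmbedding_measureTransform (hlam : IsPseudoTrivialization ω lam)
    (μ : ComplexMeasure (PhaseSpace X)) :
    transformEmbedding m τ hlam (measureTransform μ) = measureMultiplier m τ hlam μ := by
  have h : (symplecticFourier (X := X)).quotKerEquivRange.symm (measureTransform μ) =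
      (LinearMap.ker (symplecticFourier (X := X))).mkQ μ :=
    (symplecticFourier (X := X)).quotKerEquivRange_symm_apply_image μ ⟨μ, rfl⟩
  exact (congr_arg ((LinearMap.ker (symplecticFourier (X := X))).liftQ (measureMultiplier m τ hlam)
    (fun ν hν => (measureMultiplier_eq_zero_iff hlam ν).2 hν)) h).trans
    (Submodule.liftQ_apply _ _ _)

lemma measureTransform_surjective (F : measureTransforms X) : ∃ μ, measureTransform μ = F := by
  obtain ⟨_, μ, rfl⟩ := F
  exact ⟨μ, rfl⟩

lemma transformEmbedding_injective (hlam : IsPseudoTrivialization ω lam) :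
    Function.Injective (transformEmbedding m τ hlam) := by
  rw [injective_iff_map_eq_zero]
  intro F hF
  obtain ⟨μ, rfl⟩ := measureTransform_surjective F
  rw [transformEmbedding_measureTransform, measureMultiplier_eq_zero_iff] at hF
  exact Subtype.ext hF

lemma toMultipliers_symbol (φ : X →₁[m] C₀(X, ℂ)) :
    toMultipliers ω τ m (symbol m φ) = DoubleCentralizer.coe ℂ (ofL1 m ω τ φ) := rfl

/-- The embedding is consistent with the inclusion of the symbols in the multiplier algebra. -/
lemma transformEmbedding_eq_toMultipliers (hlam : IsPseudoTrivialization ω lam)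
    (F : measureTransforms X) (f : symbolSpace m)
    (h : (F : PhaseSpace X → ℂ) = (f : PhaseSpace X → ℂ)) :
    transformEmbedding m τ hlam F = toMultipliers ω τ m f := by
  obtain ⟨μ, rfl⟩ := measureTransform_surjective F
  obtain ⟨φ, rfl⟩ := symbol_surjective m f
  have hμ : symplecticFourier μ = partialFourier m φ := h
  rw [transformEmbedding_measureTransform, measureMultiplier_apply, toMultipliers_symbol,
    ← (isIdealRep_schrodingerHom hlam).multiplier_map, schrodingerHom_ofL1,
    weylIntegral_eq_schrodingerOp τ lam hμ]

/-- The embedding does not depend on the pseudo-trivialization. -/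
lemma transformEmbedding_eq {lam' : C(X, C(X, Circle))} (hlam : IsPseudoTrivialization ω lam)
    (hlam' : IsPseudoTrivialization ω lam') :
    transformEmbedding m τ hlam' = transformEmbedding m τ hlam := by
  ext1 F
  obtain ⟨μ, rfl⟩ := measureTransform_surjective F
  rw [transformEmbedding_measureTransform, transformEmbedding_measureTransform]
  exact multiplier_weylIntegral hlam hlam' μ

/-- A homomorphism of the multiplier algebra that extends the Schrödinger representation of the
symbols restricts to the Schrödinger representation of the symbol algebra: both are continuous, and
they agree on the dense image of `L¹(X; C₀(X))`. -/
lemma map_coe_eq_schrodingerHom (hlam : IsPseudoTrivialization ω lam)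
    (Φ : symbolMultipliers ω τ m →⋆ₐ[ℂ] (Lp ℂ 2 m →L[ℂ] Lp ℂ 2 m))
    (hΦ : ∀ (φ : X →₁[m] C₀(X, ℂ)) (u : Lp ℂ 2 m),
      Φ (toMultipliers ω τ m (symbol m φ)) u = schrodinger m τ lam φ u)
    (a : symbolAlgebra ω τ m) : Φ (DoubleCentralizer.coe ℂ a) = schrodingerHom m τ hlam a := by
  let c : symbolAlgebra ω τ m →⋆ₙₐ[ℂ] symbolMultipliers ω τ m := DoubleCentralizer.coeHom
  let Ψ : symbolAlgebra ω τ m →⋆ₙₐ[ℂ] (Lp ℂ 2 m →L[ℂ] Lp ℂ 2 m) :=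
    (Φ : symbolMultipliers ω τ m →⋆ₙₐ[ℂ] (Lp ℂ 2 m →L[ℂ] Lp ℂ 2 m)).comp c
  have h : (Ψ : symbolAlgebra ω τ m → _) = schrodingerHom m τ hlam := by
    refine denseRange_ofL1.equalizer (continuous_starHom Ψ) (continuous_starHom _)
      (funext fun φ => ContinuousLinearMap.ext fun u => ?_)
    exact (hΦ φ u).trans (by
      rw [schrodinger_eq, Function.comp_apply, schrodingerHom_ofL1])
  exact congr_fun h a

end Embedding

end
end TwistedWeyl

theorem proposition3p4 {X : Type*} [AddCommGroup X] [TopologicalSpace X]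
    [IsTopologicalAddGroup X] [LocallyCompactSpace X] [T2Space X] [SecondCountableTopology X]
    [MeasurableSpace X] [BorelSpace X] (m : Measure X) [m.IsAddHaarMeasure]
    (ω : TwoCocycle X) (τ : X →ₜ+ X) :
    -- the exponentials are the symplectic Fourier transforms of the Dirac measures
    (∀ ξ₀ : PhaseSpace X, symplecticFourier (VectorMeasure.dirac ξ₀ (1 : ℂ)) = exponential ξ₀) ∧
    -- the embedding of `F_Ξ 𝕄(Ξ)` into `𝒩`, which does not depend on a pseudo-trivialization
    ∃ J : measureTransforms X →ₗ[ℂ] symbolMultipliers ω τ m,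
      Function.Injective J ∧
      -- a function in both `F_Ξ 𝕄(Ξ)` and `𝔉 L¹(X; C₀(X))` is sent to its class in `ℭ ⊆ 𝒩`
      (∀ (F : measureTransforms X) (f : symbolSpace m),
        (F : PhaseSpace X → ℂ) = (f : PhaseSpace X → ℂ) → J F = toMultipliers ω τ m f) ∧
      ∀ lam : C(X, C(X, Circle)), IsPseudoTrivialization ω lam →
        ∃ Op : symbolMultipliers ω τ m →⋆ₐ[ℂ] (Lp ℂ 2 m →L[ℂ] Lp ℂ 2 m),
          -- `Op` is the unique extension to `𝒩` of the representation `Op^lam_τ` of `ℭ`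
          (∀ (φ : X →₁[m] C₀(X, ℂ)) (u : Lp ℂ 2 m),
            Op (toMultipliers ω τ m (symbol m φ)) u = schrodinger m τ lam φ u) ∧
          (∀ Op' : symbolMultipliers ω τ m →⋆ₐ[ℂ] (Lp ℂ 2 m →L[ℂ] Lp ℂ 2 m),
            (∀ (φ : X →₁[m] C₀(X, ℂ)) (u : Lp ℂ 2 m),
              Op' (toMultipliers ω τ m (symbol m φ)) u = schrodinger m τ lam φ u) → Op' = Op) ∧
          -- it is an isomorphism of `𝒩` onto `B(L²(X))`
          Function.Bijective Op ∧
          -- the weak integral formula on `F_Ξ 𝕄(Ξ)`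
          (∀ (μ : ComplexMeasure (PhaseSpace X)) (u v : Lp ℂ 2 m),
            inner ℂ v (Op (J (measureTransform μ)) u) =
              complexIntegral μ (fun ξ => inner ℂ v (weyl m τ lam ξ u))) ∧
          -- the exponentials are sent to the Weyl operators
          ∀ ξ₀ : PhaseSpace X,
            Op (J (measureTransform (VectorMeasure.dirac ξ₀ (1 : ℂ)))) = weyl m τ lam ξ₀ := by
  have := nontrivial_L2 m
  have hcan := isPseudoTrivialization_canonicalTrivialization ω
  refine ⟨symplecticFourier_dirac, transformEmbedding m τ hcan, transformEmbedding_injective hcan,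
    transformEmbedding_eq_toMultipliers hcan, fun lam hlam => ?_⟩
  have h := isIdealRep_schrodingerHom (m := m) (τ := τ) hlam
  let Op : symbolMultipliers ω τ m →⋆ₐ[ℂ] (Lp ℂ 2 m →L[ℂ] Lp ℂ 2 m) := h.extension
  have hOp : ∀ μ, Op (transformEmbedding m τ hcan (measureTransform μ)) =
      weylIntegral m τ lam μ := fun μ => by
    rw [transformEmbedding_eq hlam hcan, transformEmbedding_measureTransform]
    exact h.extension_multiplier _
  refine ⟨Op, fun φ u => ?_, fun Op' hOp' => ?_, h.extension.bijective, fun μ u v => ?_,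
    fun ξ₀ => ?_⟩
  · rw [schrodinger_eq, toMultipliers_symbol, ← schrodingerHom_ofL1 hlam]
    exact congr_arg (fun T => T u) (h.extension_coe (ofL1 m ω τ φ))
  · exact h.hom_ext (map_coe_eq_schrodingerHom hlam Op' hOp') h.extension_coe
  · rw [hOp, inner_weylIntegral]
  · rw [hOp, weylIntegral_dirac]
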